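/- **Setting.** An $H$-step process ($H\ge1$) has a finite hidden state space $\mathcal S=\bigsqcup_{h=1}^H\mathcal S_h$ with $M=\max_h|\mathcal S_h|$, an action set $\mathcal A$ of size $K\ge 1$, and a measurable observation space $\mathcal X$. The first state $s_1\in\mathcal S_1$ is fixed, and the next state $s_{h+1}\in\mathcal S_{h+1}$ is a deterministic function of $(s_h,a_h)$. At level $h$ the learner sees $x_h\sim O_{s_h}$, plays $a_h$ and receives $r_h\sim R(x_h,a_h)$. The hidden state is a.s. a measurable function of the observation (unknown to the learner), so the process is an MDP over $\mathcal X$. Almost surely $r_h\ge0$ and $\sum_{h=1}^H r_h\le1$. For $\pi=(\pi_1,\dots,\pi_H)$ with measurable $\pi_h:\mathcal X\to\mathcal A$ let $V^\pi=\mathbf E[\sum_h r_h\mid a_{1:H}\sim\pi]$, and $V^\star=\sup_\pi V^\pi$. Let $\mathcal G$ be a finite class of measurable functions $\mathcal X\to[0,1]$ and $\Pi$ a finite class of measurable functions $\mathcal X\to\mathcal A$; put $\mathcal G_h=\mathcal G$ for $h\le H$ and $\mathcal G_{H+1}=\{0\}$. *Policy-value completeness*: for all $h\le H$ and $g'\in\mathcal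 G_{h+1}$ there are $\pi\in\Pi$ and $g\in\mathcal G$ such that for (almost) every observation $x$ at level $h$, $\pi(x)\in\operatorname{argmax}_a \mathbf E[r_h+g'(x_{h+1})\mid x_h=x,a_h=a]$ and $g(x)$ is the maximal value. **Algorithm** (inputs $M,H,K,\epsilon,\mathcal G,\Pi$; parameters $\tau\in\mathbb R$, $n_{\rm train},n_{\rm eval},n_{\rm exp}\in\mathbb N$). It keeps lists $\mathcal D^{\rm learned}_h,\mathcal D^{\rm val}_h$ of data sets, initially empty; $\hat{\mathbf E}_D$ denotes the empirical mean over a data set $D$. *dfslearn*$(a_{1:h-1})$, for $h\le H$: collect a data set $\tilde D$ of $n_{\rm train}$ transitions $(x_h,a_h,r_h,x_{h+1})$, one per trajectory, by playing $a_{1:h-1}$ and then a uniformly random $a_h$. Let $d=\min_{D\in\mathcal D^{\rm val}_h}\sup_{g\in\mathcal G}|\hat{\mathbf E}_D[g(x_h)]-\hat{\mathbf E}_{\tilde D}[g(x_h)]|$ ($+\infty$ if $\mathcal D^{\rm val}_h=\emptyset$). If $d\le2\tau$ and the call is recursive, return. Otherwise add $\tilde D$ to $\mathcal D^{\rm val}_h$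 if $d>2\tau$, add $\tilde D$ to $\mathcal D^{\rm learned}_h$ in any case, and call dfslearn$(a_{1:h-1}\circ a)$ recursively for every $a\in\mathcal A$. (Calls with $h=H+1$ do nothing.) *polval*: starting from $\hat g_{H+1}=0$, for $h=H,\dots,1$ let $\hat\pi_h$ maximize $\sum_{D\in\mathcal D_h^{\rm learned}}\hat{\mathbf E}_D[K\mathbf 1\{\pi(x_h)=a_h\}(r_h+\hat g_{h+1}(x_{h+1}))]$ over $\pi\in\Pi$, and let $\hat g_h$ minimize $\sum_{D\in\mathcal D_h^{\rm val}}\hat{\mathbf E}_D[K\mathbf 1\{\hat\pi_h(x_h)=a_h\}(g(x_h)-r_h-\hat g_{h+1}(x_{h+1}))^2]$ over $g\in\mathcal G$ (exactly; ties are broken by any measurable rule). Return $\hat\pi=\hat\pi_{1:H}$ and $\hat V=\hat{\mathbf E}_D[\hat g_1(x_1)]$, where $D$ is the first data set in $\mathcal D_1^{\rm val}$. *Main program*: call dfslearn$(\varnothing)$ non-recursively. Then repeat at most $MH$ times: run polval; sample $n_{\rm eval}$ trajectories with $\hat\pi$; if $\hat V$ is at most their average return plus $\epsilon/2$, return $\hat\pi$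 and stop; otherwise make the non-recursive calls dfslearn$(a_{1:h})$ for all $h=1,\dots,H-1$ and for the action sequences of the first $\min(n_{\rm exp},n_{\rm eval})$ of these trajectories. If the loop ends without returning, report failure. **Theorem.** There are absolute constants $C$ and $q$ such that for all $M,H,K\ge1$, all $\epsilon,\delta\in(0,1)$ and all class sizes $|\mathcal G|,|\Pi|$ the parameters $\tau,n_{\rm train},n_{\rm eval},n_{\rm exp}$ can be chosen, depending only on $(M,H,K,\epsilon,\delta,|\mathcal G|,|\Pi|)$, so that the following holds. For every process as above and all classes $\mathcal G,\Pi$ of these sizes that satisfy policy-value completeness, with probability at least $1-\delta$ the algorithm returns a policy $\hat\pi$ with $V^\star-V^{\hat\pi}\le\epsilon$ after collecting at most $$C\,\frac{M^5H^{12}K^4}{\epsilon^7}\Bigl(1+\log\frac{|\mathcal G||\Pi|}{\delta}\Bigr)\Bigl(1+\log\frac1\delta\Bigr)^3\Bigl(1+\log\frac{MKH}{\epsilon}\Bigr)^q$$ trajectories, that is, $\tilde O\bigl(\frac{M^5H^{12}K^4}{\epsilon^7}\log(|\mathcal G||\Pi|/\delta)\log^3(1/\delta)\bigr)$, where $\tilde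 O$ suppresses factors logarithmic in $M,K,H,1/\epsilon$. -/

import Mathlib

open MeasureTheory ProbabilityTheory

noncomputable section

namespace TwoSampleRL

/-! ## The environment -/

/-- An `H`-step Markovian contextual decision process with `K` actions, finitely many hidden states
`S`, observations `X`, and deterministic hidden-state dynamics. Levels are numbered `0, …, H - 1`.

* Every hidden state lives at exactly one level; `step s a` is the successor of `s` under `a`
  (it plays no role when `s` is at the last level).
* `emit s` is the emission distribution of `s`.
* The hidden state can be recovered from the observation by `decode`, so that observations are
  Markov states and the process is an MDP over `X`. The learner has no access to `decode`.
* `reward (x, a)` is the distribution of the reward of action `a` under observation `x`. -/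
structure DetCDP (H K : ℕ) (S X : Type*) [MeasurableSpace X] where
  level : S → ℕ
  level_lt : ∀ s, level s < H
  init : S
  level_init : level init = 0
  step : S → Fin K → S
  level_step : ∀ s a, level s + 1 < H → level (step s a) = level s + 1
  emit : S → Measure X
  emit_prob : ∀ s, IsProbabilityMeasure (emit s)
  decode : X → S
  measurableSet_decode : ∀ s, MeasurableSet {x | decode x = s}
  decode_emit : ∀ s, ∀ᵐ x ∂(emit s), decode x = s
  reward : Kernel (X × Fin K) ℝ
  reward_markov : IsMarkovKernel reward

attribute [instance] DetCDP.emit_prob DetCDP.reward_markov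

/-- Given an observation `x`, the law of a vector of rewards, one for each action, whose `a`-th
entry has law `R (x, a)`. In an episode only the entry of the chosen action is ever revealed. -/
def rewardVector {K : ℕ} {X : Type*} [MeasurableSpace X]
    (R : Kernel (X × Fin K) ℝ) [IsMarkovKernel R] : Kernel X (Fin K → ℝ) where
  toFun x := Measure.pi fun a => R (x, a)
  measurable' := by
    refine Measurable.measure_of_isPiSystem_of_isProbabilityMeasure
      generateFrom_pi.symm isPiSystem_pi ?_
    rintro _ ⟨t, ht, rfl⟩
    simp only [Measure.pi_pi]
    refine Finset.measurable_prod _ fun a _ => ?_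
    exact (R.measurable_coe (ht a (Set.mem_univ a))).comp measurable_prodMk_right

instance {K : ℕ} {X : Type*} [MeasurableSpace X]
    (R : Kernel (X × Fin K) ℝ) [IsMarkovKernel R] : IsMarkovKernel (rewardVector R) :=
  ⟨fun x => inferInstanceAs (IsProbabilityMeasure (Measure.pi fun a => R (x, a)))⟩

/-- The exogenous randomness of one episode: for every hidden state, the observation it emits and
the reward of every action there, together with one uniformly random action for the learner.
Since a state is visited at most once per episode, a trajectory is a function of this randomness
and of the actions chosen. -/
abbrev Episode (K : ℕ) (S X : Type*) : Type _ := (S → X × (Fin K → ℝ)) × Fin K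

/-- Data recorded by the learner at one level: observation, action, reward, next observation. -/
abbrev Sample (K : ℕ) (X : Type*) : Type _ := X × Fin K × ℝ × X

abbrev Dataset (K : ℕ) (X : Type*) (n : ℕ) : Type _ := Fin n → Sample K X

/-- A nonstationary policy; the `h`-th component acts at level `h`. -/
abbrev Policy (K : ℕ) (X : Type*) : Type _ := ℕ → X → Fin K

namespace DetCDP

variable {H K : ℕ} {S X : Type*} [MeasurableSpace X]

/-- The number `M` of hidden states at the largest level. -/
def width [Fintype S] (E : DetCDP H K S X) : ℕ :=
  (Finset.range H).sup fun h => (Finset.univ.filter fun s => E.level s = h).card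

/-- The law of the exogenous randomness of one episode. -/
def episodeLaw [Fintype S] (E : DetCDP H K S X) : Measure (Episode K S X) :=
  (Measure.pi fun s => (E.emit s) ⊗ₘ (rewardVector E.reward)).prod (uniformOn Set.univ)

instance [Fintype S] [NeZero K] (E : DetCDP H K S X) : IsProbabilityMeasure E.episodeLaw := by
  have : IsProbabilityMeasure (uniformOn (Set.univ : Set (Fin K))) :=
    isProbabilityMeasure_uniformOn Set.finite_univ Set.univ_nonempty
  unfold episodeLaw
  infer_instance

/-- The law of an infinite sequence of independent episodes. -/
def tapeLaw [Fintype S] [NeZero K] (E : DetCDP H K S X) : Measure (ℕ → Episode K S X) :=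
  Measure.infinitePi fun _ => E.episodeLaw

/-- The hidden state at level `h` of the trajectory produced by the policy `π`. -/
def stateAt (E : DetCDP H K S X) (e : Episode K S X) (π : Policy K X) : ℕ → S
  | 0 => E.init
  | h + 1 => E.step (stateAt E e π h) (π h (e.1 (stateAt E e π h)).1)

/-- Observation, action and reward at level `h` of the trajectory produced by `π`. -/
def trajectory (E : DetCDP H K S X) (e : Episode K S X) (π : Policy K X) (h : ℕ) :
    X × Fin K × ℝ :=
  let o := e.1 (E.stateAt e π h)
  (o.1, π h o.1, o.2 (π h o.1))

/-- The value `V^π`: the expected sum of rewards. -/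
def value [Fintype S] (E : DetCDP H K S X) (π : Policy K X) : ℝ :=
  ∫ e, ∑ h ∈ Finset.range H, (E.trajectory e π h).2.2 ∂E.episodeLaw

/-- The optimal value `V^⋆`. -/
def optimalValue [Fintype S] (E : DetCDP H K S X) : ℝ :=
  sSup {v | ∃ π : Policy K X, (∀ h, Measurable (π h)) ∧ E.value π = v}

/-- Regularity of the rewards: whichever actions are taken, almost surely all rewards are
nonnegative and their sum is at most one. -/
def RegularRewards [Fintype S] (E : DetCDP H K S X) : Prop :=
  ∀ a : ℕ → Fin K, ∀ᵐ e ∂E.episodeLaw,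
    (∀ h < H, 0 ≤ (E.trajectory e (fun h _ => a h) h).2.2) ∧
      ∑ h ∈ Finset.range H, (E.trajectory e (fun h _ => a h) h).2.2 ≤ 1

/-- `E[r + g'(x') | x, a]`. -/
def backup (E : DetCDP H K S X) (g' : X → ℝ) (x : X) (a : Fin K) : ℝ :=
  (∫ r, r ∂E.reward (x, a)) + ∫ x', g' x' ∂E.emit (E.step (E.decode x) a)

/-- Policy-value completeness of the classes `G`, `P`. The value class is `G` at the levels of the
process and `{0}` after the last level. The conditions on observations are imposed almost surely
under the emission of each hidden state at the level concerned. -/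
def PolicyValueComplete (E : DetCDP H K S X) (G : Finset (X → ℝ)) (P : Finset (X → Fin K)) : Prop :=
  ∀ h < H, ∀ g' ∈ (if h + 1 < H then (G : Set (X → ℝ)) else {fun _ => 0}),
    ∃ π ∈ P, ∃ g ∈ G, ∀ s, E.level s = h → ∀ᵐ x ∂E.emit s,
      (∀ a, E.backup g' x a ≤ E.backup g' x (π x)) ∧ g x = E.backup g' x (π x)

end DetCDP

/-! ## What the learner sees -/

/-- The learner's access to the environment; `t` is the index of the episode.
* `explore t p`: play the action sequence `p`, then a uniformly random action; record the last
  transition. (If `p` ends at the last level, the next observation is a meaningless placeholder.)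
* `rollout t π`: play `π` and record the trajectory. -/
structure Access (K : ℕ) (X : Type*) where
  explore : ℕ → List (Fin K) → Sample K X
  rollout : ℕ → Policy K X → ℕ → X × Fin K × ℝ

/-- Access to a process, with episode `t` driven by the independent randomness `ω t`. -/
def DetCDP.access {H K : ℕ} {S X : Type*} [MeasurableSpace X] (E : DetCDP H K S X)
    (ω : ℕ → Episode K S X) : Access K X where
  explore t p :=
    let s := p.foldl E.step E.init
    let a := (ω t).2
    (((ω t).1 s).1, a, ((ω t).1 s).2 a, ((ω t).1 (E.step s a)).1)
  rollout t π := E.trajectory (ω t) π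

/-! ## Empirical objectives and optimization oracles -/

section Objectives

variable {K n : ℕ} {X : Type*}

/-- The empirical expectation over a data set. -/
def empMean (D : Dataset K X n) (f : Sample K X → ℝ) : ℝ := (∑ i, f (D i)) / n

/-- `V_D(π; g')`. -/
def policyObj (D : Dataset K X n) (g' : X → ℝ) (π : X → Fin K) : ℝ :=
  empMean D fun ⟨x, a, r, x'⟩ => if π x = a then K * (r + g' x') else 0

/-- `L_D(g; π, g')`. -/
def valueLoss (D : Dataset K X n) (π : X → Fin K) (g' g : X → ℝ) : ℝ :=
  empMean D fun ⟨x, a, r, x'⟩ => if π x = a then K * (g x - r - g' x') ^ 2 else 0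

/-- The empirical maximum mean discrepancy of two data sets with respect to `G`. -/
def mmd (G : Finset (X → ℝ)) (D D' : Dataset K X n) : ℝ :=
  ⨆ g : G, |empMean D (fun z => g.1 z.1) - empMean D' (fun z => g.1 z.1)|

/-- Exact optimization oracles for the two empirical problems of the algorithm. Ties may be broken
in any way that depends measurably on the data. -/
structure Oracles (K n : ℕ) {X : Type*} [MeasurableSpace X]
    (G : Finset (X → ℝ)) (P : Finset (X → Fin K)) where
  policy : List (Dataset K X n) → (X → ℝ) → X → Fin K
  policy_mem : ∀ (L : List (Dataset K X n)) (g' : X → ℝ), policy L g' ∈ P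
  policy_max : ∀ (L : List (Dataset K X n)) (g' : X → ℝ), ∀ π ∈ P,
    (L.map fun D => policyObj D g' π).sum ≤ (L.map fun D => policyObj D g' (policy L g')).sum
  policy_meas : ∀ (m : ℕ) (g' : X → ℝ), Measurable g' → ∀ π ∈ P,
    MeasurableSet {d : Fin m → Dataset K X n | policy (List.ofFn d) g' = π}
  value : List (Dataset K X n) → (X → Fin K) → (X → ℝ) → X → ℝ
  value_mem : ∀ (L : List (Dataset K X n)) (π : X → Fin K) (g' : X → ℝ), value L π g' ∈ G
  value_min : ∀ (L : List (Dataset K X n)) (π : X → Fin K) (g' : X → ℝ), ∀ g ∈ G,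
    (L.map fun D => valueLoss D π g' (value L π g')).sum ≤ (L.map fun D => valueLoss D π g' g).sum
  value_meas : ∀ (m : ℕ) (π : X → Fin K) (g' : X → ℝ), Measurable π → Measurable g' → ∀ g ∈ G,
    MeasurableSet {d : Fin m → Dataset K X n | value (List.ofFn d) π g' = g}

end Objectives

/-! ## The algorithm -/

/-- The tuning parameters: test threshold `τ` and sample sizes. -/
structure Params where
  τ : ℝ
  nTrain : ℕ
  nEval : ℕ
  nExp : ℕ

/-- The global memory: for every level the data sets in `D^learned` and in `D^val`, and the number
of trajectories collected so far. -/
structure Memory (K : ℕ) (X : Type*) (n : ℕ) where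
  learned : ℕ → List (Dataset K X n)
  val : ℕ → List (Dataset K X n)
  used : ℕ

section Algorithm

variable {K : ℕ} {X : Type*} [MeasurableSpace X]

open Classical in
/-- The depth-first search routine, called on the path `p` with `d = H - p.length` levels left;
`isRec` tells whether the call is recursive. Nothing is done after the last level. -/
def dfsLearn (acc : Access K X) (G : Finset (X → ℝ)) (θ : Params) :
    (d : ℕ) → (p : List (Fin K)) → (isRec : Bool) →
      Memory K X θ.nTrain → Memory K X θ.nTrain
  | 0, _, _, m => m
  | d + 1, p, isRec, m =>
    let h := p.length
    let D : Dataset K X θ.nTrain := fun i => acc.explore (m.used + i) p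
    let m₁ := { m with used := m.used + θ.nTrain }
    let seen : Prop := ∃ D' ∈ m.val h, mmd G D' D ≤ 2 * θ.τ
    if seen ∧ isRec = true then m₁
    else
      let m₂ := if seen then m₁
        else { m₁ with val := Function.update m₁.val h (m₁.val h ++ [D]) }
      let m₃ := { m₂ with learned := Function.update m₂.learned h (m₂.learned h ++ [D]) }
      (List.finRange K).foldl (fun m' a => dfsLearn acc G θ d (p ++ [a]) true m') m₃

variable {G : Finset (X → ℝ)} {P : Finset (X → Fin K)}

/-- The fitted value function `d` levels before the end of the process, i.e. at level `H - d`;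
it is `0` after the last level. -/
def fittedValue {n : ℕ} (H : ℕ) (O : Oracles K n G P) (m : Memory K X n) : ℕ → X → ℝ
  | 0 => fun _ => 0
  | d + 1 =>
    let g' := fittedValue H O m d
    let h := H - (d + 1)
    O.value (m.val h) (O.policy (m.learned h) g') g'

/-- The fitted policy. -/
def fittedPolicy {n : ℕ} (H : ℕ) (O : Oracles K n G P) (m : Memory K X n) : Policy K X :=
  fun h => O.policy (m.learned h) (fittedValue H O m (H - (h + 1)))

/-- The estimate of the optimal value, from the first data set for the root. -/
def fittedOptimum {n : ℕ} (H : ℕ) (O : Oracles K n G P) (m : Memory K X n) : ℝ :=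
  match m.val 0 with
  | [] => 0
  | D :: _ => empMean D fun z => fittedValue H O m H z.1

open Classical in
/-- The main loop, with a given number of iterations left. It returns a policy, or `none` for
failure, and the total number of trajectories collected. -/
def mainLoop (acc : Access K X) (H : ℕ) (ε : ℝ) (θ : Params) (O : Oracles K θ.nTrain G P) :
    ℕ → Memory K X θ.nTrain → Option (Policy K X) × ℕ
  | 0, m => (none, m.used)
  | k + 1, m =>
    let π := fittedPolicy H O m
    let T : ℕ → ℕ → X × Fin K × ℝ := fun i => acc.rollout (m.used + i) π
    let m₁ := { m with used := m.used + θ.nEval }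
    let avg : ℝ :=
      (∑ i ∈ Finset.range θ.nEval, ∑ h ∈ Finset.range H, (T i h).2.2) / θ.nEval
    if fittedOptimum H O m ≤ avg + ε / 2 then (some π, m₁.used)
    else
      let m₂ := (List.range' 1 (H - 1)).foldl (fun m' h =>
        (List.range (min θ.nExp θ.nEval)).foldl (fun m'' i =>
          dfsLearn acc G θ (H - h) ((List.range h).map fun j => (T i j).2.1) false m'') m') m₁
      mainLoop acc H ε θ O k m₂

/-- The complete algorithm. The input `M` only determines the number `M * H` of iterations. -/
def runAlgorithm (acc : Access K X) (M H : ℕ) (ε : ℝ) (θ : Params) (O : Oracles K θ.nTrain G P) :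
    Option (Policy K X) × ℕ :=
  mainLoop acc H ε θ O (M * H)
    (dfsLearn acc G θ H [] false { learned := fun _ => [], val := fun _ => [], used := 0 })

end Algorithm

end TwoSampleRL

end

/-! Transitions are deterministic, so a training data set is determined by the hidden state in which
it is collected and by the block of episodes it uses. An `Episode` carries the observations and
rewards of every hidden state at once. Hence for each block and each state the data set `dataAt`
exists whether or not it is collected, and the adaptive choices of the algorithm only select among
these. A plain union bound over the `B` possible blocks, the at most M·H states and the finite set
`testFunctions` makes all empirical objectives accurate up to τ (`Concentrated`). Here `B` is a
worst-case count, exponential in H; only its logarithm matters, so it costs one factor of H in the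
sample size.

On this event the search and the regression are analysed deterministically. Data sets from one state
pass the two-sample test, so a level never holds more than M validation data sets. The K recursive
calls of a search are paid for either by a new validation data set or by a non-recursive call
(`Advances`, `advances_dfsLearn`), which makes the actual cost polynomial. Every state with learning
data is `Known`, and so are its successors: on the value class each resembles a state with
validation data.

The oracles optimize sums over data sets. The population excesses are nonnegative, so each one is at
most the number of data sets times 2τ (`Concentrated.fit`). Backward induction over the levels then
shows that V̂ is nearly an upper bound of V⋆. Telescoping along trajectories
(`RegularRewards.le_value`) shows that the value of the fitted policy is at least V̂ minus a small
error minus the probability of leaving the learned states (`Concentrated.regret`).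

So acceptance implies near-optimality, and rejection implies that the policy leaves the learned
states with probability at least ε/4. One of the first `nExp` trajectories then does so, and a new
state is learned. There are at most M·H states, so the loop returns in time
(`runAlgorithm_correct`).

One adaptive probabilistic claim remains: an evaluation is representative for a policy computed from
earlier data, at a random time. The sample space is cut into countably many pieces on which the
time, the policy and the learned states are constant and determined by the past (`Glued`,
`AdaptedOn`). On each piece the evaluation block is independent of the past
(`measure_not_representative_le`). -/

noncomputable section
namespace TwoSampleRL

/-! ### Independence and concentration under product measures. -/

section Tools

variable {ι : Type*} {Y : ι → Type*} [∀ i, MeasurableSpace (Y i)]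

/-- Functions of disjoint finite families of coordinates are independent under a product measure. -/
theorem indepFun_of_dependsOn {β γ : Type*} [MeasurableSpace β] [MeasurableSpace γ]
    (μ : ∀ i, Measure (Y i)) [∀ i, IsProbabilityMeasure (μ i)]
    {s t : Finset ι} (hst : Disjoint s t) {F : (∀ i, Y i) → β} {G : (∀ i, Y i) → γ}
    (hF : Measurable F) (hG : Measurable G) (hFs : DependsOn F s) (hGt : DependsOn G t) :
    IndepFun F G (Measure.infinitePi μ) := by
  classical
  have hne : Nonempty (∀ i, Y i) :=
    ⟨fun i => (nonempty_of_isProbabilityMeasure (μ i)).some⟩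
  obtain ⟨x₀⟩ := hne
  -- Filling the coordinates outside `u` with `x₀` factors `F` and `G` through the restrictions to
  -- `s` and `t`, which are independent.
  let ext (u : Finset ι) (y : ∀ i : u, Y i) : ∀ i, Y i :=
    fun i => if h : i ∈ u then y ⟨i, h⟩ else x₀ i
  have hext : ∀ u, Measurable (ext u) := by
    intro u
    refine measurable_pi_lambda _ fun i => ?_
    by_cases h : i ∈ u
    · simpa [ext, h] using measurable_pi_apply (⟨i, h⟩ : u)
    · simp [ext, h]
  have key := (iIndepFun_infinitePi (P := μ) (X := fun _ ω => ω)
    (fun _ => measurable_id)).indepFun_finset s t hst (fun i => measurable_pi_apply i)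
  have h2 := key.comp (hF.comp (hext s)) (hG.comp (hext t))
  have e1 : (F ∘ ext s) ∘ (fun a (i : s) => a i) = F := by
    funext ω
    refine hFs fun i hi => ?_
    have : i ∈ s := hi
    simp [ext, this]
  have e2 : (G ∘ ext t) ∘ (fun a (i : t) => a i) = G := by
    funext ω
    refine hGt fun i hi => ?_
    have : i ∈ t := hi
    simp [ext, this]
  rw [e1, e2] at h2
  exact h2

end Tools

section Sequences

variable {Y : Type*} [MeasurableSpace Y] (μ : Measure Y) [IsProbabilityMeasure μ]

/-- Two-sided Hoeffding inequality for a block of coordinates of an i.i.d. sequence. -/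
theorem hoeffding_block {f : Y → ℝ} (hf : Measurable f) {b : ℝ} (hb : 0 < b)
    (hfb : ∀ᵐ y ∂μ, f y ∈ Set.Icc 0 b) {n : ℕ} (hn : 0 < n) (t : ℕ) {η : ℝ} (hη : 0 ≤ η) :
    Measure.infinitePi (fun _ : ℕ => μ)
      {ω | η < |(∑ i ∈ Finset.range n, f (ω (t + i))) / n - ∫ y, f y ∂μ|} ≤
      ENNReal.ofReal (2 * Real.exp (-(2 * n * η ^ 2 / b ^ 2))) := by
  set P := Measure.infinitePi (fun _ : ℕ => μ)
  have hmp : ∀ i : ℕ, MeasurePreserving (fun ω : ℕ → Y => ω i) P μ := fun i =>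
    measurePreserving_eval_infinitePi (fun _ : ℕ => μ) i
  have hind : iIndepFun (fun (i : ℕ) (ω : ℕ → Y) => f (ω (t + i)) - ∫ y, f y ∂μ) P := by
    have h0 := iIndepFun_infinitePi (P := fun _ : ℕ => μ) (X := fun _ y => f y - ∫ y, f y ∂μ)
      (fun _ => hf.sub_const _)
    exact h0.precomp (g := fun i => t + i) (fun a b h => by simpa using h)
  -- Hoeffding's lemma: a variable in an interval of length `b` is subgaussian with variance proxy
  -- `b ^ 2 / 4`. An almost sure bound suffices.
  have hsub : ∀ i : ℕ, HasSubgaussianMGF (fun ω : ℕ → Y => f (ω (t + i)) - ∫ y, f y ∂μ)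
      ((‖b - 0‖₊ / 2) ^ 2) P := by
    intro i
    have h1 := hasSubgaussianMGF_of_mem_Icc (μ := P) (X := fun ω => f (ω (t + i)))
      (a := 0) (b := b) ((hf.comp (measurable_pi_apply _)).aemeasurable)
      ((hmp (t + i)).quasiMeasurePreserving.ae hfb)
    have h2 : ∫ ω, f (ω (t + i)) ∂P = ∫ y, f y ∂μ := by
      rw [← (hmp (t + i)).map_eq, integral_map (hmp _).measurable.aemeasurable
        hf.aestronglyMeasurable]
    rwa [h2] at h1
  have hn' : (0 : ℝ) < n := by exact_mod_cast hn
  have hbn : ((‖b - 0‖₊ / 2 : NNReal) ^ 2 : NNReal).toReal = b ^ 2 / 4 := by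
    simp only [sub_zero, NNReal.coe_pow, NNReal.coe_div, coe_nnnorm, Real.norm_eq_abs,
      NNReal.coe_ofNat, div_pow, sq_abs]
    norm_num
  have hexp : -(n * η) ^ 2 / (2 * n * (((‖b - 0‖₊ / 2 : NNReal) ^ 2 : NNReal) : ℝ)) =
      -(2 * n * η ^ 2 / b ^ 2) := by
    rw [hbn]; field_simp; ring
  have hup := HasSubgaussianMGF.measure_sum_range_ge_le_of_iIndepFun hind (n := n)
    (fun i _ => hsub i) (ε := n * η) (by positivity)
  have hlo := HasSubgaussianMGF.measure_sum_range_ge_le_of_iIndepFun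
    (X := fun i (ω : ℕ → Y) => -(f (ω (t + i)) - ∫ y, f y ∂μ))
    (hind.comp (fun _ x => -x) (fun _ => measurable_neg)) (n := n)
    (fun i _ => (hsub i).neg) (ε := n * η) (by positivity)
  rw [hexp] at hup hlo
  have hsum : ∀ ω : ℕ → Y, ∑ i ∈ Finset.range n, (f (ω (t + i)) - ∫ y, f y ∂μ) =
      n * ((∑ i ∈ Finset.range n, f (ω (t + i))) / n - ∫ y, f y ∂μ) := by
    intro ω
    rw [Finset.sum_sub_distrib]
    simp only [Finset.sum_const, Finset.card_range, nsmul_eq_mul]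
    field_simp
  have hcov : {ω : ℕ → Y | η < |(∑ i ∈ Finset.range n, f (ω (t + i))) / n - ∫ y, f y ∂μ|} ⊆
      {ω | n * η ≤ ∑ i ∈ Finset.range n, (f (ω (t + i)) - ∫ y, f y ∂μ)} ∪
      {ω | n * η ≤ ∑ i ∈ Finset.range n, -(f (ω (t + i)) - ∫ y, f y ∂μ)} := by
    intro ω hω
    simp only [Set.mem_ofPred_eq, Set.mem_union, Finset.sum_neg_distrib, hsum] at hω ⊢
    rcases lt_abs.1 hω with h | h
    · left; gcongr
    · right
      rw [← mul_neg]; gcongr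
  calc P _ ≤ P _ := measure_mono hcov
    _ ≤ _ := measure_union_le _ _
    _ ≤ ENNReal.ofReal (Real.exp (-(2 * n * η ^ 2 / b ^ 2))) +
        ENNReal.ofReal (Real.exp (-(2 * n * η ^ 2 / b ^ 2))) := by
      gcongr
      · rw [← ofReal_measureReal]; exact ENNReal.ofReal_le_ofReal hup
      · rw [← ofReal_measureReal]; exact ENNReal.ofReal_le_ofReal hlo
    _ = _ := by rw [← ENNReal.ofReal_add (by positivity) (by positivity)]; congr 1; ring

/-- An event about a block of coordinates is independent of the earlier coordinates. -/
theorem measure_inter_block {A : Set (ℕ → Y)} (hA : MeasurableSet A) {t : ℕ}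
    (hAt : ∀ ω ω' : ℕ → Y, (∀ i < t, ω i = ω' i) → ω ∈ A → ω' ∈ A) {n : ℕ}
    {B : Set (ℕ → Y)} (hB : MeasurableSet B)
    (hBt : ∀ ω ω' : ℕ → Y, (∀ i < n, ω (t + i) = ω' (t + i)) → ω ∈ B → ω' ∈ B) :
    Measure.infinitePi (fun _ : ℕ => μ) (A ∩ B) =
      Measure.infinitePi (fun _ : ℕ => μ) A * Measure.infinitePi (fun _ : ℕ => μ) B := by
  have h := indepFun_of_dependsOn (fun _ : ℕ => μ)
    (s := Finset.range t) (t := (Finset.range n).image (t + ·))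
    (by
      rw [Finset.disjoint_left]
      intro a ha hb
      simp only [Finset.mem_range, Finset.mem_image] at ha hb
      obtain ⟨i, _, rfl⟩ := hb
      omega)
    (F := fun ω => ω ∈ A) (G := fun ω => ω ∈ B) hA.mem hB.mem
    (fun ω ω' h => by
      refine propext ⟨hAt ω ω' fun i hi => h i (by simpa using hi),
        hAt ω' ω fun i hi => (h i (by simpa using hi)).symm⟩)
    (fun ω ω' h => by
      refine propext ⟨hBt ω ω' fun i hi => h _ ?_, hBt ω' ω fun i hi => (h _ ?_).symm⟩ <;>
      exact Finset.mem_coe.2 (Finset.mem_image_of_mem _ (Finset.mem_range.2 hi)))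
  have := h.measure_inter_preimage_eq_mul {True} {True} trivial trivial
  have e : ∀ C : Set (ℕ → Y), (fun ω => ω ∈ C) ⁻¹' {True} = C := by
    intro C; ext ω; simp
  rwa [e, e] at this

/-- All coordinates of a block avoid an event. -/
theorem measure_block_forall {C : Set Y} (t n : ℕ) (hC : MeasurableSet C) :
    Measure.infinitePi (fun _ : ℕ => μ) {ω | ∀ i < n, ω (t + i) ∈ C} = μ C ^ n := by
  have h := Measure.infinitePi_pi (μ := fun _ : ℕ => μ)
    (s := (Finset.range n).image (t + ·)) (t := fun _ => C) (fun _ _ => hC)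
  rw [Finset.prod_const, Finset.card_image_of_injective _ (add_right_injective t),
    Finset.card_range] at h
  rw [← h]
  congr 1
  ext ω
  simp [Set.mem_pi]

end Sequences
end TwoSampleRL

end

/-! ### Paths in the process, their measurability, and independence between states. -/

noncomputable section
namespace TwoSampleRL

namespace DetCDP

variable {H K : ℕ} {S X : Type*} [MeasurableSpace X] (E : DetCDP H K S X)

/-- The joint law of the observation and the rewards of all actions in state `s`. -/
def stateLaw (s : S) : Measure (X × (Fin K → ℝ)) := E.emit s ⊗ₘ rewardVector E.reward

instance (s : S) : IsProbabilityMeasure (E.stateLaw s) := by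
  unfold stateLaw; infer_instance

/-- The law of the observations and rewards of all states. -/
def obsLaw [Fintype S] : Measure (S → X × (Fin K → ℝ)) := Measure.pi E.stateLaw

instance [Fintype S] : IsProbabilityMeasure E.obsLaw := by
  unfold obsLaw; infer_instance

/-- States that some action sequence leads to. -/
def Reachable (s : S) : Prop :=
  ∃ p : List (Fin K), p.length = E.level s ∧ p.foldl E.step E.init = s

theorem level_foldl (p : List (Fin K)) (hp : p.length < H) :
    E.level (p.foldl E.step E.init) = p.length := by
  induction p using List.reverseRecOn with
  | nil => simpa using E.level_init
  | append_singleton p a ih =>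
    simp only [List.length_append, List.length_singleton] at hp
    rw [List.foldl_append]
    simp only [List.foldl_cons, List.foldl_nil, List.length_append, List.length_singleton]
    rw [E.level_step _ _ (by rw [ih (by omega)]; omega), ih (by omega)]

theorem reachable_foldl (p : List (Fin K)) (hp : p.length < H) :
    E.Reachable (p.foldl E.step E.init) := ⟨p, (E.level_foldl p hp).symm, rfl⟩

theorem Reachable.eq_init {s : S} (hs : E.Reachable s) (h : E.level s = 0) : s = E.init := by
  obtain ⟨p, hp, rfl⟩ := hs
  rw [h, List.length_eq_zero_iff] at hp
  simp [hp]

/-- Deterministic dynamics make the visited state a function of the actions played. Hence a search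
call on the recorded actions of a trajectory collects data in exactly the state which that
trajectory visited. -/
theorem stateAt_eq_foldl (e : Episode K S X) (π : Policy K X) (h : ℕ) :
    E.stateAt e π h =
      ((List.range h).map fun j => (E.trajectory e π j).2.1).foldl E.step E.init := by
  induction h with
  | zero => rfl
  | succ h ih =>
    rw [List.range_succ, List.map_append, List.foldl_append, ← ih]
    rfl

theorem level_stateAt (e : Episode K S X) (π : Policy K X) {h : ℕ} (hh : h < H) :
    E.level (E.stateAt e π h) = h := by
  rw [stateAt_eq_foldl, level_foldl] <;> simp [hh]

theorem reachable_stateAt (e : Episode K S X) (π : Policy K X) {h : ℕ} (hh : h < H) :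
    E.Reachable (E.stateAt e π h) := by
  rw [stateAt_eq_foldl]
  exact E.reachable_foldl _ (by simpa using hh)

/-- Before level `h` a path looks only at states of lower levels. This is the source of the
independence between the history and the current observation. -/
theorem stateAt_congr {e e' : Episode K S X} {π π' : Policy K X} {h : ℕ} (hh : h < H)
    (he : ∀ s, E.level s < h → e.1 s = e'.1 s) (hπ : ∀ j < h, π j = π' j) :
    E.stateAt e π h = E.stateAt e' π' h := by
  induction h with
  | zero => rfl
  | succ h ih =>
    have h1 := ih (by omega) (fun s hs => he s (by omega)) (fun j hj => hπ j (by omega))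
    simp only [stateAt]
    rw [h1, hπ h (by omega), he _ (by rw [level_stateAt _ _ _ (by omega)]; omega)]

theorem trajectory_congr {e : Episode K S X} {π π' : Policy K X} {h : ℕ} (hh : h < H)
    (hπ : ∀ j < H, π j = π' j) : E.trajectory e π h = E.trajectory e π' h := by
  simp only [trajectory]
  rw [E.stateAt_congr hh (fun _ _ => rfl) (fun j hj => hπ j (by omega)), hπ h hh]

/-- The visited state is a random index into the observations. As `S` is finite, it carries the
discrete σ-algebra, and measurability can be checked with the state held fixed. -/
theorem measurable_stateAt [Fintype S] (π : Policy K X) (hπ : ∀ h, Measurable (π h)) (h : ℕ) :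
    Measurable[_, ⊤] fun e : Episode K S X => E.stateAt e π h := by
  let _ : MeasurableSpace S := ⊤
  induction h with
  | zero => exact measurable_const
  | succ h ih =>
    have hF : Measurable fun z : S × Episode K S X => E.step z.1 (π h (z.2.1 z.1).1) := by
      refine measurable_from_prod_countable_right fun s => ?_
      have h1 : Measurable fun e : Episode K S X => π h (e.1 s).1 := by
        have := hπ h
        fun_prop
      exact (Measurable.of_discrete (f := fun a => E.step s a)).comp h1
    exact hF.comp (ih.prodMk measurable_id)

theorem measurable_trajectory [Fintype S] (π : Policy K X) (hπ : ∀ h, Measurable (π h)) (h : ℕ) :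
    Measurable fun e : Episode K S X => E.trajectory e π h := by
  let _ : MeasurableSpace S := ⊤
  have hF : Measurable fun z : S × Episode K S X =>
      (((z.2.1 z.1).1, π h (z.2.1 z.1).1, (z.2.1 z.1).2 (π h (z.2.1 z.1).1)) : X × Fin K × ℝ) := by
    refine measurable_from_prod_countable_right fun s => ?_
    have h1 : Measurable fun e : Episode K S X => π h (e.1 s).1 := by
      have := hπ h
      fun_prop
    have h2 : Measurable fun z : Fin K × Episode K S X => (z.2.1 s).2 z.1 :=
      measurable_from_prod_countable_right fun a => (measurable_pi_apply a).comp
        (measurable_snd.comp ((measurable_pi_apply s).comp measurable_fst))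
    have h3 : Measurable fun e : Episode K S X => (e.1 s).2 (π h (e.1 s).1) :=
      h2.comp (h1.prodMk measurable_id)
    exact (by fun_prop : Measurable fun e : Episode K S X => (e.1 s).1).prodMk (h1.prodMk h3)
  exact hF.comp ((E.measurable_stateAt π hπ h).prodMk measurable_id)

theorem measurePreserving_stateLaw_fst (s : S) :
    MeasurePreserving (Prod.fst : X × (Fin K → ℝ) → X) (E.stateLaw s) (E.emit s) :=
  ⟨measurable_fst, Measure.fst_compProd _ _⟩

section Laws

variable [Fintype S]

theorem measurePreserving_obs [NeZero K] :
    MeasurePreserving (fun e : Episode K S X => e.1) E.episodeLaw E.obsLaw := by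
  have : IsProbabilityMeasure (uniformOn (Set.univ : Set (Fin K))) :=
    isProbabilityMeasure_uniformOn Set.finite_univ Set.univ_nonempty
  exact measurePreserving_fst

theorem measurePreserving_obs_apply (s : S) :
    MeasurePreserving (fun o : S → X × (Fin K → ℝ) => o s) E.obsLaw (E.stateLaw s) :=
  measurePreserving_eval _ s

theorem measurePreserving_state [NeZero K] (s : S) :
    MeasurePreserving (fun e : Episode K S X => e.1 s) E.episodeLaw (E.stateLaw s) :=
  (E.measurePreserving_obs_apply s).comp E.measurePreserving_obs

/-- The uniformly random action is independent of everything else. -/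
theorem integral_episodeLaw [NeZero K] {f : Episode K S X → ℝ} (hf : Integrable f E.episodeLaw) :
    ∫ e, f e ∂E.episodeLaw = (∑ a : Fin K, ∫ o, f (o, a) ∂E.obsLaw) / K := by
  have hu : IsProbabilityMeasure (uniformOn (Set.univ : Set (Fin K))) :=
    isProbabilityMeasure_uniformOn Set.finite_univ Set.univ_nonempty
  have h1 : ∫ e, f e ∂E.episodeLaw =
      ∫ a, ∫ o, f (o, a) ∂E.obsLaw ∂uniformOn (Set.univ : Set (Fin K)) :=
    integral_prod_symm f hf
  rw [h1, integral_fintype Integrable.of_finite, Finset.sum_div]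
  refine Finset.sum_congr rfl fun a _ => ?_
  have : (uniformOn (Set.univ : Set (Fin K))).real {a} = 1 / K := by
    rw [measureReal_def, uniformOn_univ]
    simp
  rw [this, smul_eq_mul]
  ring

/-- The observation and rewards of `s` are independent of those of the other states. -/
theorem integral_obs_mul {F : (S → X × (Fin K → ℝ)) → ℝ} (hF : Measurable F) (s : S)
    (hFs : ∀ o o', (∀ s', s' ≠ s → o s' = o' s') → F o = F o')
    {f : X × (Fin K → ℝ) → ℝ} (hf : Measurable f) :
    ∫ o, F o * f (o s) ∂E.obsLaw = (∫ o, F o ∂E.obsLaw) * ∫ y, f y ∂E.stateLaw s := by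
  classical
  have h := indepFun_of_dependsOn E.stateLaw (s := Finset.univ.erase s) (t := {s})
    (by simp) hF (hf.comp (measurable_pi_apply s))
    (fun o o' h => hFs o o' fun s' hs' => h s' (by simpa using hs'))
    (fun o o' h => by simp [h s (by simp)])
  have hmp := E.measurePreserving_obs_apply s
  rw [Measure.infinitePi_eq_pi] at h
  have h2 := h.integral_fun_mul_eq_mul_integral hF.aestronglyMeasurable
    (hf.comp (measurable_pi_apply s)).aestronglyMeasurable
  refine h2.trans ?_
  congr 1
  rw [← hmp.map_eq, integral_map hmp.measurable.aemeasurable hf.aestronglyMeasurable]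
  rfl

end Laws

end DetCDP
end TwoSampleRL

end

/-! ### One-step expectations and importance weighting. -/

noncomputable section
namespace TwoSampleRL

namespace DetCDP

variable {H K : ℕ} {S X : Type*} [MeasurableSpace X] (E : DetCDP H K S X)

/-- The mean reward of an action. -/
def meanReward (x : X) (a : Fin K) : ℝ := ∫ r, r ∂E.reward (x, a)

/-- The transition recorded when a uniformly random action is played in state `s`. -/
def sampleAt (s : S) (e : Episode K S X) : Sample K X :=
  ((e.1 s).1, e.2, (e.1 s).2 e.2, (e.1 (E.step s e.2)).1)

theorem measurable_meanReward : Measurable fun z : X × Fin K => E.meanReward z.1 z.2 :=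
  (StronglyMeasurable.integral_kernel (κ := E.reward) stronglyMeasurable_id).measurable

theorem measurable_sampleAt (s : S) : Measurable (E.sampleAt s) := by
  have h1 : Measurable fun z : (S → X × (Fin K → ℝ)) × Fin K =>
      (((z.1 s).1, z.2, (z.1 s).2 z.2, (z.1 (E.step s z.2)).1) : Sample K X) := by
    refine measurable_from_prod_countable_left fun a => ?_
    have h2 : Measurable fun o : S → X × (Fin K → ℝ) => (o s).2 a :=
      (measurable_pi_apply a).comp (measurable_snd.comp (measurable_pi_apply s))
    exact (by fun_prop : Measurable fun o : S → X × (Fin K → ℝ) => (o s).1).prodMk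
      (measurable_const.prodMk (h2.prodMk
        (measurable_fst.comp (measurable_pi_apply (E.step s a)))))
  exact h1

theorem measurable_decode [Fintype S] : Measurable[_, ⊤] E.decode := by
  let _ : MeasurableSpace S := ⊤
  exact measurable_to_countable' fun s => E.measurableSet_decode s

theorem measurable_backup [Fintype S] (g' : X → ℝ) {π : X → Fin K} (hπ : Measurable π) :
    Measurable fun x => E.backup g' x (π x) := by
  let _ : MeasurableSpace S := ⊤
  have h1 : Measurable fun x => E.meanReward x (π x) :=
    E.measurable_meanReward.comp (measurable_id.prodMk hπ)
  have h2 : Measurable fun x => ∫ x', g' x' ∂E.emit (E.step (E.decode x) (π x)) := by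
    have h3 : Measurable fun z : S × Fin K => ∫ x', g' x' ∂E.emit (E.step z.1 z.2) :=
      Measurable.of_discrete
    exact h3.comp (E.measurable_decode.prodMk hπ)
  exact h1.add h2

theorem backup_ae_eq (g' : X → ℝ) (s : S) :
    ∀ᵐ x ∂E.emit s, ∀ a, E.backup g' x a =
      E.meanReward x a + ∫ x', g' x' ∂E.emit (E.step s a) := by
  filter_upwards [E.decode_emit s] with x hx a
  rw [backup, hx, meanReward]

theorem integral_mem_Icc {Y : Type*} [MeasurableSpace Y] {μ : Measure Y} [IsProbabilityMeasure μ]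
    {f : Y → ℝ} {b : ℝ} (hf : ∀ᵐ y ∂μ, f y ∈ Set.Icc 0 b) (hb : 0 ≤ b) :
    ∫ y, f y ∂μ ∈ Set.Icc 0 b := by
  refine ⟨integral_nonneg_of_ae (hf.mono fun y hy => hy.1), ?_⟩
  by_cases hi : Integrable f μ
  · calc ∫ y, f y ∂μ ≤ ∫ _, b ∂μ := integral_mono_ae hi (integrable_const _) (hf.mono fun y hy => hy.2)
      _ = b := by simp
  -- A non-integrable function has integral 0 by convention, which also lies in the interval.
  · rw [integral_undef hi]; exact hb

theorem integral_rewardVector (x : X) (a : Fin K) :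
    ∫ y, y a ∂rewardVector E.reward x = E.meanReward x a := by
  have hmp : MeasurePreserving (fun y : Fin K → ℝ => y a) (rewardVector E.reward x)
      (E.reward (x, a)) := measurePreserving_eval (fun a => E.reward (x, a)) a
  rw [meanReward, ← hmp.map_eq]
  exact (integral_map (f := fun r : ℝ => r) hmp.measurable.aemeasurable
    aestronglyMeasurable_id).symm

section Rewards

variable [Fintype S]

/-- All rewards of all policies are regular at once. -/
theorem RegularRewards.ae_all_policies [NeZero K] {E : DetCDP H K S X} (hR : E.RegularRewards) :
    ∀ᵐ e ∂E.episodeLaw, ∀ π : Policy K X, (∀ h < H, 0 ≤ (E.trajectory e π h).2.2) ∧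
      ∑ h ∈ Finset.range H, (E.trajectory e π h).2.2 ≤ 1 := by
  classical
  -- Only the first `H` actions matter, so there are finitely many open-loop sequences and their
  -- null sets can be united.
  have h1 : ∀ᵐ e ∂E.episodeLaw, ∀ b : Fin H → Fin K,
      (∀ h < H, 0 ≤ (E.trajectory e
        (fun h _ => if hh : h < H then b ⟨h, hh⟩ else 0) h).2.2) ∧
      ∑ h ∈ Finset.range H, (E.trajectory e
        (fun h _ => if hh : h < H then b ⟨h, hh⟩ else 0) h).2.2 ≤ 1 :=
    ae_all_iff.2 fun b => hR fun h => if hh : h < H then b ⟨h, hh⟩ else 0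
  filter_upwards [h1] with e he π
  -- For a fixed `e` the policy is replayed by the open-loop sequence of its own actions; so one
  -- null set serves all policies, measurable or not.
  have h2 := he fun h => (E.trajectory e π h).2.1
  have h3 : ∀ h ≤ H, E.stateAt e π h = E.stateAt e
      (fun h _ => if hh : h < H then (E.trajectory e π h).2.1 else 0) h := by
    intro h
    induction h with
    | zero => intro _; rfl
    | succ h ih =>
      intro hh
      simp only [stateAt]
      rw [← ih (by omega), dif_pos (by omega)]
      rfl
  have h4 : ∀ h < H, (E.trajectory e π h).2.2 = (E.trajectory e
      (fun h _ => if hh : h < H then (E.trajectory e π h).2.1 else 0) h).2.2 := by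
    intro h hh
    have h5 := h3 h hh.le
    simp only [trajectory] at h5 ⊢
    rw [← h5, dif_pos hh]
  refine ⟨fun h hh => by rw [h4 h hh]; exact h2.1 h hh, ?_⟩
  rw [Finset.sum_congr rfl fun h hh => h4 h (Finset.mem_range.1 hh)]
  exact h2.2

/-- Regularity constrains only rewards along paths. A path that reaches `s` and then plays `a`
bounds the single reward; about unreachable states nothing is known, whence the hypothesis
`Reachable` throughout. -/
theorem RegularRewards.ae_stateLaw [NeZero K] {E : DetCDP H K S X} (hR : E.RegularRewards) {s : S}
    (hs : E.Reachable s) : ∀ᵐ y ∂E.stateLaw s, ∀ a, y.2 a ∈ Set.Icc (0 : ℝ) 1 := by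
  obtain ⟨p, hp, rfl⟩ := hs
  set s := p.foldl E.step E.init
  have hmp := E.measurePreserving_state s
  have hmeas : MeasurableSet {y : X × (Fin K → ℝ) | ∀ a, y.2 a ∈ Set.Icc (0 : ℝ) 1} := by
    simp only [Set.ofPred_forall]
    exact MeasurableSet.iInter fun a =>
      ((measurable_pi_apply a).comp measurable_snd) measurableSet_Icc
  rw [← hmp.map_eq, ae_map_iff hmp.measurable.aemeasurable hmeas]
  filter_upwards [hR.ae_all_policies] with e he a
  have hlt := E.level_lt s
  let π : Policy K X := fun h _ => (p ++ [a]).getD h 0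
  have hst : E.stateAt e π p.length = s := by
    rw [stateAt_eq_foldl]
    congr 1
    refine List.ext_getElem (by simp) fun i h1 h2 => ?_
    simp only [List.length_map, List.length_range] at h1
    simp [π, trajectory, h1, Nat.lt_succ_of_lt h1]
  have hr : (E.trajectory e π p.length).2.2 = (e.1 s).2 a := by
    simp only [trajectory, hst]
    simp [π]
  have hlt' : p.length < H := by omega
  refine ⟨by rw [← hr]; exact (he π).1 _ hlt', ?_⟩
  rw [← hr]
  exact (Finset.single_le_sum (f := fun h => (E.trajectory e π h).2.2)
    (fun h hh => (he π).1 h (Finset.mem_range.1 hh)) (Finset.mem_range.2 hlt')).trans (he π).2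

theorem RegularRewards.ae_meanReward [NeZero K] {E : DetCDP H K S X} (hR : E.RegularRewards) {s : S}
    (hs : E.Reachable s) : ∀ᵐ x ∂E.emit s, ∀ a, E.meanReward x a ∈ Set.Icc (0 : ℝ) 1 := by
  filter_upwards [Measure.ae_ae_of_ae_compProd (hR.ae_stateLaw hs)] with x hx a
  rw [← integral_rewardVector]
  exact integral_mem_Icc (hx.mono fun y hy => hy a) zero_le_one

theorem RegularRewards.ae_backup [NeZero K] {E : DetCDP H K S X} (hR : E.RegularRewards) {s : S}
    (hs : E.Reachable s) {g' : X → ℝ} (hg : ∀ x, g' x ∈ Set.Icc (0 : ℝ) 1) :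
    ∀ᵐ x ∂E.emit s, ∀ a, E.backup g' x a ∈ Set.Icc (0 : ℝ) 2 := by
  filter_upwards [hR.ae_meanReward hs, E.backup_ae_eq g' s] with x hx hb a
  have h := integral_mem_Icc (μ := E.emit (E.step s a)) (Filter.Eventually.of_forall hg) zero_le_one
  rw [hb a]
  exact ⟨add_nonneg (hx a).1 h.1, by linarith [(hx a).2, h.2]⟩

theorem measurable_reward_comp {π : X → Fin K} (hπ : Measurable π) :
    Measurable fun y : X × (Fin K → ℝ) => y.2 (π y.1) := by
  have h2 : Measurable fun z : Fin K × (X × (Fin K → ℝ)) => z.2.2 z.1 :=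
    measurable_from_prod_countable_right fun a => (measurable_pi_apply a).comp measurable_snd
  exact h2.comp ((hπ.comp measurable_fst).prodMk measurable_id)

theorem RegularRewards.integrable_mul_reward [NeZero K] {E : DetCDP H K S X}
    (hR : E.RegularRewards) {s : S} (hs : E.Reachable s) {π : X → Fin K} (hπ : Measurable π)
    {f : X → ℝ} (hf : Measurable f) {B : ℝ} (hB : ∀ x, |f x| ≤ B) :
    Integrable (fun y => f y.1 * y.2 (π y.1)) (E.stateLaw s) := by
  refine Integrable.of_bound (C := B)
    ((hf.comp measurable_fst).mul (measurable_reward_comp hπ)).aestronglyMeasurable ?_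
  filter_upwards [hR.ae_stateLaw hs] with y hy
  rw [Real.norm_eq_abs, abs_mul, abs_of_nonneg (hy _).1]
  calc |f y.1| * y.2 (π y.1) ≤ |f y.1| * 1 := by gcongr; exact (hy _).2
    _ ≤ B := by simpa using hB y.1

theorem RegularRewards.integral_mul_reward [NeZero K] {E : DetCDP H K S X}
    (hR : E.RegularRewards) {s : S} (hs : E.Reachable s) {π : X → Fin K} (hπ : Measurable π)
    {f : X → ℝ} (hf : Measurable f) {B : ℝ} (hB : ∀ x, |f x| ≤ B) :
    ∫ y, f y.1 * y.2 (π y.1) ∂E.stateLaw s = ∫ x, f x * E.meanReward x (π x) ∂E.emit s := by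
  rw [stateLaw, Measure.integral_compProd (hR.integrable_mul_reward hs hπ hf hB)]
  refine integral_congr_ae (Filter.Eventually.of_forall fun x => ?_)
  simp only
  rw [integral_const_mul, integral_rewardVector]

theorem RegularRewards.ae_sampleAt [NeZero K] {E : DetCDP H K S X} (hR : E.RegularRewards) {s : S}
    (hs : E.Reachable s) : ∀ᵐ e ∂E.episodeLaw, ∀ a, (e.1 s).2 a ∈ Set.Icc (0 : ℝ) 1 :=
  (E.measurePreserving_state s).quasiMeasurePreserving.ae (hR.ae_stateLaw hs)

theorem integral_obs_fst_mul {s s' : S} (hne : s' ≠ s) {f g : X → ℝ} (hf : Measurable f)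
    (hg : Measurable g) : ∫ o, f (o s).1 * g (o s').1 ∂E.obsLaw =
      (∫ x, f x ∂E.emit s) * ∫ x, g x ∂E.emit s' := by
  have h1 : ∀ (s : S) {f : X → ℝ}, Measurable f →
      ∫ y, f y.1 ∂E.stateLaw s = ∫ x, f x ∂E.emit s := by
    intro s f hf
    rw [← (E.measurePreserving_stateLaw_fst s).map_eq,
      integral_map measurable_fst.aemeasurable hf.aestronglyMeasurable]
  have h2 : ∫ o, g (o s').1 ∂E.obsLaw = ∫ x, g x ∂E.emit s' := by
    have hmp := (E.measurePreserving_stateLaw_fst s').comp (E.measurePreserving_obs_apply s')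
    rw [← hmp.map_eq, integral_map hmp.measurable.aemeasurable hg.aestronglyMeasurable]
    rfl
  have := E.integral_obs_mul (F := fun o => g (o s').1) (by fun_prop) s
    (fun o o' h => by simp only [h s' hne]) (f := fun y => f y.1) (by fun_prop)
  rw [h1 s hf, h2] at this
  rw [mul_comm, ← this]
  simp only [mul_comm]

/-- Importance weighting: the expectation of a weighted one-step target is the backup. -/
theorem RegularRewards.integral_sampleAt [NeZero K] {E : DetCDP H K S X}
    (hR : E.RegularRewards) {s : S} (hs : E.Reachable s) {π : X → Fin K} (hπ : Measurable π)
    {f : X → ℝ} (hf : Measurable f) {B : ℝ} (hB : ∀ x, |f x| ≤ B)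
    {g' : X → ℝ} (hgm : Measurable g') (hg : ∀ x, g' x ∈ Set.Icc (0 : ℝ) 1)
    (hlast : E.level s + 1 < H ∨ g' = fun _ => 0) :
    ∫ e, (if π (E.sampleAt s e).1 = (E.sampleAt s e).2.1 then
        (K : ℝ) * (f (E.sampleAt s e).1 * ((E.sampleAt s e).2.2.1 + g' (E.sampleAt s e).2.2.2))
        else 0) ∂E.episodeLaw
      = ∫ x, f x * E.backup g' x (π x) ∂E.emit s := by
  have hK : (0 : ℝ) < K := by exact_mod_cast Nat.pos_of_ne_zero (NeZero.ne K)
  have hB0 : 0 ≤ B := by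
    have := (nonempty_of_isProbabilityMeasure (E.emit s)).some
    exact (abs_nonneg _).trans (hB this)
  have hg1 : ∀ x, |g' x| ≤ 1 := fun x => abs_le.2 ⟨by linarith [(hg x).1], (hg x).2⟩
  have hmeas : Measurable fun z : Sample K X =>
      if π z.1 = z.2.1 then (K : ℝ) * (f z.1 * (z.2.2.1 + g' z.2.2.2)) else 0 := by
    refine Measurable.ite (measurableSet_eq_fun (by fun_prop) (by fun_prop)) (by fun_prop)
      measurable_const
  have hint : Integrable (fun e => if π (E.sampleAt s e).1 = (E.sampleAt s e).2.1 then
        (K : ℝ) * (f (E.sampleAt s e).1 * ((E.sampleAt s e).2.2.1 + g' (E.sampleAt s e).2.2.2))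
        else 0) E.episodeLaw := by
    refine Integrable.of_bound (C := K * (B * 2))
      (hmeas.comp (E.measurable_sampleAt s)).aestronglyMeasurable ?_
    filter_upwards [hR.ae_sampleAt hs] with e he
    split_ifs
    · rw [Real.norm_eq_abs, abs_mul, abs_mul, abs_of_pos hK]
      gcongr
      · exact hB _
      · refine (abs_add_le _ _).trans ?_
        have h1 : |(E.sampleAt s e).2.2.1| ≤ 1 :=
          abs_le.2 ⟨by linarith [(he (E.sampleAt s e).2.1).1, show (E.sampleAt s e).2.2.1 = (e.1 s).2 e.2 from rfl, (he e.2).1], (he e.2).2⟩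
        linarith [hg1 (E.sampleAt s e).2.2.2]
    · simp only [norm_zero]; positivity
  rw [E.integral_episodeLaw hint]
  let ind (a : Fin K) (x : X) : ℝ := if π x = a then f x else 0
  have hind : ∀ a, Measurable (ind a) := fun a =>
    Measurable.ite (hπ (measurableSet_singleton a)) hf measurable_const
  have hindB : ∀ a x, |ind a x| ≤ B := by
    intro a x
    simp only [ind]
    split_ifs
    · exact hB x
    · simpa using hB0
  let G (a : Fin K) : ℝ := ∫ x, g' x ∂E.emit (E.step s a)
  -- The uniform action is integrated out first. Its average over `K` values cancels the weight `K`,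
  -- and action `a` contributes the part of the integral where `π` chooses `a`.
  have hterm : ∀ a : Fin K, ∫ o, (if π (o s).1 = a then
      (K : ℝ) * (f (o s).1 * ((o s).2 a + g' (o (E.step s a)).1)) else 0) ∂E.obsLaw =
      K * ((∫ x, ind a x * E.meanReward x a ∂E.emit s) + ∫ x, ind a x * G a ∂E.emit s) := by
    intro a
    have e1 : ∀ o : S → X × (Fin K → ℝ), (if π (o s).1 = a then
      (K : ℝ) * (f (o s).1 * ((o s).2 a + g' (o (E.step s a)).1)) else 0) =
      K * (ind a (o s).1 * (o s).2 a + ind a (o s).1 * g' (o (E.step s a)).1) := by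
      intro o
      simp only [ind]
      split_ifs <;> ring
    simp only [e1]
    have hi1 : Integrable (fun o : S → X × (Fin K → ℝ) => ind a (o s).1 * (o s).2 a) E.obsLaw :=
      (E.measurePreserving_obs_apply s).integrable_comp_of_integrable
      (hR.integrable_mul_reward hs (π := fun _ => a) measurable_const (hind a) (hindB a))
    have hi2 : Integrable (fun o : S → X × (Fin K → ℝ) =>
        ind a (o s).1 * g' (o (E.step s a)).1) E.obsLaw := by
      refine Integrable.of_bound (C := B * 1) (by have := hind a; fun_prop) ?_
      refine Filter.Eventually.of_forall fun o => ?_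
      rw [Real.norm_eq_abs, abs_mul]
      exact mul_le_mul (hindB _ _) (hg1 _) (abs_nonneg _) hB0
    rw [integral_const_mul, integral_add hi1 hi2]
    congr 2
    · rw [← hR.integral_mul_reward hs (π := fun _ => a) measurable_const (hind a) (hindB a),
        ← (E.measurePreserving_obs_apply s).map_eq, integral_map
          (measurable_pi_apply s).aemeasurable]
      · have := hind a
        exact ((this.comp measurable_fst).mul ((measurable_pi_apply a).comp
          measurable_snd)).aestronglyMeasurable
    · rcases hlast with h | h
      · rw [integral_mul_const]
        refine E.integral_obs_fst_mul (fun hc => ?_) (hind a) hgm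
        have := E.level_step s a h
        rw [hc] at this
        omega
      · simp [G, h]
  refine (congrArg (· / (K : ℝ)) (Finset.sum_congr rfl fun a _ => hterm a)).trans ?_
  rw [← Finset.mul_sum, mul_comm, mul_div_assoc,
    div_self hK.ne', mul_one]
  have hmi : ∀ a, Integrable (fun x => ind a x * E.meanReward x a) (E.emit s) := by
    intro a
    refine Integrable.of_bound (C := B * 1) ?_ ?_
    · have h1 := hind a
      have h2 : Measurable fun x => E.meanReward x a :=
        E.measurable_meanReward.comp (measurable_id.prodMk measurable_const)
      exact (h1.mul h2).aestronglyMeasurable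
    · filter_upwards [hR.ae_meanReward hs] with x hx
      rw [Real.norm_eq_abs, abs_mul]
      exact mul_le_mul (hindB _ _) (abs_le.2 ⟨by linarith [(hx a).1], (hx a).2⟩) (abs_nonneg _) hB0
  have hGi : ∀ a, Integrable (fun x => ind a x * G a) (E.emit s) := by
    intro a
    refine Integrable.mul_const (Integrable.of_bound (C := B) (hind a).aestronglyMeasurable
      (Filter.Eventually.of_forall (hindB a))) _
  have hsum : ∀ a, (∫ x, ind a x * E.meanReward x a ∂E.emit s) + ∫ x, ind a x * G a ∂E.emit s =
      ∫ x, ind a x * E.meanReward x a + ind a x * G a ∂E.emit s :=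
    fun a => (integral_add (hmi a) (hGi a)).symm
  have hsi : ∀ a, Integrable (fun x => ind a x * E.meanReward x a + ind a x * G a) (E.emit s) :=
    fun a => (hmi a).add (hGi a)
  rw [Finset.sum_congr rfl fun a _ => hsum a, ← integral_finsetSum _ fun a _ => hsi a]
  refine integral_congr_ae ?_
  filter_upwards [E.backup_ae_eq g' s] with x hx
  rw [hx (π x)]
  simp only [ind]
  rw [Finset.sum_eq_single (π x)]
  · simp only [if_true, G]; ring
  · intro a _ ha
    simp [ha.symm]
  · simp

end Rewards

end DetCDP
end TwoSampleRL

end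

/-! ### Telescoping values along a trajectory. -/

noncomputable section
namespace TwoSampleRL

namespace DetCDP

variable {H K : ℕ} {S X : Type*} [MeasurableSpace X] (E : DetCDP H K S X)

/-- The exploratory action of an episode plays no part in a rollout. Policy values can therefore be
computed under `obsLaw`, with the dummy action `0`. -/
theorem stateAt_obs (e : Episode K S X) (a : Fin K) (π : Policy K X) (h : ℕ) :
    E.stateAt (e.1, a) π h = E.stateAt e π h := by
  induction h with
  | zero => rfl
  | succ h ih => simp only [stateAt]; rw [ih]

theorem trajectory_obs (e : Episode K S X) (a : Fin K) (π : Policy K X) (h : ℕ) :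
    E.trajectory (e.1, a) π h = E.trajectory e π h := by
  simp only [trajectory, stateAt_obs]

theorem measurable_prodMk_zero [NeZero K] : Measurable fun o : S → X × (Fin K → ℝ) => ((o, 0) : Episode K S X) :=
  measurable_prodMk_right

section Telescope

variable [Fintype S] [NeZero K]

theorem ae_obs_of_ae_episode {p : Episode K S X → Prop}
    (hp : ∀ o a a', p (o, a) → p (o, a')) (h : ∀ᵐ e ∂E.episodeLaw, p e) :
    ∀ᵐ o ∂E.obsLaw, p (o, 0) := by
  have hu : IsProbabilityMeasure (uniformOn (Set.univ : Set (Fin K))) :=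
    isProbabilityMeasure_uniformOn Set.finite_univ Set.univ_nonempty
  have h1 := Measure.ae_ae_of_ae_prod h
  filter_upwards [h1] with o ho
  obtain ⟨a, ha⟩ := ho.exists
  exact hp o a 0 ha

theorem RegularRewards.ae_obs {E : DetCDP H K S X} (hR : E.RegularRewards) (π : Policy K X) :
    ∀ᵐ o ∂E.obsLaw, ∀ h < H, (E.trajectory (o, 0) π h).2.2 ∈ Set.Icc (0 : ℝ) 1 := by
  refine E.ae_obs_of_ae_episode (p := fun e =>
    ∀ h < H, (E.trajectory e π h).2.2 ∈ Set.Icc (0 : ℝ) 1) ?_ ?_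
  · intro o a a' h j hj
    have := h j hj
    rwa [← E.trajectory_obs _ a'] at this
  · filter_upwards [hR.ae_all_policies] with e he h hh
    exact ⟨(he π).1 h hh, (Finset.single_le_sum (f := fun h => (E.trajectory e π h).2.2)
      (fun h hh => (he π).1 h (Finset.mem_range.1 hh)) (Finset.mem_range.2 hh)).trans (he π).2⟩

variable {E}

theorem RegularRewards.integral_backup (hR : E.RegularRewards) {s : S} (hs : E.Reachable s)
    {π : X → Fin K} (hπ : Measurable π) (g' : X → ℝ) :
    ∫ y, (y.2 (π y.1) + ∫ x', g' x' ∂E.emit (E.step s (π y.1))) ∂E.stateLaw s =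
      ∫ x, E.backup g' x (π x) ∂E.emit s := by
  have hi := hR.integrable_mul_reward hs hπ (f := fun _ => 1) measurable_const (B := 1) (by simp)
  have hm := hR.integral_mul_reward hs hπ (f := fun _ => 1) measurable_const (B := 1) (by simp)
  simp only [one_mul] at hi hm
  have hv : Measurable fun x => ∫ x', g' x' ∂E.emit (E.step s (π x)) :=
    (Measurable.of_discrete (f := fun a => ∫ x', g' x' ∂E.emit (E.step s a))).comp hπ
  have hb : ∀ x, ‖∫ x', g' x' ∂E.emit (E.step s (π x))‖ ≤
      ∑ a, |∫ x', g' x' ∂E.emit (E.step s a)| := fun x =>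
    Finset.single_le_sum (f := fun a => |∫ x', g' x' ∂E.emit (E.step s a)|)
      (fun a _ => abs_nonneg _) (Finset.mem_univ (π x))
  have hvi : Integrable (fun x => ∫ x', g' x' ∂E.emit (E.step s (π x))) (E.emit s) :=
    Integrable.of_bound hv.aestronglyMeasurable _ (Filter.Eventually.of_forall hb)
  have hmp := E.measurePreserving_stateLaw_fst s
  have hmi : Integrable (fun x => E.meanReward x (π x)) (E.emit s) := by
    refine Integrable.of_bound (C := 1)
      (E.measurable_meanReward.comp (measurable_id.prodMk hπ)).aestronglyMeasurable ?_
    filter_upwards [hR.ae_meanReward hs] with x hx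
    rw [Real.norm_eq_abs]
    exact abs_le.2 ⟨by linarith [(hx (π x)).1], (hx (π x)).2⟩
  have hvi' : Integrable (fun y : X × (Fin K → ℝ) =>
      ∫ x', g' x' ∂E.emit (E.step s (π y.1))) (E.stateLaw s) :=
    hmp.integrable_comp_of_integrable hvi
  rw [integral_add hi hvi', hm]
  have h2 : ∫ y, (∫ x', g' x' ∂E.emit (E.step s (π y.1))) ∂E.stateLaw s =
      ∫ x, (∫ x', g' x' ∂E.emit (E.step s (π x))) ∂E.emit s := by
    rw [← hmp.map_eq, integral_map measurable_fst.aemeasurable hv.aestronglyMeasurable]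
  rw [h2, ← integral_add hmi hvi]
  refine integral_congr_ae ?_
  filter_upwards [E.backup_ae_eq g' s] with x hx
  rw [hx]

/-- Given the history up to level `h`, the expected reward plus value of the next state is the
expected backup in the current state. -/
theorem RegularRewards.integral_step (hR : E.RegularRewards) {π : Policy K X}
    (hπ : ∀ h, Measurable (π h)) {h : ℕ} (hh : h < H) (g' : X → ℝ)
    {A : Set (S → X × (Fin K → ℝ))} (hA : MeasurableSet A)
    (hAd : ∀ o o', (∀ s, E.level s < h → o s = o' s) → o ∈ A → o' ∈ A) :
    ∫ o in A, ((E.trajectory (o, 0) π h).2.2 +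
        ∫ x', g' x' ∂E.emit (E.stateAt (o, 0) π (h + 1))) ∂E.obsLaw =
      ∫ o in A, (∫ x, E.backup g' x (π h x) ∂E.emit (E.stateAt (o, 0) π h)) ∂E.obsLaw := by
  classical
  let _ : MeasurableSpace S := ⊤
  have hstate : Measurable fun o : S → X × (Fin K → ℝ) => E.stateAt (o, 0) π h :=
    (E.measurable_stateAt π hπ h).comp measurable_prodMk_zero
  have hfm : ∀ s, Measurable fun y : X × (Fin K → ℝ) =>
      y.2 (π h y.1) + ∫ x', g' x' ∂E.emit (E.step s (π h y.1)) := fun s =>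
    (measurable_reward_comp (hπ h)).add
      ((Measurable.of_discrete (f := fun a => ∫ x', g' x' ∂E.emit (E.step s a))).comp
        ((hπ h).comp measurable_fst))
  -- Decomposition by the current state: the indicator `F s` depends on lower levels only, hence is
  -- independent of the observation and rewards of `s`.
  let F (s : S) (o : S → X × (Fin K → ℝ)) : ℝ :=
    if o ∈ A ∧ E.stateAt (o, 0) π h = s then 1 else 0
  have hF : ∀ s, Measurable (F s) := fun s =>
    Measurable.ite (hA.inter (hstate (measurableSet_singleton s))) measurable_const
      measurable_const
  have hterm : ∀ s, ∫ o, F s o * ((o s).2 (π h (o s).1) +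
      ∫ x', g' x' ∂E.emit (E.step s (π h (o s).1))) ∂E.obsLaw =
      ∫ o, F s o * ∫ x, E.backup g' x (π h x) ∂E.emit s ∂E.obsLaw := by
    intro s
    by_cases hs : E.level s = h ∧ E.Reachable s
    · rw [E.integral_obs_mul (hF s) s ?_ (hfm s), hR.integral_backup hs.2 (hπ h),
        integral_mul_const]
      intro o o' hoo
      have h1 : E.stateAt (o, 0) π h = E.stateAt (o', 0) π h :=
        E.stateAt_congr hh (fun s' hs' => hoo s' (by rintro rfl; omega)) fun _ _ => rfl
      have h2 : o ∈ A ↔ o' ∈ A :=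
        ⟨hAd o o' fun s' hs' => hoo s' (by rintro rfl; omega),
          hAd o' o fun s' hs' => (hoo s' (by rintro rfl; omega)).symm⟩
      simp only [F, h1, h2]
    · have : ∀ o, F s o = 0 := by
        intro o
        refine if_neg fun hc => hs ?_
        rw [← hc.2]
        exact ⟨E.level_stateAt _ _ hh, E.reachable_stateAt _ _ hh⟩
      simp [this]
  have hl : ∀ o, A.indicator (fun o => (E.trajectory (o, 0) π h).2.2 +
      ∫ x', g' x' ∂E.emit (E.stateAt (o, 0) π (h + 1))) o =
      ∑ s, F s o * ((o s).2 (π h (o s).1) +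
        ∫ x', g' x' ∂E.emit (E.step s (π h (o s).1))) := by
    intro o
    by_cases ho : o ∈ A
    · simp [F, ho, trajectory, stateAt]
    · simp [F, ho]
  have hr : ∀ o, A.indicator (fun o =>
      ∫ x, E.backup g' x (π h x) ∂E.emit (E.stateAt (o, 0) π h)) o =
      ∑ s, F s o * ∫ x, E.backup g' x (π h x) ∂E.emit s := by
    intro o
    by_cases ho : o ∈ A <;> simp [F, ho]
  rw [← integral_indicator hA, ← integral_indicator hA]
  simp only [hl, hr]
  have hF1 : ∀ s o, |F s o| ≤ 1 := by
    intro s o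
    simp only [F]
    split_ifs <;> simp
  rw [integral_finsetSum, integral_finsetSum]
  · exact Finset.sum_congr rfl fun s _ => hterm s
  · intro s _
    exact (Integrable.of_bound (C := 1) (hF s).aestronglyMeasurable
      (Filter.Eventually.of_forall (hF1 s))).mul_const _
  · intro s _
    by_cases hs : E.Reachable s
    · have hi := hR.integrable_mul_reward hs (hπ h) (f := fun _ => 1) measurable_const (B := 1)
        (by simp)
      simp only [one_mul] at hi
      have hv : Integrable (fun y : X × (Fin K → ℝ) =>
          ∫ x', g' x' ∂E.emit (E.step s (π h y.1))) (E.stateLaw s) := by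
        refine Integrable.of_bound (C := ∑ a, |∫ x', g' x' ∂E.emit (E.step s a)|)
          ((Measurable.of_discrete (f := fun a => ∫ x', g' x' ∂E.emit (E.step s a))).comp
            ((hπ h).comp measurable_fst)).aestronglyMeasurable
          (Filter.Eventually.of_forall fun y => ?_)
        exact Finset.single_le_sum (f := fun a => |∫ x', g' x' ∂E.emit (E.step s a)|)
          (fun a _ => abs_nonneg _) (Finset.mem_univ (π h y.1))
      have := (E.measurePreserving_obs_apply s).integrable_comp_of_integrable (hi.add hv)
      exact this.bdd_mul (c := 1) (hF s).aestronglyMeasurable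
        (Filter.Eventually.of_forall (hF1 s))
    · have : ∀ o, F s o = 0 := by
        intro o
        refine if_neg fun hc => hs ?_
        rw [← hc.2]
        exact E.reachable_stateAt _ _ hh
      simp [this]

theorem value_eq_sum (hR : E.RegularRewards) {π : Policy K X} (hπ : ∀ h, Measurable (π h)) :
    E.value π = ∑ h ∈ Finset.range H, ∫ o, (E.trajectory (o, 0) π h).2.2 ∂E.obsLaw := by
  have hmp := E.measurePreserving_obs
  have hm : ∀ h, Measurable fun o : S → X × (Fin K → ℝ) => (E.trajectory (o, 0) π h).2.2 :=
    fun h => (measurable_snd.comp measurable_snd).comp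
      ((E.measurable_trajectory π hπ h).comp measurable_prodMk_zero)
  rw [value, ← integral_finsetSum, ← hmp.map_eq, integral_map hmp.measurable.aemeasurable]
  · simp only [E.trajectory_obs]
  · exact (Finset.measurable_sum _ fun h _ => hm h).aestronglyMeasurable
  · intro h hh
    refine Integrable.of_bound (C := 1) (hm h).aestronglyMeasurable ?_
    filter_upwards [hR.ae_obs π] with o ho
    have := ho h (Finset.mem_range.1 hh)
    rw [Real.norm_eq_abs]
    exact abs_le.2 ⟨by linarith [this.1], this.2⟩

/-- If the functions `g h` lose at most `κ` against one step of `π` in all states of `U`, then they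
overestimate the value of `π` by at most `H * κ` plus the probability that `π` leaves `U`. -/
theorem RegularRewards.le_value (hR : E.RegularRewards) {π : Policy K X}
    (hπ : ∀ h, Measurable (π h)) {g : ℕ → X → ℝ}
    (hg : ∀ h x, g h x ∈ Set.Icc (0 : ℝ) 1) (hgH : g H = fun _ => 0) {U : Set S}
    (hU : E.init ∈ U) {κ : ℝ} (hκ : 0 ≤ κ)
    (hstep : ∀ s ∈ U, E.Reachable s → ∫ x, g (E.level s) x ∂E.emit s - κ ≤
      ∫ x, E.backup (g (E.level s + 1)) x (π (E.level s) x) ∂E.emit s) :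
    ∫ x, g 0 x ∂E.emit E.init - H * κ -
      E.episodeLaw.real {e | ∃ h < H, E.stateAt e π h ∉ U} ≤ E.value π := by
  let _ : MeasurableSpace S := ⊤
  have hstate : ∀ h, Measurable fun o : S → X × (Fin K → ℝ) => E.stateAt (o, 0) π h := fun h =>
    (E.measurable_stateAt π hπ h).comp measurable_prodMk_zero
  have hrm : ∀ h, Measurable fun o : S → X × (Fin K → ℝ) => (E.trajectory (o, 0) π h).2.2 :=
    fun h => (measurable_snd.comp measurable_snd).comp
      ((E.measurable_trajectory π hπ h).comp measurable_prodMk_zero)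
  have hri : ∀ h < H, Integrable (fun o => (E.trajectory (o, 0) π h).2.2) E.obsLaw := by
    intro h hh
    refine Integrable.of_bound (C := 1) (hrm h).aestronglyMeasurable ?_
    filter_upwards [hR.ae_obs π] with o ho
    have := ho h hh
    rw [Real.norm_eq_abs]
    exact abs_le.2 ⟨by linarith [this.1], this.2⟩
  let v (h : ℕ) (o : S → X × (Fin K → ℝ)) : ℝ := ∫ x, g h x ∂E.emit (E.stateAt (o, 0) π h)
  have hv01 : ∀ h o, v h o ∈ Set.Icc (0 : ℝ) 1 := fun h o =>
    integral_mem_Icc (Filter.Eventually.of_forall (hg h)) zero_le_one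
  have hvm : ∀ h, Measurable (v h) := fun h =>
    (Measurable.of_discrete (f := fun s => ∫ x, g h x ∂E.emit s)).comp (hstate h)
  have hvi : ∀ h, Integrable (v h) E.obsLaw := fun h =>
    Integrable.of_mem_Icc 0 1 (hvm h).aemeasurable (Filter.Eventually.of_forall (hv01 h))
  -- The event of having stayed in `U` up to level `h`. Once a path leaves `U`, its remaining value,
  -- at most 1, is given up. This loss is paid once per path and is the difference of the
  -- probabilities of `A 0` and `A h` below.
  let A (h : ℕ) : Set (S → X × (Fin K → ℝ)) := {o | ∀ j ≤ h, j < H → E.stateAt (o, 0) π j ∈ U}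
  have hAm : ∀ h, MeasurableSet (A h) := by
    intro h
    simp only [A, Set.ofPred_forall]
    exact MeasurableSet.iInter fun j => MeasurableSet.iInter fun _ => MeasurableSet.iInter
      fun _ => hstate j (MeasurableSpace.measurableSet_top)
  have hAsub : ∀ h, A (h + 1) ⊆ A h := fun h o ho j hj => ho j (by omega)
  have key : ∀ h ≤ H, (∫ o in A 0, v 0 o ∂E.obsLaw) - h * κ - (∫ o in A h, v h o ∂E.obsLaw) -
      (E.obsLaw.real (A 0) - E.obsLaw.real (A h)) ≤
      ∑ j ∈ Finset.range h, ∫ o, (E.trajectory (o, 0) π j).2.2 ∂E.obsLaw := by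
    intro h
    induction h with
    | zero => intro _; simp
    | succ h ih =>
      intro hh
      have ih := ih (by omega)
      rw [Finset.sum_range_succ]
      have h1 := hR.integral_step hπ (h := h) (by omega) (g (h + 1)) (hAm h) (by
        intro o o' hoo ho j hj hjH
        rw [← E.stateAt_congr (e := (o, 0)) (e' := (o', 0)) hjH
          (fun s hs => hoo s (by omega)) fun _ _ => rfl]
        exact ho j hj hjH)
      rw [integral_add (hri h (by omega)).integrableOn (hvi (h + 1)).integrableOn] at h1
      have h2 : (∫ o in A h, v h o ∂E.obsLaw) - κ ≤ ∫ o in A h,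
          (∫ x, E.backup (g (h + 1)) x (π h x) ∂E.emit (E.stateAt (o, 0) π h)) ∂E.obsLaw := by
        have h3 : ∫ o in A h, (v h o - κ) ∂E.obsLaw ≤ ∫ o in A h,
          (∫ x, E.backup (g (h + 1)) x (π h x) ∂E.emit (E.stateAt (o, 0) π h)) ∂E.obsLaw := by
          refine setIntegral_mono_on ((hvi h).sub (integrable_const κ)).integrableOn ?_ (hAm h) ?_
          · refine Integrable.integrableOn (Integrable.of_bound
              (C := ∑ s, |∫ x, E.backup (g (h + 1)) x (π h x) ∂E.emit s|) ?_
              (Filter.Eventually.of_forall fun o => ?_))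
            · exact ((Measurable.of_discrete
                (f := fun s => ∫ x, E.backup (g (h + 1)) x (π h x) ∂E.emit s)).comp
                (hstate h)).aestronglyMeasurable
            · exact Finset.single_le_sum
                (f := fun s => |∫ x, E.backup (g (h + 1)) x (π h x) ∂E.emit s|)
                (fun _ _ => abs_nonneg _) (Finset.mem_univ (E.stateAt (o, 0) π h))
          · intro o ho
            have h4 := hstep _ (ho h le_rfl (by omega)) (E.reachable_stateAt (o, 0) π (by omega))
            rwa [E.level_stateAt _ _ (by omega)] at h4
        rw [integral_sub (hvi h).integrableOn (integrable_const κ)] at h3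
        simp only [integral_const, smul_eq_mul, measureReal_restrict_apply_univ] at h3
        have h5 : E.obsLaw.real (A h) * κ ≤ κ := mul_le_of_le_one_left hκ measureReal_le_one
        linarith
      have h6 : ∫ o in A h, v (h + 1) o ∂E.obsLaw ≤ (∫ o in A (h + 1), v (h + 1) o ∂E.obsLaw) +
          (E.obsLaw.real (A h) - E.obsLaw.real (A (h + 1))) := by
        have h7 := setIntegral_union (μ := E.obsLaw) (f := v (h + 1)) (s := A (h + 1))
          (t := A h \ A (h + 1)) Set.disjoint_sdiff_right ((hAm h).diff (hAm (h + 1)))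
          (hvi _).integrableOn (hvi _).integrableOn
        rw [Set.union_sdiff_cancel (hAsub h)] at h7
        have h8 : ∫ o in A h \ A (h + 1), v (h + 1) o ∂E.obsLaw ≤
            ∫ o in A h \ A (h + 1), (1 : ℝ) ∂E.obsLaw :=
          setIntegral_mono (hvi _).integrableOn (integrable_const _).integrableOn
            fun o => (hv01 _ o).2
        rw [setIntegral_const, smul_eq_mul, mul_one,
          measureReal_sdiff (hAsub h) (hAm (h + 1))] at h8
        linarith
      -- Rewards earned outside `A h` are nonnegative, so discarding them only weakens the lower
      -- bound.
      have h9 : ∫ o in A h, (E.trajectory (o, 0) π h).2.2 ∂E.obsLaw ≤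
          ∫ o, (E.trajectory (o, 0) π h).2.2 ∂E.obsLaw :=
        setIntegral_le_integral (hri h (by omega)) ((hR.ae_obs π).mono
          fun o ho => (ho h (by omega)).1)
      push_cast
      have h10 : ∫ o in A h, (E.trajectory (o, 0) π h).2.2 ∂E.obsLaw +
        ∫ o in A h, v (h + 1) o ∂E.obsLaw = ∫ o in A h,
          (∫ x, E.backup (g (h + 1)) x (π h x) ∂E.emit (E.stateAt (o, 0) π h)) ∂E.obsLaw := h1
      linarith
  have hfin := key H le_rfl
  rw [← value_eq_sum hR hπ] at hfin
  have hA0 : A 0 = Set.univ := by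
    refine Set.eq_univ_of_forall fun o j hj _ => ?_
    obtain rfl : j = 0 := by omega
    exact hU
  have hvH : ∫ o in A H, v H o ∂E.obsLaw = 0 := by simp [v, hgH]
  have hv0 : ∫ o in A 0, v 0 o ∂E.obsLaw = ∫ x, g 0 x ∂E.emit E.init := by
    simp [hA0, v, stateAt]
  have hexit : E.episodeLaw.real {e | ∃ h < H, E.stateAt e π h ∉ U} = 1 - E.obsLaw.real (A H) := by
    have hc : {e : Episode K S X | ∃ h < H, E.stateAt e π h ∉ U} =
        (fun e : Episode K S X => e.1) ⁻¹' (A H)ᶜ := by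
      ext e
      simp only [A, Set.mem_ofPred_eq, Set.mem_preimage, Set.mem_compl_iff, stateAt_obs]
      push Not
      exact ⟨fun ⟨h, h1, h2⟩ => ⟨h, h1.le, h1, h2⟩, fun ⟨h, _, h1, h2⟩ => ⟨h, h1, h2⟩⟩
    rw [hc, E.measurePreserving_obs.measureReal_preimage (hAm H).compl.nullMeasurableSet,
      probReal_compl_eq_one_sub (hAm H)]
  rw [hvH, hv0, hA0, probReal_univ] at hfin
  rw [hexit]
  linarith

/-- If the functions `g h` dominate one step of `π` in all states, they dominate its value. -/
theorem RegularRewards.value_le (hR : E.RegularRewards) {π : Policy K X}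
    (hπ : ∀ h, Measurable (π h)) {g : ℕ → X → ℝ}
    (hgH : g H = fun _ => 0)
    (hstep : ∀ s, E.Reachable s →
      ∫ x, E.backup (g (E.level s + 1)) x (π (E.level s) x) ∂E.emit s ≤
        ∫ x, g (E.level s) x ∂E.emit s) :
    E.value π ≤ ∫ x, g 0 x ∂E.emit E.init := by
  let _ : MeasurableSpace S := ⊤
  have hstate : ∀ h, Measurable fun o : S → X × (Fin K → ℝ) => E.stateAt (o, 0) π h := fun h =>
    (E.measurable_stateAt π hπ h).comp measurable_prodMk_zero
  have hcomp : ∀ (h : ℕ) (f : S → ℝ),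
      Integrable (fun o : S → X × (Fin K → ℝ) => f (E.stateAt (o, 0) π h)) E.obsLaw := by
    intro h f
    refine Integrable.of_bound (C := ∑ s, |f s|)
      ((Measurable.of_discrete (f := f)).comp (hstate h)).aestronglyMeasurable
      (Filter.Eventually.of_forall fun o => ?_)
    exact Finset.single_le_sum (f := fun s => |f s|) (fun _ _ => abs_nonneg _)
      (Finset.mem_univ (E.stateAt (o, 0) π h))
  have hri : ∀ h < H, Integrable (fun o => (E.trajectory (o, 0) π h).2.2) E.obsLaw := by
    intro h hh
    refine Integrable.of_bound (C := 1) ((measurable_snd.comp measurable_snd).comp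
      ((E.measurable_trajectory π hπ h).comp measurable_prodMk_zero)).aestronglyMeasurable ?_
    filter_upwards [hR.ae_obs π] with o ho
    have := ho h hh
    rw [Real.norm_eq_abs]
    exact abs_le.2 ⟨by linarith [this.1], this.2⟩
  have key : ∀ h ≤ H, ∑ j ∈ Finset.range h, ∫ o, (E.trajectory (o, 0) π j).2.2 ∂E.obsLaw +
      (∫ o, (∫ x, g h x ∂E.emit (E.stateAt (o, 0) π h)) ∂E.obsLaw) ≤
      ∫ x, g 0 x ∂E.emit E.init := by
    intro h
    induction h with
    | zero => intro _; simp [stateAt]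
    | succ h ih =>
      intro hh
      have ih := ih (by omega)
      rw [Finset.sum_range_succ]
      have h1 := hR.integral_step hπ (h := h) (by omega) (g (h + 1)) MeasurableSet.univ
        (fun _ _ _ _ => trivial)
      simp only [Measure.restrict_univ] at h1
      rw [integral_add (hri h (by omega)) (hcomp (h + 1) fun s => ∫ x, g (h + 1) x ∂E.emit s)] at h1
      have h2 : ∫ o, (∫ x, E.backup (g (h + 1)) x (π h x) ∂E.emit (E.stateAt (o, 0) π h)) ∂E.obsLaw
          ≤ ∫ o, (∫ x, g h x ∂E.emit (E.stateAt (o, 0) π h)) ∂E.obsLaw := by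
        refine integral_mono (hcomp h fun s => ∫ x, E.backup (g (h + 1)) x (π h x) ∂E.emit s)
          (hcomp h fun s => ∫ x, g h x ∂E.emit s) fun o => ?_
        have h4 := hstep _ (E.reachable_stateAt (o, 0) π (h := h) (by omega))
        rwa [E.level_stateAt _ _ (by omega)] at h4
      linarith
  have hfin := key H le_rfl
  rw [← value_eq_sum hR hπ] at hfin
  simpa [hgH] using hfin

end Telescope

end DetCDP
end TwoSampleRL

end

/-! ### The search routine: invariants of the memory and amortized cost. -/

noncomputable section
namespace TwoSampleRL

/-- `m'` arises from `m` by collecting more data. -/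
structure Memory.Le {K : ℕ} {X : Type*} {n : ℕ} (m m' : Memory K X n) : Prop where
  val : ∀ h, m.val h <+: m'.val h
  learned : ∀ h, m.learned h <+: m'.learned h

theorem Memory.Le.refl {K : ℕ} {X : Type*} {n : ℕ} (m : Memory K X n) : m.Le m :=
  ⟨fun _ => List.prefix_rfl, fun _ => List.prefix_rfl⟩

theorem Memory.Le.trans {K : ℕ} {X : Type*} {n : ℕ} {m m' m'' : Memory K X n} (h : m.Le m')
    (h' : m'.Le m'') : m.Le m'' :=
  ⟨fun i => (h.val i).trans (h'.val i), fun i => (h.learned i).trans (h'.learned i)⟩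

/-- The number of validation data sets at the first `H` levels. -/
def Memory.valCount {K : ℕ} {X : Type*} {n : ℕ} (H : ℕ) (m : Memory K X n) : ℕ :=
  ∑ h ∈ Finset.range H, (m.val h).length

section Mmd

variable {K n : ℕ} {X : Type*} {G : Finset (X → ℝ)}

theorem le_mmd (D D' : Dataset K X n) {g : X → ℝ} (hg : g ∈ G) :
    |empMean D (fun z => g z.1) - empMean D' (fun z => g z.1)| ≤ mmd G D D' :=
  le_ciSup (f := fun g : G => |empMean D (fun z => g.1 z.1) - empMean D' (fun z => g.1 z.1)|)
    (Finite.bddAbove_range _) ⟨g, hg⟩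

theorem mmd_le {D D' : Dataset K X n} {b : ℝ} (hb : 0 ≤ b)
    (h : ∀ g ∈ G, |empMean D (fun z => g z.1) - empMean D' (fun z => g z.1)| ≤ b) :
    mmd G D D' ≤ b :=
  Real.iSup_le (fun g => h g.1 g.2) hb

end Mmd

theorem valCount_update {H K : ℕ} {X : Type*} {n : ℕ} (m : Memory K X n) {h : ℕ} (hh : h < H) (D : Dataset K X n)
    (l : ℕ → List (Dataset K X n)) (t : ℕ) :
    Memory.valCount H ⟨l, Function.update m.val h (m.val h ++ [D]), t⟩ = m.valCount H + 1 := by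
  simp only [Memory.valCount]
  have : ∀ i ∈ Finset.range H, (Function.update m.val h (m.val h ++ [D]) i).length =
      (m.val i).length + if i = h then 1 else 0 := by
    intro i _
    by_cases hi : i = h
    · subst hi; simp
    · simp [hi]
  rw [Finset.sum_congr rfl this, Finset.sum_add_distrib]
  simp [hh]

theorem prefix_update {K : ℕ} {X : Type*} {n : ℕ} (l : ℕ → List (Dataset K X n)) (h : ℕ) (D : Dataset K X n) (i : ℕ) :
    l i <+: Function.update l h (l h ++ [D]) i := by
  by_cases hi : i = h
  · subst hi; simp
  · simp [hi]

section Unfold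

variable {K : ℕ} {X : Type*} (acc : Access K X) (G : Finset (X → ℝ)) (θ : Params)
  (d : ℕ) (p : List (Fin K)) (m : Memory K X θ.nTrain)

/-- A call has three outcomes, separated here and in the next two lemmas: data resembling a stored
data set end a recursive call, but are still learned from and expanded in a non-recursive one; new
data enter both lists. -/
theorem dfsLearn_seen_rec (h : ∃ D' ∈ m.val p.length,
      mmd G D' (fun i : Fin θ.nTrain => acc.explore (m.used + i) p) ≤ 2 * θ.τ) :
    dfsLearn acc G θ (d + 1) p true m = { m with used := m.used + θ.nTrain } := by
  rw [dfsLearn]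
  exact if_pos ⟨h, rfl⟩

theorem dfsLearn_seen (h : ∃ D' ∈ m.val p.length,
      mmd G D' (fun i : Fin θ.nTrain => acc.explore (m.used + i) p) ≤ 2 * θ.τ) :
    dfsLearn acc G θ (d + 1) p false m = (List.finRange K).foldl
      (fun m' a => dfsLearn acc G θ d (p ++ [a]) true m')
      ⟨Function.update m.learned p.length (m.learned p.length ++
        [fun i : Fin θ.nTrain => acc.explore (m.used + i) p]), m.val, m.used + θ.nTrain⟩ := by
  rw [dfsLearn]
  refine (if_neg (by simp)).trans ?_
  simp only [if_pos h]

theorem dfsLearn_new (isRec : Bool) (h : ¬ ∃ D' ∈ m.val p.length,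
      mmd G D' (fun i : Fin θ.nTrain => acc.explore (m.used + i) p) ≤ 2 * θ.τ) :
    dfsLearn acc G θ (d + 1) p isRec m = (List.finRange K).foldl
      (fun m' a => dfsLearn acc G θ d (p ++ [a]) true m')
      ⟨Function.update m.learned p.length (m.learned p.length ++
        [fun i : Fin θ.nTrain => acc.explore (m.used + i) p]),
        Function.update m.val p.length (m.val p.length ++
        [fun i : Fin θ.nTrain => acc.explore (m.used + i) p]), m.used + θ.nTrain⟩ := by
  rw [dfsLearn]
  refine (if_neg (fun h' => h h'.1)).trans ?_
  simp only [if_neg h]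

end Unfold

namespace DetCDP

variable {H K : ℕ} {S X : Type*} [MeasurableSpace X] (E : DetCDP H K S X)

/-- The data set collected in state `s` from episode `t` on. -/
def dataAt (ω : ℕ → Episode K S X) (n t : ℕ) (s : S) : Dataset K X n :=
  fun i => E.sampleAt s (ω (t + i))

/-- The hidden state at which a data set was collected. -/
def stateOf {n : ℕ} [NeZero n] (D : Dataset K X n) : S := E.decode (D 0).1

/-- All data sets collected in the blocks of episodes before the `B`-th one represent the value
class up to an error `τ`. -/
def Represents (ω : ℕ → Episode K S X) (G : Finset (X → ℝ)) (n B : ℕ) (τ : ℝ) : Prop :=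
  (∀ t s, E.decode ((ω t).1 s).1 = s) ∧
    ∀ c < B, ∀ s, E.Reachable s → ∀ g ∈ G,
      |empMean (E.dataAt ω n (n * c) s) (fun z => g z.1) - ∫ x, g x ∂E.emit s| ≤ τ

/-- Some validation data set represents the value class in state `s`. -/
def Known {n : ℕ} [NeZero n] (G : Finset (X → ℝ)) (τ : ℝ) (m : Memory K X n) (s : S) : Prop :=
  ∃ D ∈ m.val (E.level s), ∀ g ∈ G,
    |∫ x, g x ∂E.emit (E.stateOf D) - ∫ x, g x ∂E.emit s| ≤ 4 * τ

/-- The state of a data set and all its successors are known. -/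
def Explored {n : ℕ} [NeZero n] (G : Finset (X → ℝ)) (τ : ℝ) (m : Memory K X n)
    (D : Dataset K X n) : Prop :=
  E.Known G τ m (E.stateOf D) ∧
    ∀ a, E.level (E.stateOf D) + 1 < H → E.Known G τ m (E.step (E.stateOf D) a)

/-- The memory consists of data collected in the blocks of episodes before the `B`-th one, of which
`c` have been used. -/
structure Consistent (ω : ℕ → Episode K S X) (G : Finset (X → ℝ)) {n : ℕ} [NeZero n] (B : ℕ)
    (τ : ℝ) (m : Memory K X n) (c : ℕ) : Prop where
  used : m.used = n * c
  learned : ∀ h, ∀ D ∈ m.learned h, E.Reachable (E.stateOf D) ∧ E.level (E.stateOf D) = h ∧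
    ∃ c < B, D = E.dataAt ω n (n * c) (E.stateOf D)
  sublist : ∀ h, (m.val h).Sublist (m.learned h)
  pairwise : ∀ h, (m.val h).Pairwise fun D D' => ¬ mmd G D D' ≤ 2 * τ

/-- The operation `f` on memories takes at most `b` blocks of episodes and preserves consistency;
`k` and `u` bound the growth of the two lists of data sets and of the amortized number of blocks;
`Q` holds afterwards. -/
def Advances (ω : ℕ → Episode K S X) (G : Finset (X → ℝ)) {n : ℕ} [NeZero n] (B : ℕ) (τ : ℝ)
    (b k u : ℕ) (f : Memory K X n → Memory K X n) (Q : Memory K X n → Prop) : Prop :=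
  ∀ m c, E.Consistent ω G B τ m c → c + b ≤ B → ∃ c', E.Consistent ω G B τ (f m) c' ∧
    c' ≤ c + b ∧ c' + K * m.valCount H ≤ c + u + K * (f m).valCount H ∧ m.Le (f m) ∧
    (∀ h, ∀ D ∈ (f m).learned h, D ∈ m.learned h ∨ E.Explored G τ (f m) D) ∧
    (∀ h, ((f m).learned h).length + (m.val h).length ≤
      (m.learned h).length + ((f m).val h).length + k) ∧ Q (f m)

variable {E} {ω : ℕ → Episode K S X} {G : Finset (X → ℝ)} {n : ℕ} [NeZero n] {B : ℕ} {τ : ℝ}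

theorem Known.mono {m m' : Memory K X n} (h : m.Le m') {s : S} (hs : E.Known G τ m s) :
    E.Known G τ m' s := by
  obtain ⟨D, hD, hg⟩ := hs
  exact ⟨D, (h.val _).subset hD, hg⟩

theorem Explored.mono {m m' : Memory K X n} (h : m.Le m') {D : Dataset K X n}
    (hD : E.Explored G τ m D) : E.Explored G τ m' D :=
  ⟨hD.1.mono h, fun a ha => (hD.2 a ha).mono h⟩

theorem Represents.stateOf_dataAt (hω : E.Represents ω G n B τ) (t : ℕ) (s : S) :
    E.stateOf (E.dataAt ω n t s) = s := hω.1 _ _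

/-- Validation data sets of one level belong to different states. -/
theorem Consistent.nodup_stateOf (hω : E.Represents ω G n B τ) (hτ : 0 ≤ τ) {m : Memory K X n}
    {c : ℕ} (hm : E.Consistent ω G B τ m c) (h : ℕ) : ((m.val h).map E.stateOf).Nodup := by
  rw [List.Nodup, List.pairwise_map]
  refine (hm.pairwise h).imp_of_mem fun {D D'} hD hD' hne heq => hne ?_
  obtain ⟨hr, -, c, hc, hDc⟩ := hm.learned h D ((hm.sublist h).subset hD)
  obtain ⟨-, -, c', hc', hDc'⟩ := hm.learned h D' ((hm.sublist h).subset hD')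
  -- Two data sets of one state are both within `τ` of the same expectations, hence within `2 * τ`
  -- of each other, so the test would not have admitted the second.
  refine mmd_le (by linarith) fun g hg => ?_
  have h1 := hω.2 c hc _ hr g hg
  have h2 := hω.2 c' hc' _ hr g hg
  rw [← hDc] at h1
  rw [heq, ← hDc'] at h2
  rw [heq] at h1
  rw [abs_le] at h1 h2 ⊢
  constructor <;> linarith [h1.1, h1.2, h2.1, h2.2]

/-- The validation data sets of a level belong to distinct states of that level. This bounds the
growth of `val`, which pays for the recursive calls. -/
theorem Consistent.length_val_le [Fintype S] (hω : E.Represents ω G n B τ) (hτ : 0 ≤ τ)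
    {m : Memory K X n} {c : ℕ} (hm : E.Consistent ω G B τ m c) (h : ℕ) :
    (m.val h).length ≤ E.width := by
  classical
  by_cases hh : h < H
  · have h1 := hm.nodup_stateOf hω hτ h
    have h2 : ((m.val h).map E.stateOf).toFinset ⊆
        Finset.univ.filter fun s => E.level s = h := by
      intro s hs
      simp only [List.mem_toFinset, List.mem_map] at hs
      obtain ⟨D, hD, rfl⟩ := hs
      simpa using (hm.learned h D ((hm.sublist h).subset hD)).2.1
    calc (m.val h).length = ((m.val h).map E.stateOf).toFinset.card := by
          rw [List.toFinset_card_of_nodup h1, List.length_map]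
      _ ≤ (Finset.univ.filter fun s => E.level s = h).card := Finset.card_le_card h2
      _ ≤ _ := Finset.le_sup (f := fun h => (Finset.univ.filter fun s => E.level s = h).card)
          (Finset.mem_range.2 hh)
  · have : m.val h = [] := by
      refine List.eq_nil_iff_forall_not_mem.2 fun D hD => hh ?_
      rw [← (hm.learned h D ((hm.sublist h).subset hD)).2.1]
      exact E.level_lt _
    simp [this]

theorem Consistent.valCount_le [Fintype S] (hω : E.Represents ω G n B τ) (hτ : 0 ≤ τ)
    {m : Memory K X n} {c : ℕ} (hm : E.Consistent ω G B τ m c) :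
    m.valCount H ≤ E.width * H := by
  calc m.valCount H ≤ ∑ h ∈ Finset.range H, E.width :=
        Finset.sum_le_sum fun h _ => hm.length_val_le hω hτ h
    _ = _ := by simp [mul_comm]

theorem Advances.id : E.Advances ω G (n := n) B τ 0 0 0 id fun _ => True :=
  fun m c hm _ => ⟨c, hm, by simp, by simp, Memory.Le.refl m, fun h D hD => Or.inl hD,
    fun h => by simp, trivial⟩

/-- All counters add up, and what `Q` and `Explored` record survives because memories only grow. The
terms `K * valCount` express an amortization: the `K` child calls that follow a new validation data
set are charged to its addition, so that a recursive call has amortized cost one. -/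
theorem Advances.comp {b k u b' k' u' : ℕ} {f f' : Memory K X n → Memory K X n}
    {Q Q' : Memory K X n → Prop} (h : E.Advances ω G B τ b k u f Q)
    (h' : E.Advances ω G B τ b' k' u' f' Q') (hQ : ∀ m m', m.Le m' → Q m → Q m') :
    E.Advances ω G B τ (b + b') (k + k') (u + u') (fun m => f' (f m)) fun m => Q m ∧ Q' m := by
  intro m c hm hc
  obtain ⟨c₁, hm₁, hb₁, hu₁, hle₁, hnew₁, hlen₁, hQ₁⟩ := h m c hm (by omega)
  obtain ⟨c₂, hm₂, hb₂, hu₂, hle₂, hnew₂, hlen₂, hQ₂⟩ := h' (f m) c₁ hm₁ (by omega)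
  refine ⟨c₂, hm₂, by omega, by beta_reduce; omega, hle₁.trans hle₂, ?_, ?_, hQ _ _ hle₂ hQ₁, hQ₂⟩
  · intro i D hD
    rcases hnew₂ i D hD with hD | hD
    · exact (hnew₁ i D hD).imp_right fun h => h.mono hle₂
    · exact Or.inr hD
  · intro i
    have := hlen₁ i
    have := hlen₂ i
    beta_reduce
    omega

theorem Advances.weaken {b k u b' k' u' : ℕ} {f : Memory K X n → Memory K X n}
    {Q Q' : Memory K X n → Prop} (h : E.Advances ω G B τ b k u f Q) (hb : b ≤ b') (hk : k ≤ k')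
    (hu : u ≤ u') (hQ : ∀ m, Q m → Q' m) : E.Advances ω G B τ b' k' u' f Q' := by
  intro m c hm hc
  obtain ⟨c₁, hm₁, hb₁, hu₁, hle₁, hnew₁, hlen₁, hQ₁⟩ := h m c hm (by omega)
  exact ⟨c₁, hm₁, by omega, by omega, hle₁, hnew₁, fun i => (hlen₁ i).trans (by omega), hQ _ hQ₁⟩

theorem Advances.foldl {ι : Type*} {b k u : ℕ} {f : ι → Memory K X n → Memory K X n}
    {Q : ι → Memory K X n → Prop} (hQ : ∀ i m m', m.Le m' → Q i m → Q i m') (l : List ι)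
    (h : ∀ i ∈ l, E.Advances ω G B τ b k u (f i) (Q i)) :
    E.Advances ω G B τ (l.length * b) (l.length * k) (l.length * u)
      (fun m => l.foldl (fun m' i => f i m') m) fun m => ∀ i ∈ l, Q i m := by
  induction l with
  | nil => exact Advances.id.weaken (by simp) (by simp) (by simp) (by simp)
  | cons i l ih =>
    have h1 := (h i (by simp)).comp (ih fun j hj => h j (by simp [hj])) (hQ i)
    refine Advances.weaken h1 ?_ ?_ ?_ ?_
    · simp [add_mul, add_comm]
    · simp [add_mul, add_comm]
    · simp [add_mul, add_comm]
    · intro m hm j hj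
      rcases List.mem_cons.1 hj with rfl | hj
      · exact hm.1
      · exact hm.2 j hj

/-- The effect of searching all children of a state `s` after a new data set `D` from `s` has been
added to the memory `m`, which gives `m₃`. -/
theorem advances_children {f : Fin K → Memory K X n → Memory K X n} {s : S} {b k u : ℕ}
    {P : Prop} (hP : E.level s + 1 < H → P)
    (hf : ∀ a, E.Advances ω G B τ b 0 1 (f a) fun m' => P → E.Known G τ m' (E.step s a))
    {m m₃ : Memory K X n} {c h₀ : ℕ} {D : Dataset K X n} (hDs : E.stateOf D = s)
    (hle : m.Le m₃) (hcons : E.Consistent ω G B τ m₃ (c + 1)) (hcB : c + (1 + K * b) ≤ B)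
    (hD : D ∈ m₃.learned h₀)
    (hlearned : ∀ h, ∀ D' ∈ m₃.learned h, D' ∈ m.learned h ∨ D' = D)
    (hknown : E.Known G τ m₃ s) (hval : 1 + K + K * m.valCount H ≤ u + K * m₃.valCount H)
    (hlen : ∀ h, (m₃.learned h).length + (m.val h).length ≤
      (m.learned h).length + (m₃.val h).length + k)
    {m' : Memory K X n} (hm' : m' = (List.finRange K).foldl (fun m' a => f a m') m₃) :
    ∃ c', E.Consistent ω G B τ m' c' ∧
      c' ≤ c + (1 + K * b) ∧ c' + K * m.valCount H ≤ c + u + K * m'.valCount H ∧ m.Le m' ∧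
      (∀ h, ∀ D ∈ m'.learned h, D ∈ m.learned h ∨ E.Explored G τ m' D) ∧
      (∀ h, (m'.learned h).length + (m.val h).length ≤
        (m.learned h).length + (m'.val h).length + k) ∧
      E.Known G τ m' s ∧ ∃ D ∈ m'.learned h₀, E.stateOf D = s := by
  have hfold := Advances.foldl (f := f) (Q := fun a m' => P → E.Known G τ m' (E.step s a))
    (fun a m₁ m₂ hle hk hd => (hk hd).mono hle) (List.finRange K) (fun a _ => hf a)
  obtain ⟨c', hm'', hb', hu', hle', hnew', hlen', hQ'⟩ := hfold m₃ (c + 1) hcons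
    (by simp only [List.length_finRange]; omega)
  beta_reduce at hm'' hu' hle' hnew' hlen' hQ'
  rw [← hm'] at hm'' hu' hle' hnew' hlen' hQ'
  simp only [List.length_finRange, mul_one, mul_zero, add_zero] at hb' hu' hlen'
  refine ⟨c', hm'', by omega, by omega, hle.trans hle', ?_, ?_, hknown.mono hle',
    D, (hle'.learned _).subset hD, hDs⟩
  · intro h D' hD'
    rcases hnew' h D' hD' with h1 | h1
    -- Of the data sets added before the recursion only `D` is new. It is explored afterwards, since
    -- each child call leaves its state known; at the last level there is nothing to ask of the
    -- children.
    · refine (hlearned h D' h1).imp_right ?_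
      rintro rfl
      rw [Explored, hDs]
      refine ⟨hknown.mono hle', fun a ha => ?_⟩
      exact hQ' a (List.mem_finRange a) (hP ha)
    · exact Or.inr h1
  · intro h
    have := hlen h
    have := hlen' h
    omega

/-- The effect of one call of the search routine. -/
theorem advances_dfsLearn {θ : Params} [NeZero θ.nTrain]
    (hω : E.Represents ω G θ.nTrain B θ.τ) (hτ : 0 ≤ θ.τ) (d : ℕ) :
    ∀ (p : List (Fin K)) (isRec : Bool), p.length + d = H →
      E.Advances ω G B θ.τ ((K + 1) ^ d) (if isRec then 0 else 1) (if isRec then 1 else 1 + K)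
        (dfsLearn (E.access ω) G θ d p isRec) fun m =>
          (0 < d → E.Known G θ.τ m (p.foldl E.step E.init)) ∧
          (0 < d → isRec = false →
            ∃ D ∈ m.learned p.length, E.stateOf D = p.foldl E.step E.init) := by
  classical
  induction d with
  | zero =>
    intro p isRec hp
    exact Advances.id.weaken (by simp) (by simp) (by simp) (by simp)
  | succ d ih =>
    intro p isRec hp
    have hlt : p.length < H := by omega
    set s := p.foldl E.step E.init with hs
    have hreach : E.Reachable s := E.reachable_foldl p hlt
    have hlev : E.level s = p.length := E.level_foldl p hlt
    -- A call uses one block and makes at most `K` calls one level deeper. This worst-case count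
    -- holds whatever the tests decide, and it keeps all blocks in the range where accuracy is
    -- assumed.
    have hpow : 1 + K * (K + 1) ^ d ≤ (K + 1) ^ (d + 1) := by
      rw [pow_succ]
      nlinarith [Nat.one_le_pow d (K + 1) (by omega)]
    intro m c hm hc
    set D : Dataset K X θ.nTrain := E.dataAt ω θ.nTrain m.used s with hD
    have hDs : E.stateOf D = s := hω.stateOf_dataAt _ _
    have hDe : D = fun i : Fin θ.nTrain => (E.access ω).explore (m.used + i) p := rfl
    have hDc : D = E.dataAt ω θ.nTrain (θ.nTrain * c) s := by rw [hD, hm.used]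
    have hcB : c < B := by omega
    have hDlearned : E.Reachable (E.stateOf D) ∧ E.level (E.stateOf D) = p.length ∧
        ∃ c < B, D = E.dataAt ω θ.nTrain (θ.nTrain * c) (E.stateOf D) := by
      rw [hDs]
      exact ⟨hreach, hlev, c, hcB, hDc⟩
    have hDrep := hω.2 c hcB s hreach
    rw [← hDc] at hDrep
    have hmem : ∀ h, ∀ D' ∈ Function.update m.learned p.length (m.learned p.length ++ [D]) h,
        D' ∈ m.learned h ∨ (h = p.length ∧ D' = D) := by
      intro h D' hD'
      by_cases hh : h = p.length
      · subst hh
        simpa using hD'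
      · rw [Function.update_of_ne hh] at hD'
        exact Or.inl hD'
    have hmem' : ∀ h, ∀ D' ∈ Function.update m.learned p.length (m.learned p.length ++ [D]) h,
        E.Reachable (E.stateOf D') ∧ E.level (E.stateOf D') = h ∧
          ∃ c < B, D' = E.dataAt ω θ.nTrain (θ.nTrain * c) (E.stateOf D') := by
      intro h D' hD'
      rcases hmem h D' hD' with h1 | ⟨rfl, rfl⟩
      · exact hm.learned h D' h1
      · exact hDlearned
    have hself : D ∈ Function.update m.learned p.length (m.learned p.length ++ [D]) p.length := by
      simp
    have hchild : ∀ a, E.Advances ω G B θ.τ ((K + 1) ^ d) 0 1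
        (dfsLearn (E.access ω) G θ d (p ++ [a]) true)
        fun m' => 0 < d → E.Known G θ.τ m' (E.step s a) := fun a =>
      (ih (p ++ [a]) true (by simp; omega)).weaken le_rfl le_rfl le_rfl
        fun m' hm' hd => by simpa [hs] using hm'.1 hd
    have hP : E.level s + 1 < H → 0 < d := fun h => by omega
    have hcB' : c + (1 + K * (K + 1) ^ d) ≤ B := by omega
    by_cases hseen : ∃ D' ∈ m.val p.length, mmd G D' D ≤ 2 * θ.τ
    -- The 4 in `Known`: the test allows `2 * τ`, and each of the two empirical means is off by at
    -- most `τ`.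
    · have hknown : E.Known G θ.τ m s := by
        obtain ⟨D', hD', hle⟩ := hseen
        refine ⟨D', by rwa [hlev], fun g hg => ?_⟩
        obtain ⟨hr', -, c', hc', hDc'⟩ := hm.learned _ D' ((hm.sublist _).subset hD')
        have h1 := hω.2 c' hc' _ hr' g hg
        rw [← hDc'] at h1
        have h2 := hDrep g hg
        have h3 := (le_mmd D' D hg).trans hle
        rw [abs_le] at h1 h2 h3 ⊢
        constructor <;> linarith [h1.1, h1.2, h2.1, h2.2, h3.1, h3.2]
      cases isRec with
      | true =>
        rw [hDe] at hseen
        rw [dfsLearn_seen_rec (E.access ω) G θ d p m hseen]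
        refine ⟨c + 1, ⟨?_, hm.learned, hm.sublist, hm.pairwise⟩, by omega, ?_,
          ⟨fun _ => List.prefix_rfl, fun _ => List.prefix_rfl⟩, fun h D hD => Or.inl hD,
          fun h => by simp, fun _ => hknown, by simp⟩
        · simp only [hm.used]; ring
        · simp [Memory.valCount]
      | false =>
        rw [hDe] at hseen
        rw [dfsLearn_seen (E.access ω) G θ d p m hseen, ← hDe]
        have hle₃ : m.Le ⟨Function.update m.learned p.length (m.learned p.length ++ [D]), m.val,
          m.used + θ.nTrain⟩ := ⟨fun _ => List.prefix_rfl, fun i => prefix_update _ _ _ _⟩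
        -- No validation data set is added, so the child calls are not amortized (`u = 1 + K`), and
        -- `learned` grows by one more than `val` (`k = 1`).
        obtain ⟨c', h1, h2, h3, h4, h5, h6, h7, h8⟩ :=
          advances_children (k := 1) (u := 1 + K) (h₀ := p.length) hP hchild hDs hle₃
          ⟨by simp only [hm.used]; ring, hmem',
            fun h => (hm.sublist h).trans (hle₃.learned h).sublist, hm.pairwise⟩ hcB' hself
          (fun h D' hD' => (hmem h D' hD').imp_right And.right) (hknown.mono hle₃)
          (by simp [Memory.valCount])
          (fun h => by by_cases hh : h = p.length
                       · subst hh; simp; omega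
                       · simp [hh]) rfl
        exact ⟨c', h1, h2.trans (by omega), h3, h4, h5, h6, fun _ => h7, fun _ _ => h8⟩
    · have hnew := dfsLearn_new (E.access ω) G θ d p m isRec (by rwa [← hDe])
      rw [← hDe] at hnew
      rw [hnew]
      have hle₃ : m.Le ⟨Function.update m.learned p.length (m.learned p.length ++ [D]),
        Function.update m.val p.length (m.val p.length ++ [D]),
        m.used + θ.nTrain⟩ := ⟨fun i => prefix_update _ _ _ _, fun i => prefix_update _ _ _ _⟩
      have hsub : ∀ h, (Function.update m.val p.length (m.val p.length ++ [D]) h).Sublist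
          (Function.update m.learned p.length (m.learned p.length ++ [D]) h) := by
        intro h
        by_cases hh : h = p.length
        · subst hh
          simpa using hm.sublist p.length
        · simpa [hh] using hm.sublist h
      have hpair : ∀ h, (Function.update m.val p.length (m.val p.length ++ [D]) h).Pairwise
          fun D D' => ¬ mmd G D D' ≤ 2 * θ.τ := by
        intro h
        by_cases hh : h = p.length
        · subst hh
          simp only [Function.update_self]
          refine List.pairwise_append.2 ⟨hm.pairwise _, List.pairwise_singleton _ _, ?_⟩
          intro D' hD' D'' hD''
          obtain rfl := List.mem_singleton.1 hD''
          exact fun hle => hseen ⟨D', hD', hle⟩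
        · simpa [hh] using hm.pairwise h
      have hu : 1 ≤ if isRec = true then 1 else 1 + K := by split_ifs <;> omega
      -- The new validation data set pays for the `K` child calls, leaving amortized cost 1.
      obtain ⟨c', h1, h2, h3, h4, h5, h6, h7, h8⟩ :=
        advances_children (k := 0) (u := 1) (h₀ := p.length) hP hchild hDs hle₃
        ⟨by simp only [hm.used]; ring, hmem', hsub, hpair⟩ hcB' hself
        (fun h D' hD' => (hmem h D' hD').imp_right And.right)
        ⟨D, by simp [hlev], fun g hg => by rw [hDs]; simpa using hτ⟩
        (by rw [valCount_update m hlt]; linarith)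
        (fun h => by by_cases hh : h = p.length
                     · subst hh; simp; omega
                     · simp [hh]) rfl
      exact ⟨c', h1, h2.trans (by omega), h3.trans (by omega), h4, h5,
        fun h => (h6 h).trans (by omega), fun _ => h7, fun _ _ => h8⟩

end DetCDP
end TwoSampleRL

end

/-! ### Regression at a single level. -/

noncomputable section
namespace TwoSampleRL

/-- The integrand of the empirical policy objective. -/
def policyTerm {K : ℕ} {X : Type*} (π : X → Fin K) (g' : X → ℝ) (z : Sample K X) : ℝ :=
  if π z.1 = z.2.1 then K * (z.2.2.1 + g' z.2.2.2) else 0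

/-- The integrand of the empirical value loss. -/
def lossTerm {K : ℕ} {X : Type*} (π : X → Fin K) (g' g : X → ℝ) (z : Sample K X) : ℝ :=
  if π z.1 = z.2.1 then K * (g z.1 - z.2.2.1 - g' z.2.2.2) ^ 2 else 0

theorem policyObj_eq {K n : ℕ} {X : Type*} (D : Dataset K X n) (g' : X → ℝ) (π : X → Fin K) :
    policyObj D g' π = empMean D (policyTerm π g') := rfl

theorem valueLoss_eq {K n : ℕ} {X : Type*} (D : Dataset K X n) (π : X → Fin K) (g' g : X → ℝ) :
    valueLoss D π g' g = empMean D (lossTerm π g' g) := rfl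

/-- Optimality for an empirical sum controls only the sum `r` of the population excesses. When the
excesses are nonnegative, the sum controls each of them, at the price of a factor equal to the
number of data sets. -/
theorem list_sum_le_of_approx {α : Type*} (l : List α) (a b r : α → ℝ) (t : ℝ)
    (h : ∀ x ∈ l, r x ≤ a x - b x + t) (hab : (l.map a).sum ≤ (l.map b).sum) :
    (l.map r).sum ≤ l.length * t := by
  have key : (l.map r).sum ≤ (l.map a).sum - (l.map b).sum + l.length * t := by
    clear hab
    induction l with
    | nil => simp
    | cons x l ih =>
      have h1 := ih fun y hy => h y (by simp [hy])
      have h2 := h x (by simp)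
      simp only [List.map_cons, List.sum_cons, List.length_cons]
      push_cast
      linarith
  linarith

theorem list_single_le_sum {α : Type*} {l : List α} {r : α → ℝ} (h : ∀ x ∈ l, 0 ≤ r x) {x : α}
    (hx : x ∈ l) : r x ≤ (l.map r).sum :=
  List.single_le_sum (by simpa using h) _ (List.mem_map_of_mem hx)

section Terms

variable {K : ℕ} {X : Type*} {π : X → Fin K} {g' g : X → ℝ}

/-- The sharper bound is `2 * K`; the range `4 * K` of the loss terms is used so that one
concentration bound serves all test functions. -/
theorem policyTerm_mem (hg' : ∀ x, g' x ∈ Set.Icc (0 : ℝ) 1) {z : Sample K X}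
    (hz : z.2.2.1 ∈ Set.Icc (0 : ℝ) 1) : policyTerm π g' z ∈ Set.Icc (0 : ℝ) (4 * K) := by
  have hK : (0 : ℝ) ≤ K := Nat.cast_nonneg K
  have h1 := hg' z.2.2.2
  unfold policyTerm
  split_ifs
  · exact ⟨mul_nonneg hK (add_nonneg hz.1 h1.1), by nlinarith [hz.2, h1.2]⟩
  · exact ⟨le_rfl, by positivity⟩

theorem lossTerm_mem (hg' : ∀ x, g' x ∈ Set.Icc (0 : ℝ) 1) (hg : ∀ x, g x ∈ Set.Icc (0 : ℝ) 1)
    {z : Sample K X} (hz : z.2.2.1 ∈ Set.Icc (0 : ℝ) 1) :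
    lossTerm π g' g z ∈ Set.Icc (0 : ℝ) (4 * K) := by
  have hK : (0 : ℝ) ≤ K := Nat.cast_nonneg K
  have h1 := hg' z.2.2.2
  have h2 := hg z.1
  unfold lossTerm
  split_ifs
  · refine ⟨by positivity, ?_⟩
    rw [mul_comm]
    refine mul_le_mul_of_nonneg_right ?_ hK
    nlinarith [hz.1, hz.2, h1.1, h1.2, h2.1, h2.2]
  · exact ⟨le_rfl, by positivity⟩

variable [MeasurableSpace X]

theorem measurable_policyTerm (hπ : Measurable π) (hg' : Measurable g') :
    Measurable (policyTerm π g') := by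
  unfold policyTerm
  exact Measurable.ite (measurableSet_eq_fun (by fun_prop) (by fun_prop)) (by fun_prop)
    measurable_const

theorem measurable_lossTerm (hπ : Measurable π) (hg' : Measurable g') (hg : Measurable g) :
    Measurable (lossTerm π g' g) := by
  unfold lossTerm
  exact Measurable.ite (measurableSet_eq_fun (by fun_prop) (by fun_prop)) (by fun_prop)
    measurable_const

end Terms

/-- The value class one level after `h`. -/
def nextClass {X : Type*} (H : ℕ) (G : Finset (X → ℝ)) (h : ℕ) : Set (X → ℝ) :=
  if h + 1 < H then (G : Set (X → ℝ)) else {fun _ => 0}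

theorem nextClass_subset {H : ℕ} {X : Type*} {G : Finset (X → ℝ)} {h : ℕ} {g' : X → ℝ} (hg' : g' ∈ nextClass H G h) :
    g' ∈ insert (fun _ => (0 : ℝ)) (G : Set (X → ℝ)) := by
  unfold nextClass at hg'
  split_ifs at hg' with h1
  · exact Or.inr hg'
  · exact Or.inl hg'

theorem nextClass_last {H : ℕ} {X : Type*} {G : Finset (X → ℝ)} {h : ℕ} {g' : X → ℝ} (hg' : g' ∈ nextClass H G h) :
    h + 1 < H ∨ g' = fun _ => 0 := by
  unfold nextClass at hg'
  split_ifs at hg' with h1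
  · exact Or.inl h1
  · exact Or.inr hg'

namespace DetCDP

variable {H K : ℕ} {S X : Type*} [MeasurableSpace X]

section Population

variable {E : DetCDP H K S X} [Fintype S] [NeZero K]

theorem RegularRewards.integral_policyTerm (hR : E.RegularRewards) {s : S} (hs : E.Reachable s)
    {π : X → Fin K} (hπ : Measurable π) {g' : X → ℝ} (hgm : Measurable g')
    (hg : ∀ x, g' x ∈ Set.Icc (0 : ℝ) 1) (hlast : E.level s + 1 < H ∨ g' = fun _ => 0) :
    ∫ e, policyTerm π g' (E.sampleAt s e) ∂E.episodeLaw =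
      ∫ x, E.backup g' x (π x) ∂E.emit s := by
  have := hR.integral_sampleAt hs hπ (f := fun _ => 1) measurable_const (B := 1) (by simp) hgm hg
    hlast
  simp only [one_mul] at this
  exact this

theorem integral_sampleAt_fst (E : DetCDP H K S X) (s : S) {π : X → Fin K} (hπ : Measurable π)
    {f : X → ℝ} (hf : Measurable f) {B : ℝ} (hB : ∀ x, |f x| ≤ B) :
    ∫ e, (if π (E.sampleAt s e).1 = (E.sampleAt s e).2.1 then (K : ℝ) * f (E.sampleAt s e).1
      else 0) ∂E.episodeLaw = ∫ x, f x ∂E.emit s := by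
  have hK : (0 : ℝ) < K := by exact_mod_cast Nat.pos_of_ne_zero (NeZero.ne K)
  have hB0 : 0 ≤ B := by
    have := (nonempty_of_isProbabilityMeasure (E.emit s)).some
    exact (abs_nonneg _).trans (hB this)
  have hmeas : Measurable fun z : Sample K X => if π z.1 = z.2.1 then (K : ℝ) * f z.1 else 0 :=
    Measurable.ite (measurableSet_eq_fun (by fun_prop) (by fun_prop)) (by fun_prop)
      measurable_const
  have hint : Integrable (fun e => if π (E.sampleAt s e).1 = (E.sampleAt s e).2.1 then
      (K : ℝ) * f (E.sampleAt s e).1 else 0) E.episodeLaw := by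
    refine Integrable.of_bound (C := K * B)
      (hmeas.comp (E.measurable_sampleAt s)).aestronglyMeasurable
      (Filter.Eventually.of_forall fun e => ?_)
    split_ifs
    · rw [Real.norm_eq_abs, abs_mul, abs_of_pos hK]
      gcongr
      exact hB _
    · simp only [norm_zero]; positivity
  rw [E.integral_episodeLaw hint]
  have hmp := (E.measurePreserving_stateLaw_fst s).comp (E.measurePreserving_obs_apply s)
  have hterm : ∀ a : Fin K, ∫ o, (if π (o s).1 = a then (K : ℝ) * f (o s).1 else 0) ∂E.obsLaw =
      K * ∫ x, (if π x = a then f x else 0) ∂E.emit s := by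
    intro a
    have hm : Measurable fun x => if π x = a then f x else 0 :=
      Measurable.ite (hπ (measurableSet_singleton a)) hf measurable_const
    rw [← hmp.map_eq, integral_map hmp.measurable.aemeasurable hm.aestronglyMeasurable,
      ← integral_const_mul]
    simp
  refine (congrArg (· / (K : ℝ)) (Finset.sum_congr rfl fun a _ => hterm a)).trans ?_
  rw [← Finset.mul_sum, mul_comm, mul_div_assoc, div_self hK.ne', mul_one, ← integral_finsetSum]
  · simp
  · intro a _
    refine Integrable.of_bound (C := B) (Measurable.ite (hπ (measurableSet_singleton a)) hf
      measurable_const).aestronglyMeasurable (Filter.Eventually.of_forall fun x => ?_)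
    split_ifs
    · exact hB x
    · simpa using hB0

theorem integrable_of_unit {Y : Type*} [MeasurableSpace Y] {μ : Measure Y} [IsProbabilityMeasure μ]
    {f : Y → ℝ} {b : ℝ} (hf : Measurable f) (h : ∀ᵐ y ∂μ, f y ∈ Set.Icc 0 b) : Integrable f μ :=
  Integrable.of_mem_Icc 0 b hf.aemeasurable h

/-- The excess loss is the excess squared distance to the backup. -/
theorem RegularRewards.integral_lossTerm_sub (hR : E.RegularRewards) {s : S} (hs : E.Reachable s)
    {π : X → Fin K} (hπ : Measurable π) {g' : X → ℝ} (hgm : Measurable g')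
    (hg : ∀ x, g' x ∈ Set.Icc (0 : ℝ) 1) (hlast : E.level s + 1 < H ∨ g' = fun _ => 0)
    {g₁ g₂ : X → ℝ} (hm₁ : Measurable g₁) (h₁ : ∀ x, g₁ x ∈ Set.Icc (0 : ℝ) 1)
    (hm₂ : Measurable g₂) (h₂ : ∀ x, g₂ x ∈ Set.Icc (0 : ℝ) 1) :
    ∫ e, lossTerm π g' g₁ (E.sampleAt s e) ∂E.episodeLaw -
      ∫ e, lossTerm π g' g₂ (E.sampleAt s e) ∂E.episodeLaw =
      ∫ x, (g₁ x - E.backup g' x (π x)) ^ 2 ∂E.emit s -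
        ∫ x, (g₂ x - E.backup g' x (π x)) ^ 2 ∂E.emit s := by
  have hli : ∀ g : X → ℝ, Measurable g → (∀ x, g x ∈ Set.Icc (0 : ℝ) 1) →
      Integrable (fun e => lossTerm π g' g (E.sampleAt s e)) E.episodeLaw := by
    intro g hm h
    refine integrable_of_unit (b := 4 * K) ((measurable_lossTerm hπ hgm hm).comp
      (E.measurable_sampleAt s)) ?_
    filter_upwards [hR.ae_sampleAt hs] with e he
    exact lossTerm_mem hg h (he e.2)
  have hbm := E.measurable_backup g' hπ
  have hsi : ∀ g : X → ℝ, Measurable g → (∀ x, g x ∈ Set.Icc (0 : ℝ) 1) →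
      Integrable (fun x => (g x - E.backup g' x (π x)) ^ 2) (E.emit s) := by
    intro g hm h
    refine integrable_of_unit (b := 4) (by fun_prop) ?_
    filter_upwards [hR.ae_backup hs hg] with x hx
    exact ⟨sq_nonneg _, by nlinarith [(hx (π x)).1, (hx (π x)).2, (h x).1, (h x).2]⟩
  rw [← integral_sub (hli g₁ hm₁ h₁) (hli g₂ hm₂ h₂),
    ← integral_sub (hsi g₁ hm₁ h₁) (hsi g₂ hm₂ h₂)]
  -- The difference of two squares is affine in the regression target, with slope `-2 * f` and
  -- constant part `q`. Hence the variance of the target cancels and only its conditional mean, the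
  -- backup, remains.
  let f (x : X) : ℝ := g₁ x - g₂ x
  let q (x : X) : ℝ := g₁ x ^ 2 - g₂ x ^ 2
  have hfB : ∀ x, |f x| ≤ 1 := fun x => abs_le.2
    ⟨by simp only [f]; linarith [(h₁ x).1, (h₂ x).2], by simp only [f]; linarith [(h₁ x).2, (h₂ x).1]⟩
  have hqB : ∀ x, |q x| ≤ 1 := fun x => abs_le.2
    ⟨by simp only [q]; nlinarith [(h₁ x).1, (h₂ x).2, (h₂ x).1],
      by simp only [q]; nlinarith [(h₁ x).2, (h₂ x).1, (h₁ x).1]⟩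
  have hfm : Measurable f := hm₁.sub hm₂
  have hqm : Measurable q := (hm₁.pow_const 2).sub (hm₂.pow_const 2)
  have e1 := integral_sampleAt_fst E s hπ hqm hqB
  have e2 := hR.integral_sampleAt hs hπ hfm hfB hgm hg hlast
  have hpw : ∀ e, lossTerm π g' g₁ (E.sampleAt s e) - lossTerm π g' g₂ (E.sampleAt s e) =
      (if π (E.sampleAt s e).1 = (E.sampleAt s e).2.1 then (K : ℝ) * q (E.sampleAt s e).1 else 0)
      - 2 * (if π (E.sampleAt s e).1 = (E.sampleAt s e).2.1 then
        (K : ℝ) * (f (E.sampleAt s e).1 * ((E.sampleAt s e).2.2.1 + g' (E.sampleAt s e).2.2.2))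
        else 0) := by
    intro e
    simp only [lossTerm, f, q]
    split_ifs <;> ring
  have hK : (0 : ℝ) ≤ K := Nat.cast_nonneg K
  have hi1 : Integrable (fun e => if π (E.sampleAt s e).1 = (E.sampleAt s e).2.1 then
      (K : ℝ) * q (E.sampleAt s e).1 else 0) E.episodeLaw := by
    have hmm : Measurable fun z : Sample K X => if π z.1 = z.2.1 then (K : ℝ) * q z.1 else 0 :=
      Measurable.ite (measurableSet_eq_fun (by fun_prop) (by fun_prop)) (by fun_prop)
        measurable_const
    refine Integrable.of_bound (C := K) (hmm.comp (E.measurable_sampleAt s)).aestronglyMeasurable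
      (Filter.Eventually.of_forall fun e => ?_)
    split_ifs
    · rw [Real.norm_eq_abs, abs_mul, abs_of_nonneg hK]
      nlinarith [hqB (E.sampleAt s e).1]
    · simp
  have hi2 : Integrable (fun e => if π (E.sampleAt s e).1 = (E.sampleAt s e).2.1 then
        (K : ℝ) * (f (E.sampleAt s e).1 * ((E.sampleAt s e).2.2.1 + g' (E.sampleAt s e).2.2.2))
        else 0) E.episodeLaw := by
    have := (hi1.sub ((hli g₁ hm₁ h₁).sub (hli g₂ hm₂ h₂))).const_mul (1 / 2 : ℝ)
    refine this.congr (Filter.Eventually.of_forall fun e => ?_)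
    simp only [Pi.sub_apply, hpw]
    ring
  simp only [hpw]
  rw [integral_sub hi1 (hi2.const_mul 2), integral_const_mul, e1, e2]
  have hqi : Integrable q (E.emit s) := Integrable.of_bound (C := 1) hqm.aestronglyMeasurable
    (Filter.Eventually.of_forall hqB)
  have hfi : Integrable (fun x => f x * E.backup g' x (π x)) (E.emit s) := by
    refine Integrable.of_bound (C := 1 * 2) (hfm.mul hbm).aestronglyMeasurable ?_
    filter_upwards [hR.ae_backup hs hg] with x hx
    rw [Real.norm_eq_abs, abs_mul]
    exact mul_le_mul (hfB x) (by rw [abs_of_nonneg (hx _).1]; exact (hx _).2) (abs_nonneg _)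
      zero_le_one
  rw [← integral_const_mul, ← integral_sub hqi (hfi.const_mul 2)]
  refine integral_congr_ae (Filter.Eventually.of_forall fun x => ?_)
  simp only [f, q]
  ring

end Population

/-- In all blocks of episodes before the `B`-th one, all empirical objectives are accurate up to
`τ` in all reachable states. -/
structure Concentrated [Fintype S] (E : DetCDP H K S X) (ω : ℕ → Episode K S X) (G : Finset (X → ℝ))
    (P : Finset (X → Fin K)) (n B : ℕ) (τ : ℝ) : Prop where
  represents : E.Represents ω G n B τ
  policy : ∀ c < B, ∀ s, E.Reachable s → ∀ g' ∈ insert (fun _ => (0 : ℝ)) (G : Set (X → ℝ)),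
    ∀ π ∈ P, |empMean (E.dataAt ω n (n * c) s) (policyTerm π g') -
      ∫ e, policyTerm π g' (E.sampleAt s e) ∂E.episodeLaw| ≤ τ
  loss : ∀ c < B, ∀ s, E.Reachable s → ∀ g' ∈ insert (fun _ => (0 : ℝ)) (G : Set (X → ℝ)),
    ∀ π ∈ P, ∀ g ∈ G, |empMean (E.dataAt ω n (n * c) s) (lossTerm π g' g) -
      ∫ e, lossTerm π g' g (E.sampleAt s e) ∂E.episodeLaw| ≤ τ

section Fit

variable {E : DetCDP H K S X} [Fintype S] [NeZero K] {ω : ℕ → Episode K S X} {G : Finset (X → ℝ)}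
  {P : Finset (X → Fin K)} {n : ℕ} [NeZero n] {B : ℕ} {τ : ℝ}

theorem nextClass_unit (hG : ∀ g ∈ G, Measurable g ∧ ∀ x, g x ∈ Set.Icc (0 : ℝ) 1) {h : ℕ}
    {g' : X → ℝ} (hg' : g' ∈ nextClass H G h) :
    Measurable g' ∧ ∀ x, g' x ∈ Set.Icc (0 : ℝ) 1 := by
  rcases nextClass_subset hg' with rfl | h1
  · exact ⟨measurable_const, fun _ => ⟨le_rfl, zero_le_one⟩⟩
  · exact hG g' h1

/-- Quality of the fitted policy and the fitted value function of one level, relative to the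
optimal policy and value for the regression target of the next level. -/
theorem Concentrated.fit (hω : E.Concentrated ω G P n B τ) (hR : E.RegularRewards)
    (hG : ∀ g ∈ G, Measurable g ∧ ∀ x, g x ∈ Set.Icc (0 : ℝ) 1) (hP : ∀ π ∈ P, Measurable π)
    (O : Oracles K n G P) {m : Memory K X n} {c : ℕ} (hm : E.Consistent ω G B τ m c) {h : ℕ}
    {g' : X → ℝ} (hg' : g' ∈ nextClass H G h) {β : ℝ} (hβ : 0 < β)
    (hL : (m.learned h).length * τ ≤ β ^ 2 / 4)
    {πs : X → Fin K} (hπs : πs ∈ P) {gs : X → ℝ} (hgs : gs ∈ G)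
    (hopt : ∀ s, E.level s = h → ∀ᵐ x ∂E.emit s,
      (∀ a, E.backup g' x a ≤ E.backup g' x (πs x)) ∧ gs x = E.backup g' x (πs x)) :
    (∀ D ∈ m.learned h, ∫ x, gs x ∂E.emit (E.stateOf D) - β ^ 2 / 2 ≤
      ∫ x, E.backup g' x (O.policy (m.learned h) g' x) ∂E.emit (E.stateOf D)) ∧
    ∀ D ∈ m.val h, |∫ x, O.value (m.val h) (O.policy (m.learned h) g') g' x ∂E.emit (E.stateOf D) -
      ∫ x, gs x ∂E.emit (E.stateOf D)| ≤ 2 * β + β ^ 2 / 2 := by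
  set π := O.policy (m.learned h) g' with hπdef
  set g := O.value (m.val h) π g' with hgdef
  have hπP : π ∈ P := O.policy_mem _ _
  have hgG : g ∈ G := O.value_mem _ _ _
  obtain ⟨hgm', hg01'⟩ := nextClass_unit hG hg'
  -- Accuracy on any data set forces `0 ≤ τ`; without data both claims are void.
  have hτ : 0 ≤ τ ∨ m.learned h = [] := by
    rcases List.eq_nil_or_concat (m.learned h) with h0 | ⟨l, D, hl⟩
    · exact Or.inr h0
    · left
      obtain ⟨hr, -, c, hc, -⟩ := hm.learned h D (by simp [hl])
      exact (abs_nonneg _).trans (hω.represents.2 c hc _ hr g hgG)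
  rcases hτ with hτ | hnil
  swap
  · have hv : m.val h = [] := by
      have := hm.sublist h
      rw [hnil] at this
      exact List.sublist_nil.1 this
    rw [hnil, hv]
    simp
  let T (x : X) : ℝ := E.backup g' x (π x)
  have hTm : Measurable T := E.measurable_backup g' (hP π hπP)
  have hdata : ∀ D ∈ m.learned h, E.Reachable (E.stateOf D) ∧ E.level (E.stateOf D) = h ∧
      (E.level (E.stateOf D) + 1 < H ∨ g' = fun _ => 0) := by
    intro D hD
    obtain ⟨h1, h2, -⟩ := hm.learned h D hD
    exact ⟨h1, h2, by rw [h2]; exact nextClass_last hg'⟩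
  -- Optimality of `gs` keeps the backup of `π` below `gs`, hence below 1, although a backup is only
  -- bounded by 2 in general.
  have hT01 : ∀ D ∈ m.learned h, ∀ᵐ x ∂E.emit (E.stateOf D), T x ∈ Set.Icc (0 : ℝ) (gs x) := by
    intro D hD
    obtain ⟨h1, h2, -⟩ := hdata D hD
    filter_upwards [hopt _ h2, hR.ae_backup h1 hg01'] with x hx hb
    exact ⟨(hb _).1, by rw [hx.2]; exact hx.1 _⟩
  have hgs01 := (hG gs hgs).2
  have hgsm := (hG gs hgs).1
  have hg01 := (hG g hgG).2
  have hgm := (hG g hgG).1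
  have hgi : ∀ s, Integrable g (E.emit s) := fun s =>
    integrable_of_unit hgm (Filter.Eventually.of_forall hg01)
  have hgsi : ∀ s, Integrable gs (E.emit s) := fun s =>
    integrable_of_unit hgsm (Filter.Eventually.of_forall hgs01)
  have hTi : ∀ D ∈ m.learned h, Integrable T (E.emit (E.stateOf D)) := fun D hD =>
    integrable_of_unit (b := 1) hTm ((hT01 D hD).mono fun x hx => ⟨hx.1, hx.2.trans (hgs01 x).2⟩)
  -- the regret of the policy
  let ρ (D : Dataset K X n) : ℝ := ∫ x, gs x ∂E.emit (E.stateOf D) - ∫ x, T x ∂E.emit (E.stateOf D)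
  have hρ0 : ∀ D ∈ m.learned h, 0 ≤ ρ D := by
    intro D hD
    have := integral_mono_ae (hTi D hD) (hgsi (E.stateOf D)) ((hT01 D hD).mono fun x hx => hx.2)
    simpa [ρ] using this
  have hρsum : ((m.learned h).map ρ).sum ≤ (m.learned h).length * (2 * τ) := by
    refine list_sum_le_of_approx _ (fun D => policyObj D g' πs) (fun D => policyObj D g' π) ρ _ ?_
      (O.policy_max _ _ _ hπs)
    intro D hD
    obtain ⟨h1, h2, h3⟩ := hdata D hD
    obtain ⟨-, -, c, hc, hDc⟩ := hm.learned h D hD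
    have a1 := hω.policy c hc _ h1 g' (nextClass_subset hg') πs hπs
    have a2 := hω.policy c hc _ h1 g' (nextClass_subset hg') π hπP
    rw [← hDc, hR.integral_policyTerm h1 (hP _ hπs) hgm' hg01' h3] at a1
    rw [← hDc, hR.integral_policyTerm h1 (hP _ hπP) hgm' hg01' h3] at a2
    have a3 : ∫ x, E.backup g' x (πs x) ∂E.emit (E.stateOf D) =
        ∫ x, gs x ∂E.emit (E.stateOf D) :=
      integral_congr_ae ((hopt _ h2).mono fun x hx => hx.2.symm)
    rw [a3] at a1
    simp only [policyObj_eq, ρ, T]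
    linarith [(abs_le.1 a1).1, (abs_le.1 a2).2]
  have hρ1 : ∀ D ∈ m.learned h, ρ D ≤ β ^ 2 / 2 := by
    intro D hD
    have := list_single_le_sum hρ0 hD
    linarith
  refine ⟨fun D hD => ?_, fun D hD => ?_⟩
  · have := hρ1 D hD
    simp only [ρ, T] at this
    linarith
  have hvl : ∀ D ∈ m.val h, D ∈ m.learned h := fun D hD => (hm.sublist h).subset hD
  let σ (g : X → ℝ) (D : Dataset K X n) : ℝ := ∫ x, (g x - T x) ^ 2 ∂E.emit (E.stateOf D)
  have hsqi : ∀ f : X → ℝ, Measurable f → (∀ x, f x ∈ Set.Icc (0 : ℝ) 1) → ∀ D ∈ m.learned h,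
      Integrable (fun x => (f x - T x) ^ 2) (E.emit (E.stateOf D)) := by
    intro f hfm hf D hD
    refine integrable_of_unit (b := 1) (by fun_prop) ?_
    filter_upwards [hT01 D hD] with x hx
    have h1 := (hgs01 x).2
    exact ⟨sq_nonneg _, by nlinarith [hx.1, hx.2, (hf x).1, (hf x).2]⟩
  -- The regression target `T` belongs to the fitted policy and need not lie in the class. But `0 ≤
  -- gs - T ≤ 1`, so a square is at most the difference itself, and the policy regret bounds the
  -- squared error of the comparator `gs`.
  have hσs : ∀ D ∈ m.val h, σ gs D ≤ ρ D := by
    intro D hD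
    have hD' := hvl D hD
    simp only [σ, ρ]
    rw [← integral_sub (hgsi _) (hTi D hD')]
    refine integral_mono_ae (hsqi gs hgsm hgs01 D hD') ((hgsi _).sub (hTi D hD')) ?_
    filter_upwards [hT01 D hD'] with x hx
    nlinarith [hx.1, hx.2, (hgs01 x).1, (hgs01 x).2]
  have hσsum : ((m.val h).map fun D => σ g D - σ gs D).sum ≤ (m.val h).length * (2 * τ) := by
    refine list_sum_le_of_approx _ (fun D => valueLoss D π g' g) (fun D => valueLoss D π g' gs) _ _
      ?_ (O.value_min _ _ _ _ hgs)
    intro D hD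
    obtain ⟨h1, h2, h3⟩ := hdata D (hvl D hD)
    obtain ⟨-, -, c, hc, hDc⟩ := hm.learned h D (hvl D hD)
    have a1 := hω.loss c hc _ h1 g' (nextClass_subset hg') π hπP g hgG
    have a2 := hω.loss c hc _ h1 g' (nextClass_subset hg') π hπP gs hgs
    have a3 := hR.integral_lossTerm_sub h1 (hP _ hπP) hgm' hg01' h3 hgm hg01 hgsm hgs01
    rw [← hDc] at a1 a2
    simp only [valueLoss_eq, σ, T]
    linarith [(abs_le.1 a1).1, (abs_le.1 a2).2]
  have hσρ : ((m.val h).map (σ g)).sum ≤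
      ((m.val h).map ρ).sum + ((m.val h).map fun D => σ g D - σ gs D).sum := by
    rw [← List.sum_map_add]
    refine List.sum_le_sum fun D hD => ?_
    have := hσs D hD
    linarith
  -- The policy regret is controlled on learning data; this transfers to validation data because
  -- they are a sublist.
  have hρv : ((m.val h).map ρ).sum ≤ ((m.learned h).map ρ).sum := by
    refine List.Sublist.sum_le_sum ((hm.sublist h).map ρ) ?_
    intro r hr
    obtain ⟨D, hD, rfl⟩ := List.mem_map.1 hr
    exact hρ0 D hD
  have hlen : ((m.val h).length : ℝ) * (2 * τ) ≤ (m.learned h).length * (2 * τ) := by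
    have : ((m.val h).length : ℝ) ≤ (m.learned h).length := by
      exact_mod_cast (hm.sublist h).length_le
    gcongr
  have hD' := hvl D hD
  have hσD : σ g D ≤ β ^ 2 := by
    have := list_single_le_sum (r := σ g) (fun D _ => integral_nonneg fun x => sq_nonneg _) hD
    linarith
  -- The pointwise bound `|u| ≤ u ^ 2 / β + β` replaces the Cauchy–Schwarz inequality, at the price
  -- of a factor 2.
  have habs : |∫ x, g x ∂E.emit (E.stateOf D) - ∫ x, T x ∂E.emit (E.stateOf D)| ≤ 2 * β := by
    rw [← integral_sub (hgi _) (hTi D hD')]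
    refine (abs_integral_le_integral_abs).trans ?_
    calc ∫ x, |g x - T x| ∂E.emit (E.stateOf D)
        ≤ ∫ x, ((g x - T x) ^ 2 / β + β) ∂E.emit (E.stateOf D) := by
          refine integral_mono ((hgi _).sub (hTi D hD')).abs
            (((hsqi g hgm hg01 D hD').div_const β).add (integrable_const β)) fun x => ?_
          simp only
          rw [← sq_abs (g x - T x)]
          have h0 := abs_nonneg (g x - T x)
          rcases le_total |g x - T x| β with h1 | h1
          · have : 0 ≤ |g x - T x| ^ 2 / β := by positivity
            linarith
          · have : |g x - T x| ≤ |g x - T x| ^ 2 / β := by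
              rw [le_div_iff₀ hβ]
              nlinarith
            linarith
      _ = σ g D / β + β := by
          rw [integral_add ((hsqi g hgm hg01 D hD').div_const β) (integrable_const β),
            integral_div]
          simp [σ]
      _ ≤ 2 * β := by
          have : σ g D / β ≤ β := by
            rw [div_le_iff₀ hβ]
            nlinarith
          linarith
  have h1 := hρ1 D hD'
  have h2 := hρ0 D hD'
  simp only [ρ] at h1 h2
  rw [abs_le] at habs ⊢
  constructor <;> linarith [habs.1, habs.2]

end Fit

end DetCDP
end TwoSampleRL

end

/-! ### Propagation of errors over the levels. -/

noncomputable section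
namespace TwoSampleRL

namespace DetCDP

variable {H K : ℕ} {S X : Type*} [MeasurableSpace X]

/-- The states from which learning data have been collected. -/
def learnedStates (E : DetCDP H K S X) {n : ℕ} [NeZero n] (m : Memory K X n) : Set S :=
  {s | ∃ D ∈ m.learned (E.level s), E.stateOf D = s}

/-- Bellman optimal values inside the class. -/
structure IsOptimal (E : DetCDP H K S X) (G : Finset (X → ℝ)) (gs : ℕ → X → ℝ) : Prop where
  last : ∀ h, H ≤ h → gs h = fun _ => 0
  mem : ∀ h < H, gs h ∈ G
  opt : ∀ h < H, ∀ s, E.level s = h → ∀ᵐ x ∂E.emit s,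
    (∀ a, E.backup (gs (h + 1)) x a ≤ gs h x) ∧ ∃ a, gs h x = E.backup (gs (h + 1)) x a

/-- Backward induction: completeness is applied to the function already chosen one level later. That
the Bellman optimum lies in the class lets it be compared between states which the two-sample test
cannot distinguish. -/
theorem PolicyValueComplete.exists_isOptimal {E : DetCDP H K S X} {G : Finset (X → ℝ)}
    {P : Finset (X → Fin K)} (hC : E.PolicyValueComplete G P) : ∃ gs, E.IsOptimal G gs := by
  have key : ∀ d ≤ H, ∃ gs : ℕ → X → ℝ, (∀ h, H ≤ h → gs h = fun _ => 0) ∧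
      ∀ h < H, H - d ≤ h → gs h ∈ G ∧ ∀ s, E.level s = h → ∀ᵐ x ∂E.emit s,
        (∀ a, E.backup (gs (h + 1)) x a ≤ gs h x) ∧
          ∃ a, gs h x = E.backup (gs (h + 1)) x a := by
    intro d
    induction d with
    | zero => exact fun _ => ⟨fun _ _ => 0, fun _ _ => rfl, fun h h1 h2 => by omega⟩
    | succ d ih =>
      intro hd
      obtain ⟨gs, hlast, hgs⟩ := ih (by omega)
      have hmem : gs (H - (d + 1) + 1) ∈
          (if H - (d + 1) + 1 < H then (G : Set (X → ℝ)) else {fun _ => 0}) := by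
        split_ifs with h
        · exact (hgs _ h (by omega)).1
        · exact hlast _ (by omega)
      obtain ⟨π, -, g, hg, hopt⟩ := hC (H - (d + 1)) (by omega) _ hmem
      refine ⟨Function.update gs (H - (d + 1)) g, fun h hh => ?_, fun h h1 h2 => ?_⟩
      · rw [Function.update_of_ne (by omega)]
        exact hlast h hh
      · rw [Function.update_of_ne (a := h + 1) (by omega)]
        by_cases h3 : h = H - (d + 1)
        · subst h3
          rw [Function.update_self]
          refine ⟨hg, fun s hs => ?_⟩
          filter_upwards [hopt s hs] with x hx
          exact ⟨fun a => by rw [hx.2]; exact hx.1 a, π x, hx.2⟩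
        · rw [Function.update_of_ne h3]
          exact hgs h h1 (by omega)
  obtain ⟨gs, h1, h2⟩ := key H le_rfl
  exact ⟨gs, h1, fun h hh => (h2 h hh (by omega)).1, fun h hh => (h2 h hh (by omega)).2⟩

section Fitted

variable {G : Finset (X → ℝ)} {P : Finset (X → Fin K)} {n : ℕ} (O : Oracles K n G P)
  (m : Memory K X n)

theorem fittedValue_level {h : ℕ} (hh : h < H) : fittedValue H O m (H - h) =
    O.value (m.val h) (O.policy (m.learned h) (fittedValue H O m (H - (h + 1))))
      (fittedValue H O m (H - (h + 1))) := by
  obtain ⟨d, hd⟩ : ∃ d, H - h = d + 1 := ⟨H - (h + 1), by omega⟩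
  have h1 : H - (h + 1) = d := by omega
  have h2 : H - (d + 1) = h := by omega
  rw [hd, h1, fittedValue]
  simp only [h2]

theorem fittedValue_mem {h : ℕ} (hh : h < H) : fittedValue H O m (H - h) ∈ G := by
  rw [fittedValue_level O m hh]
  exact O.value_mem _ _ _

theorem fittedValue_nextClass (h : ℕ) :
    fittedValue H O m (H - (h + 1)) ∈ nextClass H G h := by
  unfold nextClass
  split_ifs with hh
  · exact fittedValue_mem O m hh
  · rw [show H - (h + 1) = 0 by omega]
    rfl

theorem fittedPolicy_mem (h : ℕ) : fittedPolicy H O m h ∈ P := O.policy_mem _ _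

end Fitted

section Regret

variable {E : DetCDP H K S X} [Fintype S] [NeZero K] {ω : ℕ → Episode K S X} {G : Finset (X → ℝ)}
  {P : Finset (X → Fin K)} {n : ℕ} [NeZero n] {B : ℕ} {τ : ℝ}

/-- The optimal functions dominate one step of every policy, so telescoping makes them dominate its
value. The reverse inequality is not needed. -/
theorem optimalValue_le (hR : E.RegularRewards)
    (hG : ∀ g ∈ G, Measurable g ∧ ∀ x, g x ∈ Set.Icc (0 : ℝ) 1) {gs : ℕ → X → ℝ}
    (hgs : E.IsOptimal G gs) : E.optimalValue ≤ ∫ x, gs 0 x ∂E.emit E.init := by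
  refine csSup_le ⟨_, fun _ _ => 0, fun _ => measurable_const, rfl⟩ ?_
  rintro _ ⟨π, hπ, rfl⟩
  have h01 : ∀ h, Measurable (gs h) ∧ ∀ x, gs h x ∈ Set.Icc (0 : ℝ) 1 := by
    intro h
    by_cases hh : h < H
    · exact hG _ (hgs.mem h hh)
    · rw [hgs.last h (by omega)]
      exact ⟨measurable_const, fun _ => ⟨le_rfl, zero_le_one⟩⟩
  refine hR.value_le hπ (hgs.last H le_rfl) fun s hs => ?_
  refine integral_mono_ae ?_ ?_ ?_
  · exact integrable_of_unit (b := 2) (E.measurable_backup _ (hπ _))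
      ((hR.ae_backup hs (h01 _).2).mono fun x hx => hx _)
  · exact integrable_of_unit (h01 _).1 (Filter.Eventually.of_forall (h01 _).2)
  · exact (hgs.opt _ (E.level_lt s) s rfl).mono fun x hx => hx.1 _

/-- Consequences of accurate data for the fitted policy and value function. -/
theorem Concentrated.regret (hω : E.Concentrated ω G P n B τ) (hR : E.RegularRewards)
    (hG : ∀ g ∈ G, Measurable g ∧ ∀ x, g x ∈ Set.Icc (0 : ℝ) 1) (hP : ∀ π ∈ P, Measurable π)
    (hC : E.PolicyValueComplete G P) (O : Oracles K n G P) {m : Memory K X n} {c : ℕ}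
    (hm : E.Consistent ω G B τ m c) (hex : ∀ h, ∀ D ∈ m.learned h, E.Explored G τ m D)
    {β κ : ℝ} (hβ : 0 < β) (hL : ∀ h, (m.learned h).length * τ ≤ β ^ 2 / 4)
    (hκ : 8 * τ + 2 * β + β ^ 2 ≤ κ) (hτ : 0 ≤ τ) (hinit : E.init ∈ E.learnedStates m) :
    E.optimalValue ≤ ∫ x, fittedValue H O m H x ∂E.emit E.init + H * κ ∧
    ∫ x, fittedValue H O m H x ∂E.emit E.init - H * κ -
      E.episodeLaw.real {e | ∃ h < H, E.stateAt e (fittedPolicy H O m) h ∉ E.learnedStates m} ≤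
      E.value (fittedPolicy H O m) := by
  have hκ0 : 0 ≤ κ := by nlinarith
  let g (h : ℕ) : X → ℝ := fittedValue H O m (H - h)
  have hgH : g H = fun _ => 0 := by simp only [g, Nat.sub_self]; rfl
  have hg0 : g 0 = fittedValue H O m H := rfl
  have hg01 : ∀ h x, g h x ∈ Set.Icc (0 : ℝ) 1 := by
    intro h x
    by_cases hh : h < H
    · exact (hG _ (fittedValue_mem O m hh)).2 x
    · simp only [g, show H - h = 0 by omega]
      exact ⟨le_rfl, zero_le_one⟩
  -- the Bellman optimal value for the fitted target, and the errors of the fit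
  have hfit : ∀ h < H, ∃ gb ∈ G,
      (∀ s, E.level s = h → ∀ᵐ x ∂E.emit s, (∀ a, E.backup (g (h + 1)) x a ≤ gb x) ∧
        ∃ a, gb x = E.backup (g (h + 1)) x a) ∧
      (∀ D ∈ m.learned h, ∫ x, gb x ∂E.emit (E.stateOf D) - β ^ 2 / 2 ≤
        ∫ x, E.backup (g (h + 1)) x (fittedPolicy H O m h x) ∂E.emit (E.stateOf D)) ∧
      ∀ D ∈ m.val h, |∫ x, g h x ∂E.emit (E.stateOf D) -
        ∫ x, gb x ∂E.emit (E.stateOf D)| ≤ 2 * β + β ^ 2 / 2 := by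
    intro h hh
    obtain ⟨πs, hπs, gb, hgb, hopt⟩ := hC h hh _ (fittedValue_nextClass O m h)
    have hf := hω.fit hR hG hP O hm (fittedValue_nextClass O m h) hβ (hL h) hπs hgb hopt
    rw [← fittedValue_level O m hh] at hf
    refine ⟨gb, hgb, fun s hs => ?_, hf⟩
    filter_upwards [hopt s hs] with x hx
    exact ⟨fun a => by rw [hx.2]; exact hx.1 a, πs x, hx.2⟩
  constructor
  · obtain ⟨gs, hgs⟩ := hC.exists_isOptimal
    -- Induction on the number of remaining levels. A known state is exchanged for the state of a
    -- validation data set `D`, at a cost of `4 * τ` for each of `g` and `gs`. There the fit costs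
    -- `2 * β + β ^ 2 / 2`, and replacing the target costs at most the error at the successors,
    -- which are known because `D` is explored.
    have hacc : ∀ d, ∀ s, E.level s + d = H → E.Known G τ m s →
        |∫ x, g (E.level s) x ∂E.emit s - ∫ x, gs (E.level s) x ∂E.emit s| ≤ d * κ := by
      intro d
      induction d with
      | zero => intro s hs; exact absurd hs (E.level_lt s).ne
      | succ d ih =>
        intro s hs hk
        have hlt := E.level_lt s
        obtain ⟨D, hD, hDg⟩ := hk
        have hDl := (hm.sublist _).subset hD
        obtain ⟨hr', hlev, -⟩ := hm.learned _ D hDl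
        have hchild := (hex _ D hDl).2
        obtain ⟨gb, hgb, hopt, -, hval⟩ := hfit _ hlt
        have hcl : ∀ a, |∫ x, g (E.level s + 1) x ∂E.emit (E.step (E.stateOf D) a) -
            ∫ x, gs (E.level s + 1) x ∂E.emit (E.step (E.stateOf D) a)| ≤ d * κ := by
          intro a
          rcases Nat.eq_zero_or_pos d with rfl | hd
          · have : E.level s + 1 = H := by omega
            rw [this, hgH, hgs.last H le_rfl]
            simp
          · have hlt' : E.level (E.stateOf D) + 1 < H := by omega
            have hl := E.level_step (E.stateOf D) a hlt'
            have := ih _ (by omega) (hchild a hlt')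
            rwa [hl, hlev] at this
        have h1 : |∫ x, gb x ∂E.emit (E.stateOf D) -
            ∫ x, gs (E.level s) x ∂E.emit (E.stateOf D)| ≤ d * κ := by
          have hgm := hG gb hgb
          have hgsm := hG _ (hgs.mem _ hlt)
          have hi1 : Integrable gb (E.emit (E.stateOf D)) :=
            integrable_of_unit hgm.1 (Filter.Eventually.of_forall hgm.2)
          have hi2 : Integrable (gs (E.level s)) (E.emit (E.stateOf D)) :=
            integrable_of_unit hgsm.1 (Filter.Eventually.of_forall hgsm.2)
          rw [← integral_sub hi1 hi2]
          refine abs_integral_le_integral_abs.trans ?_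
          calc ∫ x, |gb x - gs (E.level s) x| ∂E.emit (E.stateOf D)
              ≤ ∫ _, (d * κ : ℝ) ∂E.emit (E.stateOf D) := by
                -- Two maxima over actions differ by at most the largest difference of their
                -- entries.
                refine integral_mono_ae (hi1.sub hi2).abs (integrable_const _) ?_
                filter_upwards [hopt _ hlev, hgs.opt _ hlt _ hlev,
                  E.backup_ae_eq (g (E.level s + 1)) (E.stateOf D),
                  E.backup_ae_eq (gs (E.level s + 1)) (E.stateOf D)] with x hx hy hb hb'
                obtain ⟨hx1, a, ha⟩ := hx
                obtain ⟨hy1, a', ha'⟩ := hy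
                have e1 := abs_le.1 (hcl a)
                have e2 := abs_le.1 (hcl a')
                have e3 := hx1 a'
                have e4 := hy1 a
                rw [hb] at ha e3
                rw [hb'] at ha' e4
                exact abs_le.2 ⟨by linarith [e2.1], by linarith [e1.2]⟩
            _ = d * κ := by simp
        have h3 := hDg _ (hgs.mem _ hlt)
        have h4 := hDg _ (fittedValue_mem O m hlt)
        have h5 : |∫ x, g (E.level s) x ∂E.emit (E.stateOf D) - ∫ x, g (E.level s) x ∂E.emit s|
          ≤ 4 * τ := h4
        have hf' := hval D hD
        push_cast
        have hsq := sq_nonneg β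
        rw [abs_le] at h1 h3 h5 hf' ⊢
        constructor <;> linarith [h1.1, h1.2, h3.1, h3.2, h5.1, h5.2, hf'.1, hf'.2]
    obtain ⟨D, hD, hDs⟩ := hinit
    have hk := (hex _ D hD).1
    rw [hDs] at hk
    have h1 := hacc H E.init (by rw [E.level_init]; simp) hk
    rw [E.level_init, hg0] at h1
    have h2 := optimalValue_le hR hG hgs
    linarith [(abs_le.1 h1).1]
  · have h1 := hR.le_value (π := fittedPolicy H O m)
      (fun h => hP _ (fittedPolicy_mem O m h)) hg01 hgH hinit hκ0 ?_
    · exact h1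
    -- The policy bound holds at `s` itself, since `D` was collected there. The value bound holds
    -- only at the state of a validation data set `D'` resembling `s`, so `g` and `gb` are both
    -- transferred, at `4 * τ` each.
    · rintro s ⟨D, hD, hDs⟩ hs
      obtain ⟨gb, hgb, -, hpol, hval⟩ := hfit _ (E.level_lt s)
      have h2 := hpol D hD
      have hk := (hex _ D hD).1
      rw [hDs] at h2 hk
      obtain ⟨D', hD', hDg⟩ := hk
      have h3 := hval D' hD'
      have h4 := hDg _ hgb
      have h5 := hDg _ (fittedValue_mem O m (E.level_lt s))
      have h6 : |∫ x, g (E.level s) x ∂E.emit (E.stateOf D') -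
        ∫ x, g (E.level s) x ∂E.emit s| ≤ 4 * τ := h5
      have hsq := sq_nonneg β
      linarith [(abs_le.1 h3).2, (abs_le.1 h4).1, (abs_le.1 h4).2, (abs_le.1 h6).1]

omit [NeZero K] in
/-- The estimate of the optimal value is accurate. -/
theorem Concentrated.fittedOptimum (hω : E.Concentrated ω G P n B τ) (hH : 1 ≤ H)
    (O : Oracles K n G P) {m : Memory K X n} {c : ℕ} (hm : E.Consistent ω G B τ m c)
    (hne : m.val 0 ≠ []) :
    |fittedOptimum H O m - ∫ x, fittedValue H O m H x ∂E.emit E.init| ≤ τ := by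
  obtain ⟨D, l, hDl⟩ := List.exists_cons_of_ne_nil hne
  have hD := (hm.sublist 0).subset (show D ∈ m.val 0 by simp [hDl])
  obtain ⟨hr, hlev, c, hc, hDc⟩ := hm.learned 0 D hD
  have h1 := hω.represents.2 c hc _ hr _ (fittedValue_mem (H := H) O m (h := 0) (by omega))
  rw [← hDc, Reachable.eq_init E hr hlev] at h1
  simp only [TwoSampleRL.fittedOptimum, hDl]
  exact h1

end Regret

end DetCDP
end TwoSampleRL

end

/-! ### The main loop on the good event. -/

noncomputable section
namespace TwoSampleRL

section Loop

variable {K : ℕ} {X : Type*} [MeasurableSpace X] {G : Finset (X → ℝ)} {P : Finset (X → Fin K)}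
  (acc : Access K X) (H : ℕ) (θ : Params) (O : Oracles K θ.nTrain G P)

/-- The average return of the evaluation trajectories of one iteration. -/
def avgReturn (m : Memory K X θ.nTrain) : ℝ :=
  (∑ i ∈ Finset.range θ.nEval, ∑ h ∈ Finset.range H,
    (acc.rollout (m.used + i) (fittedPolicy H O m) h).2.2) / θ.nEval

/-- The memory after an iteration that does not return. -/
def exploreStep (m : Memory K X θ.nTrain) : Memory K X θ.nTrain :=
  (List.range' 1 (H - 1)).foldl (fun m' h =>
    (List.range (min θ.nExp θ.nEval)).foldl (fun m'' i =>
      dfsLearn acc G θ (H - h) ((List.range h).map fun j =>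
        (acc.rollout (m.used + i) (fittedPolicy H O m) j).2.1) false m'') m')
    { m with used := m.used + θ.nEval }

open Classical in
theorem mainLoop_succ (ε : ℝ) (k : ℕ) (m : Memory K X θ.nTrain) :
    mainLoop acc H ε θ O (k + 1) m =
      if fittedOptimum H O m ≤ avgReturn acc H θ O m + ε / 2 then
        (some (fittedPolicy H O m), m.used + θ.nEval)
      else mainLoop acc H ε θ O k (exploreStep acc H θ O m) := rfl

/-- The memory after the first call of the search routine. -/
def initialMemory (G : Finset (X → ℝ)) : Memory K X θ.nTrain :=
  dfsLearn acc G θ H [] false { learned := fun _ => [], val := fun _ => [], used := 0 }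

/-- The memory after `k` iterations that do not return. -/
def memoryAt (k : ℕ) : Memory K X θ.nTrain :=
  (exploreStep acc H θ O)^[k] (initialMemory acc H θ G)

theorem memoryAt_succ (k : ℕ) :
    memoryAt acc H θ O (k + 1) = exploreStep acc H θ O (memoryAt acc H θ O k) :=
  Function.iterate_succ_apply' _ _ _

end Loop

namespace DetCDP

variable {H K : ℕ} {S X : Type*} [MeasurableSpace X]

theorem card_le_width_mul [Fintype S] (E : DetCDP H K S X) : Fintype.card S ≤ E.width * H := by
  classical
  calc Fintype.card S = ∑ h ∈ Finset.range H, (Finset.univ.filter fun s => E.level s = h).card :=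
        Finset.card_eq_sum_card_fiberwise fun s _ => by simpa using E.level_lt s
    _ ≤ ∑ h ∈ Finset.range H, E.width := Finset.sum_le_sum fun h hh =>
        Finset.le_sup (f := fun h => (Finset.univ.filter fun s => E.level s = h).card) hh
    _ = _ := by simp [mul_comm]

theorem learnedStates_mono {E : DetCDP H K S X} {n : ℕ} [NeZero n] {m m' : Memory K X n}
    (h : m.Le m') : E.learnedStates m ⊆ E.learnedStates m' := by
  rintro s ⟨D, hD, hs⟩
  exact ⟨D, (h.learned _).subset hD, hs⟩

section Loop

variable {E : DetCDP H K S X} {ω : ℕ → Episode K S X} {G : Finset (X → ℝ)}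
  {P : Finset (X → Fin K)} {B : ℕ} {θ : Params} [NeZero θ.nTrain]

/-- The effect of one iteration that does not return. -/
theorem advances_exploreStep (hω : E.Represents ω G θ.nTrain B θ.τ) (hτ : 0 ≤ θ.τ)
    (hN : θ.nEval = θ.nTrain) (hn : θ.nExp ≤ θ.nTrain) (O : Oracles K θ.nTrain G P)
    {m : Memory K X θ.nTrain} {c : ℕ} (hm : E.Consistent ω G B θ.τ m c)
    (hc : c + (1 + H * θ.nExp * (K + 1) ^ H) ≤ B) {m' : Memory K X θ.nTrain}
    (hm' : m' = exploreStep (E.access ω) H θ O m) :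
    ∃ c', E.Consistent ω G B θ.τ m' c' ∧ c' ≤ c + (1 + H * θ.nExp * (K + 1) ^ H) ∧
      c' + K * m.valCount H ≤ c + (1 + H * θ.nExp * (1 + K)) + K * m'.valCount H ∧ m.Le m' ∧
      (∀ h, ∀ D ∈ m'.learned h, D ∈ m.learned h ∨ E.Explored G θ.τ m' D) ∧
      (∀ h, (m'.learned h).length + (m.val h).length ≤
        (m.learned h).length + (m'.val h).length + H * θ.nExp) ∧
      ∀ h < H, 0 < h → ∀ i < θ.nExp,
        E.stateAt (ω (m.used + i)) (fittedPolicy H O m) h ∈ E.learnedStates m' := by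
  set π := fittedPolicy H O m with hπ
  have hinner : ∀ h ∈ List.range' 1 (H - 1), E.Advances ω G B θ.τ (θ.nExp * (K + 1) ^ H)
      (θ.nExp * 1) (θ.nExp * (1 + K))
      (fun m' => (List.range (min θ.nExp θ.nEval)).foldl (fun m'' i =>
        dfsLearn (E.access ω) G θ (H - h) ((List.range h).map fun j =>
        ((E.access ω).rollout (m.used + i) π j).2.1) false m'') m')
      (fun m' => ∀ i < θ.nExp, E.stateAt (ω (m.used + i)) π h ∈ E.learnedStates m') := by
    intro h hh
    rw [List.mem_range'_1] at hh
    have hmin : min θ.nExp θ.nEval = θ.nExp := by omega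
    rw [hmin]
    have h1 := Advances.foldl (E := E) (ω := ω) (G := G) (B := B) (τ := θ.τ)
      (b := (K + 1) ^ H) (k := 1) (u := 1 + K)
      (f := fun i m'' => dfsLearn (E.access ω) G θ (H - h) ((List.range h).map fun j =>
        ((E.access ω).rollout (m.used + i) π j).2.1) false m'')
      (Q := fun i m' => E.stateAt (ω (m.used + i)) π h ∈ E.learnedStates m')
      (fun i m₁ m₂ hle hs => learnedStates_mono hle hs) (List.range θ.nExp) ?_
    · refine h1.weaken (by simp) (by simp) (by simp) ?_
      intro m' hm' i hi
      exact hm' i (List.mem_range.2 hi)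
    · intro i _
      have h2 := advances_dfsLearn hω hτ (H - h) ((List.range h).map fun j =>
        ((E.access ω).rollout (m.used + i) π j).2.1) false (by simp; omega)
      refine h2.weaken (Nat.pow_le_pow_right (by omega) (by omega)) (by simp) (by simp) ?_
      intro m' hm'
      have h3 := hm'.2 (by omega) rfl
      have h4 : E.stateAt (ω (m.used + i)) π h = _ := E.stateAt_eq_foldl _ _ _
      simp only [List.length_map, List.length_range] at h3
      change E.stateAt (ω (m.used + i)) π h ∈ E.learnedStates m'
      obtain ⟨D, hD, hs⟩ := h3
      refine ⟨D, ?_, ?_⟩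
      · rw [E.level_stateAt _ _ (by omega)]
        exact hD
      · rw [hs, h4]
        rfl
  have houter := Advances.foldl (E := E) (ω := ω) (G := G) (B := B) (τ := θ.τ)
    (Q := fun h m' => ∀ i < θ.nExp, E.stateAt (ω (m.used + i)) π h ∈ E.learnedStates m')
    (fun h m₁ m₂ hle hs i hi => learnedStates_mono hle (hs i hi)) (List.range' 1 (H - 1)) hinner
  have hlen : (List.range' 1 (H - 1)).length ≤ H := by simp
  have houter' := houter.weaken (b' := H * θ.nExp * (K + 1) ^ H) (k' := H * θ.nExp)
    (u' := H * θ.nExp * (1 + K)) (by rw [mul_assoc]; exact Nat.mul_le_mul_right _ hlen)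
    (by rw [mul_one]; exact Nat.mul_le_mul_right _ hlen)
    (by rw [mul_assoc]; exact Nat.mul_le_mul_right _ hlen) (fun _ h => h)
  -- Since `nEval = nTrain`, an evaluation uses exactly one block, and every data set keeps starting
  -- at a multiple of `nTrain`.
  obtain ⟨c', h1, h2, h3, h4, h5, h6, h7⟩ := houter' { m with used := m.used + θ.nEval } (c + 1)
    ⟨by simp only [hm.used, hN]; ring, hm.learned, hm.sublist, hm.pairwise⟩ (by omega)
  have hm'' : m' = (List.range' 1 (H - 1)).foldl (fun m' h =>
    (List.range (min θ.nExp θ.nEval)).foldl (fun m'' i =>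
      dfsLearn (E.access ω) G θ (H - h) ((List.range h).map fun j =>
        ((E.access ω).rollout (m.used + i) π j).2.1) false m'') m')
    { m with used := m.used + θ.nEval } := hm'
  beta_reduce at h1 h3 h4 h5 h6 h7
  rw [← hm''] at h1 h3 h4 h5 h6 h7
  have hv : Memory.valCount H { m with used := m.used + θ.nEval } = m.valCount H := rfl
  rw [hv] at h3
  exact ⟨c', h1, by omega, by omega, ⟨h4.val, h4.learned⟩, h5, h6,
    fun h hh h0 i hi => h7 h (by rw [List.mem_range'_1]; omega) i hi⟩

/-- What is known about the memory after `k` iterations. -/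
structure Reached (E : DetCDP H K S X) (ω : ℕ → Episode K S X) (G : Finset (X → ℝ)) (B : ℕ)
    (θ : Params) [NeZero θ.nTrain] (k c : ℕ) (m : Memory K X θ.nTrain) : Prop where
  consistent : E.Consistent ω G B θ.τ m c
  le_worst : c ≤ (K + 1) ^ H + k * (1 + H * θ.nExp * (K + 1) ^ H)
  le_amortized : c ≤ 1 + K + k * (1 + H * θ.nExp * (1 + K)) + K * m.valCount H
  explored : ∀ h, ∀ D ∈ m.learned h, E.Explored G θ.τ m D
  length_le : ∀ h, (m.learned h).length ≤ (m.val h).length + (1 + k * (H * θ.nExp))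
  init_mem : E.init ∈ E.learnedStates m

theorem reached_initialMemory (hω : E.Represents ω G θ.nTrain B θ.τ) (hτ : 0 ≤ θ.τ)
    (hH : 1 ≤ H) (hB : (K + 1) ^ H ≤ B) :
    ∃ c, E.Reached ω G B θ 0 c (initialMemory (E.access ω) H θ G) := by
  obtain ⟨c, h1, h2, h3, h4, h5, h6, h7, h8⟩ := advances_dfsLearn hω hτ H [] false (by simp)
    { learned := fun _ => [], val := fun _ => [], used := 0 } 0
    ⟨by simp, by simp, by simp, by simp⟩ (by omega)
  refine ⟨c, h1, by omega, ?_, ?_, ?_, ?_⟩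
  · simp only [initialMemory]
    simp [Memory.valCount] at h3 ⊢
    exact h3
  · intro h D hD
    rcases h5 h D hD with h | h
    · simp at h
    · exact h
  · intro h
    have := h6 h
    simp at this
    simpa [initialMemory] using this
  · obtain ⟨D, hD, hs⟩ := h8 (by omega) rfl
    exact ⟨D, by rw [E.level_init]; exact hD, hs⟩

theorem Reached.step (hω : E.Represents ω G θ.nTrain B θ.τ) (hτ : 0 ≤ θ.τ)
    (hN : θ.nEval = θ.nTrain) (hn : θ.nExp ≤ θ.nTrain) (O : Oracles K θ.nTrain G P)
    {m : Memory K X θ.nTrain} {k c : ℕ} (hm : E.Reached ω G B θ k c m)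
    (hB : (K + 1) ^ H + (k + 1) * (1 + H * θ.nExp * (K + 1) ^ H) ≤ B) :
    (∃ c', E.Reached ω G B θ (k + 1) c' (exploreStep (E.access ω) H θ O m)) ∧
      m.Le (exploreStep (E.access ω) H θ O m) ∧
      ∀ h < H, ∀ i < θ.nExp, E.stateAt (ω (m.used + i)) (fittedPolicy H O m) h ∈
        E.learnedStates (exploreStep (E.access ω) H θ O m) := by
  have hw := hm.le_worst
  have ha := hm.le_amortized
  obtain ⟨c', h1, h2, h3, h4, h5, h6, h7⟩ := advances_exploreStep hω hτ hN hn O hm.consistent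
    (by rw [add_mul, one_mul] at hB; omega) rfl
  refine ⟨⟨c', h1, ?_, ?_, ?_, ?_, learnedStates_mono h4 hm.init_mem⟩, h4, ?_⟩
  · rw [add_mul, one_mul]; omega
  · rw [add_mul, one_mul]; omega
  · intro h D hD
    rcases h5 h D hD with h8 | h8
    · exact (hm.explored h D h8).mono h4
    · exact h8
  · intro h
    have := h6 h
    have := hm.length_le h
    rw [add_mul, one_mul]; omega
  · intro h hh i hi
    -- The loop searches from level 1 on; at level 0 a path is in the initial state, which the very
    -- first call has learned.
    rcases Nat.eq_zero_or_pos h with rfl | h0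
    · exact learnedStates_mono h4 hm.init_mem
    · exact h7 h hh h0 i hi

theorem reached_memoryAt (hω : E.Represents ω G θ.nTrain B θ.τ) (hτ : 0 ≤ θ.τ) (hH : 1 ≤ H)
    (hN : θ.nEval = θ.nTrain) (hn : θ.nExp ≤ θ.nTrain) (O : Oracles K θ.nTrain G P) (k : ℕ)
    (hB : (K + 1) ^ H + k * (1 + H * θ.nExp * (K + 1) ^ H) ≤ B) :
    ∃ c, E.Reached ω G B θ k c (memoryAt (E.access ω) H θ O k) := by
  induction k with
  | zero => exact reached_initialMemory hω hτ hH (by omega)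
  | succ k ih =>
    obtain ⟨c, hc⟩ := ih (by rw [add_mul] at hB; omega)
    rw [memoryAt_succ]
    exact (hc.step hω hτ hN hn O hB).1

/-- The evaluation trajectories of an iteration are representative: the average return is accurate,
and if the policy leaves the learned states with considerable probability, one of the first
trajectories does. -/
def Representative [Fintype S] (E : DetCDP H K S X) (ω : ℕ → Episode K S X) (ε : ℝ) (θ : Params)
    [NeZero θ.nTrain] (O : Oracles K θ.nTrain G P) (m : Memory K X θ.nTrain) : Prop :=
  |avgReturn (E.access ω) H θ O m - E.value (fittedPolicy H O m)| ≤ θ.τ ∧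
    (ε / 4 ≤ E.episodeLaw.real
        {e | ∃ h < H, E.stateAt e (fittedPolicy H O m) h ∉ E.learnedStates m} →
      ∃ i < θ.nExp, ∃ h < H,
        E.stateAt (ω (m.used + i)) (fittedPolicy H O m) h ∉ E.learnedStates m)

variable [Fintype S] [NeZero K]

/-- If all data are accurate and all evaluations representative, the algorithm succeeds. -/
theorem runAlgorithm_correct (hR : E.RegularRewards)
    (hG : ∀ g ∈ G, Measurable g ∧ ∀ x, g x ∈ Set.Icc (0 : ℝ) 1) (hP : ∀ π ∈ P, Measurable π)
    (hC : E.PolicyValueComplete G P) (hω : E.Concentrated ω G P θ.nTrain B θ.τ) (hτ : 0 ≤ θ.τ)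
    (hH : 1 ≤ H) (hN : θ.nEval = θ.nTrain) (hn : θ.nExp ≤ θ.nTrain) (O : Oracles K θ.nTrain G P)
    {M : ℕ} (hM : E.width = M)
    (hB : (K + 1) ^ H + M * H * (1 + H * θ.nExp * (K + 1) ^ H) ≤ B) {ε β κ : ℝ} (hε : 0 < ε)
    (hβ : 0 < β) (hL : ((M + (1 + M * H * (H * θ.nExp)) : ℕ) : ℝ) * θ.τ ≤ β ^ 2 / 4)
    (hκ : 8 * θ.τ + 2 * β + β ^ 2 ≤ κ) (hκε : 2 * θ.τ + H * κ ≤ ε / 4)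
    (hrep : ∀ k < M * H, E.Representative ω ε θ O (memoryAt (E.access ω) H θ O k)) :
    ∃ π, (runAlgorithm (E.access ω) M H ε θ O).1 = some π ∧ E.optimalValue - E.value π ≤ ε ∧
      (runAlgorithm (E.access ω) M H ε θ O).2 ≤
        θ.nTrain * (1 + K + M * H * (1 + H * θ.nExp * (1 + K)) + K * (M * H) + 1) := by
  have hrepr := hω.represents
  have hBk : ∀ k ≤ M * H, (K + 1) ^ H + k * (1 + H * θ.nExp * (K + 1) ^ H) ≤ B := fun k hk =>
    le_trans (by gcongr) hB
  have hregret : ∀ k ≤ M * H,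
      let m := memoryAt (E.access ω) H θ O k
      E.optimalValue ≤ fittedOptimum H O m + θ.τ + H * κ ∧
      fittedOptimum H O m - θ.τ - H * κ - E.episodeLaw.real
        {e | ∃ h < H, E.stateAt e (fittedPolicy H O m) h ∉ E.learnedStates m} ≤
        E.value (fittedPolicy H O m) := by
    intro k hk m
    obtain ⟨c, hm⟩ := reached_memoryAt hrepr hτ hH hN hn O k (hBk k hk)
    have h1 := hω.regret hR hG hP hC O hm.consistent hm.explored hβ (fun h => ?_) hκ hτ hm.init_mem
    · have hne : m.val 0 ≠ [] := by
        obtain ⟨D, hD, hDs⟩ := hm.init_mem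
        obtain ⟨⟨D', hD', -⟩, -⟩ := hm.explored _ D hD
        rw [hDs, E.level_init] at hD'
        exact List.ne_nil_of_mem hD'
      have h2 := abs_le.1 (hω.fittedOptimum hH O hm.consistent hne)
      exact ⟨by linarith [h1.1, h2.1], by linarith [h1.2, h2.2]⟩
    · refine le_trans ?_ hL
      gcongr
      have h2 := hm.length_le h
      have h3 := hm.consistent.length_val_le hrepr hτ h
      rw [hM] at h3
      have h4 : k * (H * θ.nExp) ≤ M * H * (H * θ.nExp) := by gcongr
      omega
  -- Potential argument: every rejected iteration adds a learned state to the one present at the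
  -- start, and there are at most `M * H` states. So `M * H` rejections are impossible.
  have key : ∀ j k, j + k = M * H →
      k + 1 ≤ (E.learnedStates (memoryAt (E.access ω) H θ O k)).ncard →
      ∃ π, (mainLoop (E.access ω) H ε θ O j (memoryAt (E.access ω) H θ O k)).1 = some π ∧
        E.optimalValue - E.value π ≤ ε ∧
        (mainLoop (E.access ω) H ε θ O j (memoryAt (E.access ω) H θ O k)).2 ≤
          θ.nTrain * (1 + K + M * H * (1 + H * θ.nExp * (1 + K)) + K * (M * H) + 1) := by
    intro j
    induction j with
    | zero =>
      intro k hk hcard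
      exfalso
      have h1 : (E.learnedStates (memoryAt (E.access ω) H θ O k)).ncard ≤ Fintype.card S := by
        rw [← Nat.card_eq_fintype_card, ← Set.ncard_univ]
        exact Set.ncard_le_ncard (Set.subset_univ _)
      have h2 := E.card_le_width_mul
      rw [hM] at h2
      omega
    | succ j ih =>
      intro k hk hcard
      obtain ⟨hreg1, hreg2⟩ := hregret k (by omega)
      obtain ⟨hr1, hr2⟩ := hrep k (by omega)
      obtain ⟨c, hm⟩ := reached_memoryAt hrepr hτ hH hN hn O k (hBk k (by omega))
      rw [mainLoop_succ]
      have hr1' := abs_le.1 hr1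
      split_ifs with htest
      -- Acceptance: V⋆ ≤ V̂ + τ + Hκ ≤ average + ε/2 + τ + Hκ ≤ V^π + ε/2 + 2τ + Hκ, and the last
      -- terms are at most ε/4.
      · refine ⟨_, rfl, by linarith [hr1'.2], ?_⟩
        have h1 := hm.le_amortized
        have h2 := hm.consistent.valCount_le hrepr hτ
        rw [hM] at h2
        simp only [hm.consistent.used, hN]
        rw [← Nat.mul_succ]
        refine Nat.mul_le_mul_left _ ?_
        have h3 : k * (1 + H * θ.nExp * (1 + K)) ≤ M * H * (1 + H * θ.nExp * (1 + K)) := by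
          gcongr; omega
        have h4 := Nat.mul_le_mul_left K h2
        omega
      -- Rejection: V^π - τ ≤ average < V̂ - ε/2, so the exit probability exceeds ε/2 - 2τ - Hκ,
      -- which is at least ε/4.
      · have hexit := hr2 (by linarith [hr1'.1])
        obtain ⟨i, hi, h, hh, hs⟩ := hexit
        obtain ⟨-, hle, hnew⟩ := hm.step hrepr hτ hN hn O (hBk (k + 1) (by omega))
        rw [← memoryAt_succ] at hle hnew ⊢
        refine ih (k + 1) (by omega) ?_
        have hlt := Set.ncard_lt_ncard
          (Set.ssubset_iff_of_subset (learnedStates_mono hle) |>.2 ⟨_, hnew h hh i hi, hs⟩)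
          (Set.toFinite _)
        omega
  refine key (M * H) 0 (by omega) ?_
  obtain ⟨c, hm⟩ := reached_memoryAt hrepr hτ hH hN hn O 0 (hBk 0 (by omega))
  rw [zero_add, Nat.one_le_iff_ne_zero, ← Nat.pos_iff_ne_zero, Set.ncard_pos]
  exact ⟨_, hm.init_mem⟩

end Loop

end DetCDP
end TwoSampleRL

end

/-! ### Adaptedness: the memory is determined by the episodes used so far. -/

noncomputable section
namespace TwoSampleRL

/-- The events that are determined by the first `t` coordinates. -/
abbrev past (Y : Type*) [MeasurableSpace Y] (t : ℕ) : MeasurableSpace (ℕ → Y) :=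
  MeasurableSpace.comap (fun ω (i : Fin t) => ω i) inferInstance

section Past

variable {Y : Type*} [MeasurableSpace Y]

theorem measurable_past_eval {t i : ℕ} (h : i < t) :
    Measurable[past Y t] fun ω : ℕ → Y => ω i :=
  (measurable_pi_apply (X := fun _ : Fin t => Y) ⟨i, h⟩).comp
    (comap_measurable fun (ω : ℕ → Y) (i : Fin t) => ω i)

theorem past_mono {s t : ℕ} (h : s ≤ t) : past Y s ≤ past Y t := by
  refine Measurable.comap_le ?_
  refine @measurable_pi_lambda _ _ _ (past Y t) _ _ fun i => ?_
  exact measurable_past_eval (by omega)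

theorem past_le (t : ℕ) : past Y t ≤ MeasurableSpace.pi :=
  Measurable.comap_le (by fun_prop)

theorem mem_of_measurableSet_past {t : ℕ} {A : Set (ℕ → Y)} (hA : MeasurableSet[past Y t] A)
    {ω ω' : ℕ → Y} (h : ∀ i < t, ω i = ω' i) (hω : ω ∈ A) : ω' ∈ A := by
  obtain ⟨B, -, rfl⟩ := hA
  have : (fun i : Fin t => ω i) = fun i : Fin t => ω' i := funext fun i => h i i.2
  rw [Set.mem_preimage] at hω ⊢
  rwa [← this]

end Past

section Adapted

variable {K : ℕ} {X : Type*} [MeasurableSpace X] {n : ℕ} {Y : Type*} [MeasurableSpace Y]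

/-- On the event `A` the list `L` of data sets has constant length and is determined by the first
`t` episodes. -/
def DeterminedOn (t : ℕ) (A : Set (ℕ → Y)) (L : (ℕ → Y) → List (Dataset K X n)) : Prop :=
  ∃ (m : ℕ) (d : (ℕ → Y) → Fin m → Dataset K X n), Measurable[past Y t] d ∧
    ∀ ω ∈ A, L ω = List.ofFn (d ω)

/-- On the event `A` exactly `t` episodes have been used, and these determine the memory as well
as the event. -/
structure IsPiece (t : ℕ) (A : Set (ℕ → Y)) (F : (ℕ → Y) → Memory K X n) : Prop where
  measurableSet : MeasurableSet[past Y t] A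
  used : ∀ ω ∈ A, (F ω).used = t
  learned : ∀ h, DeterminedOn t A fun ω => (F ω).learned h
  val : ∀ h, DeterminedOn t A fun ω => (F ω).val h

/-- The sets that are glued together from countably many disjoint sets with the property `Q`. -/
inductive Glued {Ω : Type*} (Q : Set Ω → Prop) : Set Ω → Prop
  | base {A : Set Ω} (h : Q A) : Glued Q A
  | iUnion {A : ℕ → Set Ω} (hd : Pairwise (Function.onFun Disjoint A)) (h : ∀ i, Glued Q (A i)) :
      Glued Q (⋃ i, A i)

/-- On the event `A` the random memory `F` is determined by the episodes used so far. -/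
def AdaptedOn (F : (ℕ → Y) → Memory K X n) : Set (ℕ → Y) → Prop :=
  Glued fun A => ∃ t, IsPiece t A F

/-- The lists in the memory have random length and the time is random, so events are cut into pieces
where these are constant. Each piece may be cut further on its own, which happens at every branch of
the algorithm. -/
theorem Glued.bind {Ω : Type*} {Q Q' : Set Ω → Prop} {A : Set Ω} (h : Glued Q A)
    (hQ : ∀ A, Q A → Glued Q' A) : Glued Q' A := by
  induction h with
  | base h => exact hQ _ h
  | iUnion hd _ ih => exact .iUnion hd ih

/-- Distinguish countably many cases. -/
theorem Glued.of_cases {Ω : Type*} {Q : Set Ω → Prop} (h0 : Q ∅) {A : Set Ω} {ι : Type*}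
    [Countable ι] (c : Ω → ι) (h : ∀ i, Glued Q (A ∩ {ω | c ω = i})) : Glued Q A := by
  obtain ⟨e, he⟩ := exists_injective_nat ι
  have hA : A = ⋃ k, A ∩ {ω | e (c ω) = k} := by
    ext ω; simp
  rw [hA]
  refine .iUnion (fun i j hij => Set.disjoint_left.2 ?_) fun k => ?_
  · rintro ω ⟨-, rfl⟩ ⟨-, h⟩
    exact hij h
  · by_cases hk : ∃ i, e i = k
    · obtain ⟨i, rfl⟩ := hk
      convert h i using 4
      exact he.eq_iff
    -- Numbers that encode no case contribute empty pieces, whence the hypothesis `h0`.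
    · have : A ∩ {ω | e (c ω) = k} = ∅ :=
        Set.eq_empty_of_forall_notMem fun ω hω => hk ⟨_, hω.2⟩
      rw [this]
      exact .base h0

theorem DeterminedOn.mono {t t' : ℕ} {A A' : Set (ℕ → Y)} {L : (ℕ → Y) → List (Dataset K X n)}
    (h : DeterminedOn t A L) (ht : t ≤ t') (hA : A' ⊆ A) : DeterminedOn t' A' L := by
  obtain ⟨m, d, hd, hL⟩ := h
  exact ⟨m, d, hd.mono (past_mono ht) le_rfl, fun ω hω => hL ω (hA hω)⟩

theorem DeterminedOn.congr {t : ℕ} {A : Set (ℕ → Y)} {L L' : (ℕ → Y) → List (Dataset K X n)}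
    (h : DeterminedOn t A L) (hL : ∀ ω ∈ A, L ω = L' ω) : DeterminedOn t A L' := by
  obtain ⟨m, d, hd, hL'⟩ := h
  exact ⟨m, d, hd, fun ω hω => by rw [← hL ω hω, hL' ω hω]⟩

theorem DeterminedOn.append {t : ℕ} {A : Set (ℕ → Y)} {L : (ℕ → Y) → List (Dataset K X n)}
    (h : DeterminedOn t A L) {D : (ℕ → Y) → Dataset K X n} (hD : Measurable[past Y t] D) :
    DeterminedOn t A fun ω => L ω ++ [D ω] := by
  obtain ⟨m, d, hd, hL⟩ := h
  refine ⟨m + 1, fun ω => Fin.snoc (d ω) (D ω), ?_, fun ω hω => ?_⟩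
  · refine @measurable_pi_lambda _ _ _ (past Y t) _ _ fun i => ?_
    refine Fin.lastCases ?_ (fun j => ?_) i
    · simpa using hD
    · simp only [Fin.snoc_castSucc]
      exact (measurable_pi_apply j).comp hd
  · simp only [hL ω hω, List.ofFn_succ', Fin.snoc_castSucc, Fin.snoc_last, List.concat_eq_append]

theorem DeterminedOn.update {t : ℕ} {A : Set (ℕ → Y)}
    {L : (ℕ → Y) → ℕ → List (Dataset K X n)} (h : ∀ i, DeterminedOn t A fun ω => L ω i)
    {D : (ℕ → Y) → Dataset K X n} (hD : Measurable[past Y t] D) (j i : ℕ) :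
    DeterminedOn t A fun ω => Function.update (L ω) j (L ω j ++ [D ω]) i := by
  by_cases hi : i = j
  · subst hi
    simpa using (h i).append hD
  · simpa [hi] using h i

theorem IsPiece.mono {t : ℕ} {A A' : Set (ℕ → Y)} {F : (ℕ → Y) → Memory K X n}
    (h : IsPiece t A F) (hA : A' ⊆ A) (hm : MeasurableSet[past Y t] A') : IsPiece t A' F :=
  ⟨hm, fun ω hω => h.used ω (hA hω), fun i => (h.learned i).mono le_rfl hA,
    fun i => (h.val i).mono le_rfl hA⟩

theorem IsPiece.congr {t : ℕ} {A : Set (ℕ → Y)} {F F' : (ℕ → Y) → Memory K X n}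
    (h : IsPiece t A F) (hF : ∀ ω ∈ A, F ω = F' ω) : IsPiece t A F' :=
  ⟨h.measurableSet, fun ω hω => by rw [← hF ω hω, h.used ω hω],
    fun i => (h.learned i).congr fun ω hω => by rw [hF ω hω],
    fun i => (h.val i).congr fun ω hω => by rw [hF ω hω]⟩

theorem isPiece_empty (F : (ℕ → Y) → Memory K X n) : IsPiece 0 ∅ F :=
  ⟨@MeasurableSet.empty _ (past Y 0), by simp, fun _ => ⟨0, fun _ => Fin.elim0,
    @measurable_const _ _ _ (past Y 0) _, by simp⟩, fun _ => ⟨0, fun _ => Fin.elim0,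
    @measurable_const _ _ _ (past Y 0) _, by simp⟩⟩

theorem AdaptedOn.congr {A : Set (ℕ → Y)} {F F' : (ℕ → Y) → Memory K X n}
    (h : AdaptedOn F A) (hF : ∀ ω ∈ A, F ω = F' ω) : AdaptedOn F' A := by
  induction h with
  | base h =>
    obtain ⟨t, h⟩ := h
    exact .base ⟨t, h.congr hF⟩
  | iUnion hd _ ih => exact .iUnion hd fun i => ih i fun ω hω => hF ω (Set.mem_iUnion.2 ⟨i, hω⟩)

theorem AdaptedOn.foldl {β : Type*} {Φ : β → (ℕ → Y) → Memory K X n → Memory K X n}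
    (hΦ : ∀ b A F, AdaptedOn F A → AdaptedOn (fun ω => Φ b ω (F ω)) A) (l : List β) :
    ∀ {A : Set (ℕ → Y)} {F : (ℕ → Y) → Memory K X n}, AdaptedOn F A →
      AdaptedOn (fun ω => l.foldl (fun m b => Φ b ω m) (F ω)) A := by
  induction l with
  | nil => intro A F h; exact h
  | cons b l ih => intro A F h; exact ih (hΦ b A F h)

end Adapted

namespace DetCDP

variable {H K : ℕ} {S X : Type*} [MeasurableSpace X] (E : DetCDP H K S X)
  {G : Finset (X → ℝ)} {P : Finset (X → Fin K)} {θ : Params}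

theorem measurable_dataAt (n t : ℕ) (s : S) :
    Measurable[past (Episode K S X) (t + n)] fun ω => E.dataAt ω n t s := by
  refine @measurable_pi_lambda _ _ _ (past _ (t + n)) _ _ fun i => ?_
  exact (E.measurable_sampleAt s).comp (measurable_past_eval (by omega))

theorem measurable_mmd {n : ℕ} (hG : ∀ g ∈ G, Measurable g) :
    Measurable fun D : Dataset K X n × Dataset K X n => mmd G D.1 D.2 := by
  unfold mmd empMean
  refine Measurable.iSup fun g => ?_
  have := hG g.1 g.2
  fun_prop

open Classical in
-- On a piece, the course of a call up to its recursive calls depends on a single test, whose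
-- outcome is an event of the first `t + nTrain` episodes. Splitting along it makes the branch, the
-- list lengths and the number of used episodes constant again.
theorem adaptedOn_dfsLearn (hG : ∀ g ∈ G, Measurable g) (d : ℕ) (p : List (Fin K)) (isRec : Bool)
    {A : Set (ℕ → Episode K S X)} {F : (ℕ → Episode K S X) → Memory K X θ.nTrain}
    (hF : AdaptedOn F A) :
    AdaptedOn (fun ω => dfsLearn (E.access ω) G θ d p isRec (F ω)) A := by
  induction d generalizing p isRec A F with
  | zero => exact hF
  | succ d ih =>
    refine Glued.bind hF ?_
    rintro A ⟨t, hp⟩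
    have hle : past (Episode K S X) t ≤ past (Episode K S X) (t + θ.nTrain) :=
      past_mono (by omega)
    set s := p.foldl E.step E.init
    have hD := E.measurable_dataAt θ.nTrain t s
    obtain ⟨m, v, hv, hvA⟩ := hp.val p.length
    beta_reduce at hvA
    have hdata : ∀ ω ∈ A, (fun i : Fin θ.nTrain => (E.access ω).explore ((F ω).used + i) p) =
        E.dataAt ω θ.nTrain t s := by
      intro ω hω
      rw [hp.used ω hω]
      rfl
    let T : Set (ℕ → Episode K S X) :=
      {ω | ∃ i : Fin m, mmd G (v ω i) (E.dataAt ω θ.nTrain t s) ≤ 2 * θ.τ}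
    have hT : MeasurableSet[past (Episode K S X) (t + θ.nTrain)] T := by
      have : T = ⋃ i : Fin m,
          {ω | mmd G (v ω i) (E.dataAt ω θ.nTrain t s) ≤ 2 * θ.τ} := by
        ext ω; simp [T]
      rw [this]
      refine MeasurableSet.iUnion fun i => ?_
      have h1 : Measurable[past (Episode K S X) (t + θ.nTrain)] fun ω => v ω i :=
        ((measurable_pi_apply i).comp hv).mono hle le_rfl
      exact ((measurable_mmd hG).comp (h1.prodMk hD)) measurableSet_Iic
    have hseen : ∀ ω ∈ A, (∃ D' ∈ (F ω).val p.length, mmd G D'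
        (fun i : Fin θ.nTrain => (E.access ω).explore ((F ω).used + i) p) ≤ 2 * θ.τ) ↔ ω ∈ T := by
      intro ω hω
      rw [hdata ω hω, hvA ω hω]
      simp [T, List.mem_ofFn]
    have hA' : MeasurableSet[past (Episode K S X) (t + θ.nTrain)] A := hle _ hp.measurableSet
    have hused : ∀ ω ∈ A, (F ω).used + θ.nTrain = t + θ.nTrain := fun ω hω => by
      rw [hp.used ω hω]
    refine Glued.of_cases ⟨0, isPiece_empty _⟩ (fun ω => decide (ω ∈ T)) fun b => ?_
    have hfold : ∀ {A : Set (ℕ → Episode K S X)} {F : (ℕ → Episode K S X) → Memory K X θ.nTrain},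
        AdaptedOn F A → AdaptedOn (fun ω => (List.finRange K).foldl
          (fun m' a => dfsLearn (E.access ω) G θ d (p ++ [a]) true m') (F ω)) A :=
      AdaptedOn.foldl (Φ := fun a ω m' => dfsLearn (E.access ω) G θ d (p ++ [a]) true m')
        (fun a A F h => ih (p ++ [a]) true h) _
    cases b with
    | true =>
      have hset : A ∩ {ω | decide (ω ∈ T) = true} = A ∩ T := by ext; simp
      rw [hset]
      have hm : MeasurableSet[past (Episode K S X) (t + θ.nTrain)] (A ∩ T) := hA'.inter hT
      cases isRec with
      | true =>
        refine AdaptedOn.congr (F := fun ω => { F ω with used := t + θ.nTrain })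
          (.base ⟨_, hm, fun _ _ => rfl, fun h => ?_, fun h => ?_⟩) fun ω hω => ?_
        · exact (hp.learned h).mono (by omega) Set.inter_subset_left
        · exact (hp.val h).mono (by omega) Set.inter_subset_left
        · rw [dfsLearn_seen_rec _ _ _ _ _ _ ((hseen ω hω.1).2 hω.2), hused ω hω.1]
      | false =>
        refine AdaptedOn.congr (hfold (F := fun ω =>
          ⟨Function.update (F ω).learned p.length ((F ω).learned p.length ++
            [E.dataAt ω θ.nTrain t s]), (F ω).val, t + θ.nTrain⟩)
          (.base ⟨_, hm, fun _ _ => rfl, fun h => ?_, fun h => ?_⟩)) fun ω hω => ?_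
        · exact DeterminedOn.update
            (fun i => (hp.learned i).mono (by omega) Set.inter_subset_left) hD _ _
        · exact (hp.val h).mono (by omega) Set.inter_subset_left
        · rw [dfsLearn_seen _ _ _ _ _ _ ((hseen ω hω.1).2 hω.2), hused ω hω.1, hdata ω hω.1]
    | false =>
      have hset : A ∩ {ω | decide (ω ∈ T) = false} = A ∩ Tᶜ := by ext; simp
      rw [hset]
      have hm : MeasurableSet[past (Episode K S X) (t + θ.nTrain)] (A ∩ Tᶜ) := hA'.inter hT.compl
      refine AdaptedOn.congr (hfold (F := fun ω =>
        ⟨Function.update (F ω).learned p.length ((F ω).learned p.length ++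
          [E.dataAt ω θ.nTrain t s]), Function.update (F ω).val p.length ((F ω).val p.length ++
          [E.dataAt ω θ.nTrain t s]), t + θ.nTrain⟩)
        (.base ⟨_, hm, fun _ _ => rfl, fun h => ?_, fun h => ?_⟩)) fun ω hω => ?_
      · exact DeterminedOn.update
          (fun i => (hp.learned i).mono (by omega) Set.inter_subset_left) hD _ _
      · exact DeterminedOn.update
          (fun i => (hp.val i).mono (by omega) Set.inter_subset_left) hD _ _
      · rw [dfsLearn_new _ _ _ _ _ _ _ (fun h => hω.2 ((hseen ω hω.1).1 h)), hused ω hω.1,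
          hdata ω hω.1]

/-- The oracles are measurable in the data only for fixed other arguments. These arguments range
over the finite sets `insert 0 G` and `P`, so the event is a finite union of events with fixed
arguments. -/
theorem measurableSet_fittedValue {n : ℕ} (hG : ∀ g ∈ G, Measurable g)
    (hP : ∀ π ∈ P, Measurable π) (O : Oracles K n G P) {Y : Type*} [MeasurableSpace Y] {t : ℕ}
    {A : Set (ℕ → Y)} {F : (ℕ → Y) → Memory K X n} (hF : IsPiece t A F) (d : ℕ) (g : X → ℝ) :
    MeasurableSet[past Y t] (A ∩ {ω | fittedValue H O (F ω) d = g}) := by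
  classical
  induction d generalizing g with
  | zero => exact hF.measurableSet.inter (MeasurableSet.const ((fun _ => 0) = g))
  | succ d ih =>
    by_cases hg : g ∈ G
    · obtain ⟨ml, dl, hdl, hl⟩ := hF.learned (H - (d + 1))
      obtain ⟨mv, dv, hdv, hv⟩ := hF.val (H - (d + 1))
      beta_reduce at hl hv
      have hset : A ∩ {ω | fittedValue H O (F ω) (d + 1) = g} =
          ⋃ g' ∈ insert (fun _ => 0) G, ⋃ π ∈ P, (A ∩ {ω | fittedValue H O (F ω) d = g'}) ∩
            (dl ⁻¹' {D | O.policy (List.ofFn D) g' = π} ∩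
              dv ⁻¹' {D | O.value (List.ofFn D) π g' = g}) := by
        ext ω
        simp only [Set.mem_inter_iff, Set.mem_ofPred_eq, Set.mem_iUnion, Set.mem_preimage,
          exists_prop]
        constructor
        · rintro ⟨hω, h⟩
          refine ⟨fittedValue H O (F ω) d, ?_, _, O.policy_mem _ _, ⟨hω, rfl⟩, rfl, ?_⟩
          · cases d with
            | zero => exact Finset.mem_insert_self _ _
            | succ d => exact Finset.mem_insert_of_mem (O.value_mem _ _ _)
          · rw [← h, ← hl ω hω, ← hv ω hω]
            rfl
        · rintro ⟨g', -, π, -, ⟨hω, h1⟩, h2, h3⟩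
          refine ⟨hω, ?_⟩
          simp only [fittedValue]
          rw [h1, hl ω hω, h2, hv ω hω, h3]
      rw [hset]
      refine Finset.measurableSet_biUnion _ fun g' hg' => Finset.measurableSet_biUnion _
        fun π hπ => (ih g').inter ?_
      have hg'm : Measurable g' := by
        rcases Finset.mem_insert.1 hg' with rfl | h
        · exact measurable_const
        · exact hG _ h
      exact @MeasurableSet.inter _ (past Y t) _ _ (hdl (O.policy_meas _ _ hg'm _ hπ))
        (hdv (O.value_meas _ _ _ (hP _ hπ) hg'm _ hg))
    · have hset : A ∩ {ω | fittedValue H O (F ω) (d + 1) = g} = ∅ := by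
        refine Set.eq_empty_of_forall_notMem ?_
        rintro ω ⟨-, h⟩
        exact hg (h ▸ O.value_mem _ _ _)
      rw [hset]
      exact @MeasurableSet.empty _ (past Y t)

theorem measurableSet_fittedPolicy {n : ℕ} (hG : ∀ g ∈ G, Measurable g)
    (hP : ∀ π ∈ P, Measurable π) (O : Oracles K n G P) {Y : Type*} [MeasurableSpace Y] {t : ℕ}
    {A : Set (ℕ → Y)} {F : (ℕ → Y) → Memory K X n} (hF : IsPiece t A F) (h : ℕ) {π : X → Fin K}
    (hπ : π ∈ P) : MeasurableSet[past Y t] (A ∩ {ω | fittedPolicy H O (F ω) h = π}) := by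
  classical
  obtain ⟨ml, dl, hdl, hl⟩ := hF.learned h
  beta_reduce at hl
  have hset : A ∩ {ω | fittedPolicy H O (F ω) h = π} =
      ⋃ g' ∈ insert (fun _ => 0) G, (A ∩ {ω | fittedValue H O (F ω) (H - (h + 1)) = g'}) ∩
        dl ⁻¹' {D | O.policy (List.ofFn D) g' = π} := by
    ext ω
    simp only [Set.mem_inter_iff, Set.mem_ofPred_eq, Set.mem_iUnion, Set.mem_preimage, exists_prop]
    constructor
    · rintro ⟨hω, h1⟩
      refine ⟨fittedValue H O (F ω) (H - (h + 1)), ?_, ⟨hω, rfl⟩, ?_⟩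
      · cases H - (h + 1) with
        | zero => exact Finset.mem_insert_self _ _
        | succ d => exact Finset.mem_insert_of_mem (O.value_mem _ _ _)
      · rw [← h1, ← hl ω hω]
        rfl
    · rintro ⟨g', -, ⟨hω, h1⟩, h2⟩
      refine ⟨hω, ?_⟩
      simp only [fittedPolicy]
      rw [h1, hl ω hω, h2]
  rw [hset]
  refine Finset.measurableSet_biUnion _ fun g' hg' =>
    (measurableSet_fittedValue hG hP O hF _ g').inter (hdl (O.policy_meas _ _ ?_ _ hπ))
  rcases Finset.mem_insert.1 hg' with rfl | h
  · exact measurable_const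
  · exact hG _ h

variable [NeZero K]

/-- On the event `A` the fitted policy and the learned states are `π` and `U`, and these as well as
the memory are determined by the first `t` episodes. -/
structure IsFittedPiece {n : ℕ} [NeZero n] (O : Oracles K n G P) {Y : Type*} [MeasurableSpace Y]
    (t : ℕ) (A : Set (ℕ → Y)) (F : (ℕ → Y) → Memory K X n) (π : Policy K X) (U : Set S) :
    Prop extends IsPiece t A F where
  measurable_policy : ∀ h, Measurable (π h)
  fittedPolicy_eq : ∀ ω ∈ A, ∀ h < H, fittedPolicy H O (F ω) h = π h
  learnedStates_eq : ∀ ω ∈ A, E.learnedStates (F ω) = U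

theorem isFittedPiece_empty {n : ℕ} [NeZero n] (O : Oracles K n G P) {Y : Type*}
    [MeasurableSpace Y] (F : (ℕ → Y) → Memory K X n) :
    E.IsFittedPiece O 0 ∅ F (fun _ _ => 0) ∅ :=
  ⟨isPiece_empty F, fun _ => measurable_const, by simp, by simp⟩

/-- Below level `H` the fitted policy takes finitely many values, and there are finitely many sets
of states; cutting along both makes the policy to be evaluated non-random on each piece. Levels from
`H` on are left free, since they could produce uncountably many cases. -/
theorem AdaptedOn.fitted [Fintype S] {n : ℕ} [NeZero n] (hG : ∀ g ∈ G, Measurable g)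
    (hP : ∀ π ∈ P, Measurable π) (O : Oracles K n G P) {Y : Type*} [MeasurableSpace Y]
    {A : Set (ℕ → Y)} {F : (ℕ → Y) → Memory K X n} (hF : AdaptedOn F A) :
    Glued (fun A => ∃ t π U, E.IsFittedPiece O t A F π U) A := by
  refine Glued.bind hF ?_
  rintro A ⟨t, hp⟩
  refine Glued.of_cases ⟨_, _, _, isFittedPiece_empty E O F⟩
    (fun ω (h : Fin H) => (⟨fittedPolicy H O (F ω) h, O.policy_mem _ _⟩ : P)) fun c => ?_
  refine Glued.of_cases ⟨_, _, _, isFittedPiece_empty E O F⟩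
    (fun ω => E.learnedStates (F ω)) fun U => ?_
  let π : Policy K X := fun h => if hh : h < H then (c ⟨h, hh⟩).1 else fun _ => 0
  refine .base ⟨t, π, U, hp.mono (fun ω hω => hω.1.1) ?_, fun h => ?_, fun ω hω h hh => ?_,
    fun ω hω => hω.2⟩
  · have h1 : ∀ h : Fin H, MeasurableSet[past Y t]
        (A ∩ {ω | fittedPolicy H O (F ω) h = (c h).1}) := fun h =>
      measurableSet_fittedPolicy hG hP O hp h (c h).2
    have h2 : ∀ s : S, MeasurableSet[past Y t] (A ∩ {ω | s ∈ E.learnedStates (F ω) ↔ s ∈ U}) := by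
      intro s
      obtain ⟨m, d, hd, hA⟩ := hp.learned (E.level s)
      beta_reduce at hA
      let T : Set (ℕ → Y) := {ω | ∃ i : Fin m, E.decode (d ω i 0).1 = s}
      have hT : MeasurableSet[past Y t] T := by
        have : T = ⋃ i : Fin m, (fun ω => (d ω i 0).1) ⁻¹' {x | E.decode x = s} := by
          ext ω; simp [T]
        rw [this]
        refine MeasurableSet.iUnion fun i => ?_
        have h3 : Measurable[past Y t] fun ω => (d ω i 0).1 :=
          Measurable.fst ((measurable_pi_apply 0).comp ((measurable_pi_apply i).comp hd))
        exact h3 (E.measurableSet_decode s)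
      have hmem : ∀ ω ∈ A, s ∈ E.learnedStates (F ω) ↔ ω ∈ T := by
        intro ω hω
        simp [learnedStates, hA ω hω, T, stateOf, List.mem_ofFn]
      by_cases hs : s ∈ U
      · have : A ∩ {ω | s ∈ E.learnedStates (F ω) ↔ s ∈ U} = A ∩ T := by
          ext ω
          simp only [Set.mem_inter_iff, Set.mem_ofPred_eq, hs, iff_true]
          exact and_congr_right fun hω => hmem ω hω
        rw [this]
        exact @MeasurableSet.inter _ (past Y t) _ _ hp.measurableSet hT
      · have : A ∩ {ω | s ∈ E.learnedStates (F ω) ↔ s ∈ U} = A ∩ Tᶜ := by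
          ext ω
          simp only [Set.mem_inter_iff, Set.mem_ofPred_eq, hs, iff_false, Set.mem_compl_iff]
          exact and_congr_right fun hω => not_congr (hmem ω hω)
        rw [this]
        exact @MeasurableSet.inter _ (past Y t) _ _ hp.measurableSet hT.compl
    have h4 : (A ∩ {ω | (fun h : Fin H => (⟨fittedPolicy H O (F ω) h, O.policy_mem _ _⟩ : P)) = c})
        ∩ {ω | E.learnedStates (F ω) = U} =
        A ∩ (⋂ h : Fin H, A ∩ {ω | fittedPolicy H O (F ω) h = (c h).1}) ∩
          ⋂ s : S, A ∩ {ω | s ∈ E.learnedStates (F ω) ↔ s ∈ U} := by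
      ext ω
      simp only [Set.mem_inter_iff, Set.mem_ofPred_eq, Set.mem_iInter, funext_iff, Subtype.ext_iff,
        Set.ext_iff]
      constructor
      · rintro ⟨⟨h5, h6⟩, h7⟩
        exact ⟨⟨h5, fun i => ⟨h5, h6 i⟩⟩, fun s => ⟨h5, h7 s⟩⟩
      · rintro ⟨⟨h5, h6⟩, h7⟩
        exact ⟨⟨h5, fun i => (h6 i).2⟩, fun s => (h7 s).2⟩
    rw [h4]
    exact @MeasurableSet.inter _ (past Y t) _ _
      (@MeasurableSet.inter _ (past Y t) _ _ hp.measurableSet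
        (@MeasurableSet.iInter _ _ (past Y t) _ _ h1)) (@MeasurableSet.iInter _ _ (past Y t) _ _ h2)
  · simp only [π]
    split_ifs with hh
    · exact hP _ (c ⟨h, hh⟩).2
    · exact measurable_const
  · have h1 : (fun h : Fin H => (⟨fittedPolicy H O (F ω) h, O.policy_mem _ _⟩ : P)) = c := hω.1.2
    simp only [π, dif_pos hh, ← h1]

/-- The search calls depend on the actions seen during the evaluation. These form a finite table,
and splitting along it turns the paths of the calls into constants. -/
theorem adaptedOn_exploreStep [Fintype S] [NeZero θ.nTrain] (hG : ∀ g ∈ G, Measurable g)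
    (hP : ∀ π ∈ P, Measurable π) (O : Oracles K θ.nTrain G P) {A : Set (ℕ → Episode K S X)}
    {F : (ℕ → Episode K S X) → Memory K X θ.nTrain} (hF : AdaptedOn F A) :
    AdaptedOn (fun ω => exploreStep (E.access ω) H θ O (F ω)) A := by
  refine Glued.bind (AdaptedOn.fitted E hG hP O hF) ?_
  rintro A ⟨t, π, U, hp⟩
  refine Glued.of_cases ⟨0, isPiece_empty _⟩ (fun ω (z : Fin θ.nEval × Fin H) =>
    (E.trajectory (ω (t + z.1)) π z.2).2.1) fun a => ?_
  set A' := A ∩ {ω | (fun z : Fin θ.nEval × Fin H =>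
    (E.trajectory (ω (t + z.1)) π z.2).2.1) = a} with hA'
  have hm : MeasurableSet[past (Episode K S X) (t + θ.nEval)] A' := by
    have h1 : Measurable[past (Episode K S X) (t + θ.nEval)] fun ω =>
        (fun z : Fin θ.nEval × Fin H => (E.trajectory (ω (t + z.1)) π z.2).2.1) := by
      refine @measurable_pi_lambda _ _ _ (past _ (t + θ.nEval)) _ _ fun z => ?_
      have h2 := (E.measurable_trajectory π hp.measurable_policy z.2).comp
        (measurable_past_eval (Y := Episode K S X) (show t + (z.1 : ℕ) < t + θ.nEval by omega))
      exact h2.snd.fst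
    exact @MeasurableSet.inter _ (past _ (t + θ.nEval)) _ _
      (past_mono (by omega) _ hp.measurableSet) (h1 (measurableSet_singleton a))
  have hbase : AdaptedOn (fun ω => { F ω with used := t + θ.nEval }) A' :=
    .base ⟨_, hm, fun _ _ => rfl,
      fun h => (hp.learned h).mono (by omega) Set.inter_subset_left,
      fun h => (hp.val h).mono (by omega) Set.inter_subset_left⟩
  -- The default action `0` is never read: all calls have `i < nEval` and `j < h < H`.
  let q : ℕ → ℕ → List (Fin K) := fun h i => (List.range h).map fun j =>
    if hz : i < θ.nEval ∧ j < H then a (⟨i, hz.1⟩, ⟨j, hz.2⟩) else 0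
  have hfold := AdaptedOn.foldl (Φ := fun h ω m' =>
      (List.range (min θ.nExp θ.nEval)).foldl (fun m'' i =>
        dfsLearn (E.access ω) G θ (H - h) (q h i) false m'') m')
    (fun h A F hF => AdaptedOn.foldl (Φ := fun i ω m'' =>
        dfsLearn (E.access ω) G θ (H - h) (q h i) false m'')
      (fun i A F hF => E.adaptedOn_dfsLearn hG _ _ _ hF) _ hF) (List.range' 1 (H - 1)) hbase
  refine hfold.congr fun ω hω => ?_
  have hu := hp.used ω hω.1
  unfold exploreStep
  rw [hu]
  refine List.foldl_ext _ _ _ fun m' h hh => List.foldl_ext _ _ _ fun m'' i hi => ?_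
  rw [List.mem_range'_1] at hh
  rw [List.mem_range] at hi
  congr 1
  refine List.map_congr_left fun j hj => ?_
  rw [List.mem_range] at hj
  have hz : i < θ.nEval ∧ j < H := by omega
  have h1 := congrFun hω.2 (⟨i, hz.1⟩, ⟨j, hz.2⟩)
  rw [dif_pos hz, ← h1]
  exact congrArg (fun z => z.2.1)
    (E.trajectory_congr hz.2 fun h hh => (hp.fittedPolicy_eq ω hω.1 h hh).symm)

theorem adaptedOn_memoryAt [Fintype S] [NeZero θ.nTrain] (hG : ∀ g ∈ G, Measurable g)
    (hP : ∀ π ∈ P, Measurable π) (O : Oracles K θ.nTrain G P) (k : ℕ) :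
    AdaptedOn (fun ω => memoryAt (E.access ω) H θ O k) Set.univ := by
  induction k with
  | zero =>
    refine E.adaptedOn_dfsLearn (F := fun _ => ⟨fun _ => [], fun _ => [], 0⟩) hG H [] false
      (.base ⟨0, @MeasurableSet.univ _ (past _ 0), fun _ _ => rfl, fun _ => ?_, fun _ => ?_⟩)
    all_goals exact ⟨0, fun _ => Fin.elim0, @measurable_const _ _ _ (past _ 0) _, by simp⟩
  | succ k ih =>
    simp only [memoryAt_succ]
    exact E.adaptedOn_exploreStep hG hP O ih

end DetCDP
end TwoSampleRL

end

/-! ### Evaluations are representative with high probability. -/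

noncomputable section
namespace TwoSampleRL

/-- A bound relative to each piece survives disjoint unions by countable additivity. Only the pieces
have to be measurable; the bad event `B` is arbitrary. -/
theorem Glued.measure_inter_le {Ω : Type*} [MeasurableSpace Ω] {μ : Measure Ω} {B : Set Ω}
    {Q : Set Ω → Prop} {δ : ENNReal} (hQ : ∀ A, Q A → MeasurableSet A ∧ μ (A ∩ B) ≤ μ A * δ)
    {A : Set Ω} (hA : Glued Q A) : MeasurableSet A ∧ μ (A ∩ B) ≤ μ A * δ := by
  induction hA with
  | base h => exact hQ _ h
  | @iUnion A hd _ ih =>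
    refine ⟨.iUnion fun i => (ih i).1, ?_⟩
    rw [Set.iUnion_inter, measure_iUnion hd fun i => (ih i).1, ← ENNReal.tsum_mul_right]
    exact (measure_iUnion_le _).trans (ENNReal.tsum_le_tsum fun i => (ih i).2)

namespace DetCDP

variable {H K : ℕ} {S X : Type*} [MeasurableSpace X] [Fintype S] [NeZero K] (E : DetCDP H K S X)

/-- The evaluation of a fixed policy `π` on `N` trajectories, starting with episode `t`, fails: the
average return is inaccurate, or none of the first `n` trajectories leaves the set `U` of states
although `π` does so with probability at least `p`. -/
def evaluationFails (π : Policy K X) (U : Set S) (p τ : ℝ) (N n t : ℕ) :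
    Set (ℕ → Episode K S X) :=
  {ω | τ < |(∑ i ∈ Finset.range N, ∑ h ∈ Finset.range H, (E.trajectory (ω (t + i)) π h).2.2) / N -
    E.value π|} ∪
  {ω | p ≤ E.episodeLaw.real {e | ∃ h < H, E.stateAt e π h ∉ U} ∧
    ∀ i < n, ω (t + i) ∈ {e | ∃ h < H, E.stateAt e π h ∉ U}ᶜ}

variable {E} {π : Policy K X} (hπ : ∀ h, Measurable (π h)) (U : Set S)
include hπ

omit [NeZero K] in
theorem measurableSet_exit : MeasurableSet {e | ∃ h < H, E.stateAt e π h ∉ U} := by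
  have : {e | ∃ h < H, E.stateAt e π h ∉ U} =
      ⋃ h ∈ Finset.range H, (fun e => E.stateAt e π h) ⁻¹' Uᶜ := by
    ext e; simp
  rw [this]
  exact Finset.measurableSet_biUnion _ fun h _ => E.measurable_stateAt π hπ h trivial

omit [NeZero K] in
theorem measurableSet_evaluationFails (p τ : ℝ) (N n t : ℕ) :
    MeasurableSet (E.evaluationFails π U p τ N n t) := by
  have h1 : ∀ i h, Measurable fun ω : ℕ → Episode K S X => (E.trajectory (ω (t + i)) π h).2.2 :=
    fun i h => ((E.measurable_trajectory π hπ h).comp (measurable_pi_apply (t + i))).snd.snd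
  refine MeasurableSet.union (measurableSet_lt measurable_const (by fun_prop)) ?_
  have : {ω : ℕ → Episode K S X | ∀ i < n, ω (t + i) ∈ {e | ∃ h < H, E.stateAt e π h ∉ U}ᶜ} =
      ⋂ i ∈ Finset.range n, (fun ω => ω (t + i)) ⁻¹' {e | ∃ h < H, E.stateAt e π h ∉ U}ᶜ := by
    ext e; simp
  refine MeasurableSet.inter (MeasurableSet.const _) (MeasurableSet.congr ?_ this.symm)
  exact Finset.measurableSet_biInter _ fun i _ =>
    measurable_pi_apply _ (measurableSet_exit hπ U).compl

/-- Hoeffding's inequality for the returns, which lie in [0, 1], and independence of the `n`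
trajectories that all have to stay in `U`. -/
theorem measure_evaluationFails_le (hR : E.RegularRewards) {p τ : ℝ} (hτ : 0 ≤ τ) (hp : p ≤ 1)
    {N : ℕ} (hN : 0 < N) (n t : ℕ) : E.tapeLaw (E.evaluationFails π U p τ N n t) ≤
      ENNReal.ofReal (2 * Real.exp (-(2 * N * τ ^ 2)) + (1 - p) ^ n) := by
  rw [ENNReal.ofReal_add (by positivity) (pow_nonneg (by linarith) _)]
  refine (measure_union_le _ _).trans (add_le_add ?_ ?_)
  · have h1 := hoeffding_block (μ := E.episodeLaw)
      (f := fun e => ∑ h ∈ Finset.range H, (E.trajectory e π h).2.2)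
      (Finset.measurable_sum _ fun h _ => (E.measurable_trajectory π hπ h).snd.snd)
      one_pos ?_ hN t hτ
    · rwa [one_pow, div_one] at h1
    · filter_upwards [hR.ae_all_policies] with e he
      exact ⟨Finset.sum_nonneg fun h hh => (he π).1 h (Finset.mem_range.1 hh), (he π).2⟩
  · by_cases h : p ≤ E.episodeLaw.real {e | ∃ h < H, E.stateAt e π h ∉ U}
    · have hm := measurableSet_exit (E := E) hπ U
      simp only [h, true_and]
      rw [tapeLaw, measure_block_forall _ _ _ hm.compl, ENNReal.ofReal_pow (by linarith)]
      gcongr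
      rw [← ENNReal.ofReal_toReal (measure_ne_top E.episodeLaw _)]
      refine ENNReal.ofReal_le_ofReal ?_
      have := probReal_compl_eq_one_sub (μ := E.episodeLaw) hm
      rw [measureReal_def] at this
      rw [this]
      linarith
    · simp [h]

omit hπ [NeZero K] in
theorem evaluationFails_congr {p τ : ℝ} {N n t : ℕ} (hn : n ≤ N) {ω ω' : ℕ → Episode K S X}
    (h : ∀ i < N, ω (t + i) = ω' (t + i)) (hω : ω ∈ E.evaluationFails π U p τ N n t) :
    ω' ∈ E.evaluationFails π U p τ N n t := by
  refine Or.imp (fun h1 => ?_) (fun h1 => ⟨h1.1, fun i hi => ?_⟩) hω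
  · have h2 : ∀ i ∈ Finset.range N, ω (t + i) = ω' (t + i) := fun i hi => h i (Finset.mem_range.1 hi)
    have h3 : (∑ i ∈ Finset.range N, ∑ h ∈ Finset.range H, (E.trajectory (ω (t + i)) π h).2.2) =
        ∑ i ∈ Finset.range N, ∑ h ∈ Finset.range H, (E.trajectory (ω' (t + i)) π h).2.2 :=
      Finset.sum_congr rfl fun i hi => by rw [h2 i hi]
    rw [Set.mem_ofPred_eq] at h1 ⊢
    rwa [← h3]
  · rw [← h i (by omega)]
    exact h1.2 i hi

omit hπ in
-- On a piece the policy and the learned states are constants, and the piece is an event of the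
-- first `t` episodes. There the bad event is contained in the failure of a fixed evaluation on the
-- next block, independence factors the probability, and the bound does not depend on the piece.
theorem measure_not_representative_le (hR : E.RegularRewards) {G : Finset (X → ℝ)}
    {P : Finset (X → Fin K)} (hG : ∀ g ∈ G, Measurable g) (hP : ∀ π ∈ P, Measurable π)
    {θ : Params} [NeZero θ.nTrain] (O : Oracles K θ.nTrain G P) (hτ : 0 ≤ θ.τ) {ε : ℝ}
    (hε : ε ≤ 4) (hN : 0 < θ.nEval) (hn : θ.nExp ≤ θ.nEval) (k : ℕ) :
    E.tapeLaw {ω | ¬ E.Representative ω ε θ O (memoryAt (E.access ω) H θ O k)} ≤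
      ENNReal.ofReal (2 * Real.exp (-(2 * θ.nEval * θ.τ ^ 2)) + (1 - ε / 4) ^ θ.nExp) := by
  have h := Glued.measure_inter_le (μ := E.tapeLaw)
    (B := {ω | ¬ E.Representative ω ε θ O (memoryAt (E.access ω) H θ O k)})
    (δ := ENNReal.ofReal (2 * Real.exp (-(2 * θ.nEval * θ.τ ^ 2)) + (1 - ε / 4) ^ θ.nExp)) ?_
    (AdaptedOn.fitted E hG hP O (E.adaptedOn_memoryAt hG hP O k))
  · have : IsProbabilityMeasure E.tapeLaw := by unfold tapeLaw; infer_instance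
    simpa using h.2
  · rintro A ⟨t, π, U, hA⟩
    have hAm : MeasurableSet A := past_le t _ hA.measurableSet
    refine ⟨hAm, ?_⟩
    have hsub : A ∩ {ω | ¬ E.Representative ω ε θ O (memoryAt (E.access ω) H θ O k)} ⊆
        A ∩ E.evaluationFails π U (ε / 4) θ.τ θ.nEval θ.nExp t := by
      rintro ω ⟨hωA, hω⟩
      refine ⟨hωA, ?_⟩
      have hpol := hA.fittedPolicy_eq ω hωA
      have hst : ∀ e, ∀ h < H, E.stateAt e (fittedPolicy H O (memoryAt (E.access ω) H θ O k)) h =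
          E.stateAt e π h := fun e h hh =>
        E.stateAt_congr hh (fun _ _ => rfl) (fun j hj => hpol j (by omega))
      have htr : ∀ e, ∀ h < H, E.trajectory e (fittedPolicy H O (memoryAt (E.access ω) H θ O k)) h =
          E.trajectory e π h := fun e h hh => E.trajectory_congr hh hpol
      by_contra hnot
      rw [evaluationFails, Set.mem_union, not_or, Set.mem_ofPred_eq, Set.mem_ofPred_eq, not_lt] at hnot
      refine hω ⟨?_, fun hp => ?_⟩
      · have h1 : avgReturn (E.access ω) H θ O (memoryAt (E.access ω) H θ O k) =
            (∑ i ∈ Finset.range θ.nEval, ∑ h ∈ Finset.range H,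
              (E.trajectory (ω (t + i)) π h).2.2) / θ.nEval := by
          unfold avgReturn
          rw [hA.used ω hωA]
          congr 1
          refine Finset.sum_congr rfl fun i _ => Finset.sum_congr rfl fun h hh => ?_
          exact congrArg (fun z => z.2.2) (htr _ h (Finset.mem_range.1 hh))
        have h2 : E.value (fittedPolicy H O (memoryAt (E.access ω) H θ O k)) = E.value π := by
          unfold value
          congr 1
          ext e
          refine Finset.sum_congr rfl fun h hh => ?_
          rw [htr _ h (Finset.mem_range.1 hh)]
        rw [h1, h2]
        exact hnot.1
      · have hU := hA.learnedStates_eq ω hωA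
        have hex : ∀ e, (∃ h < H, E.stateAt e (fittedPolicy H O (memoryAt (E.access ω) H θ O k)) h ∉
            E.learnedStates (memoryAt (E.access ω) H θ O k)) ↔ ∃ h < H, E.stateAt e π h ∉ U := by
          intro e
          rw [hU]
          exact exists_congr fun h => and_congr_right fun hh => by rw [hst e h hh]
        simp only [hex] at hp
        by_contra hne
        push Not at hne
        refine hnot.2 ⟨hp, fun i hi => ?_⟩
        rw [Set.mem_compl_iff, Set.mem_ofPred_eq, ← hex]
        push Not
        intro h hh
        have := hne i hi h hh
        rwa [hA.used ω hωA] at this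
    refine (measure_mono hsub).trans ?_
    have hind := measure_inter_block (μ := E.episodeLaw) hAm (t := t) (n := θ.nEval)
      (fun ω ω' h hω => mem_of_measurableSet_past hA.measurableSet h hω)
      (measurableSet_evaluationFails (E := E) hA.measurable_policy U (ε / 4) θ.τ θ.nEval θ.nExp t)
      (fun ω ω' h hω => evaluationFails_congr U hn h hω)
    rw [tapeLaw, hind]
    gcongr
    exact measure_evaluationFails_le hA.measurable_policy U hR hτ (by linarith) hN _ _

end DetCDP
end TwoSampleRL

end

/-! ### Uniform accuracy of all data sets. -/

noncomputable section
namespace TwoSampleRL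

section TestFunctions

variable {K : ℕ} {X : Type*} (G : Finset (X → ℝ)) (P : Finset (X → Fin K))

open Classical in
/-- The functions whose empirical means the algorithm relies on. -/
def testFunctions : Finset (Sample K X → ℝ) :=
  G.image (fun g z => g z.1) ∪
    (insert (fun _ => 0) G ×ˢ P).image (fun q => policyTerm q.2 q.1) ∪
    (insert (fun _ => 0) G ×ˢ P ×ˢ G).image (fun q => lossTerm q.2.1 q.1 q.2.2)

theorem card_testFunctions_le (hG : 1 ≤ G.card) (hP : 1 ≤ P.card) :
    (testFunctions G P).card ≤ 5 * G.card ^ 2 * P.card := by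
  classical
  have h0 : (insert (fun _ => (0 : ℝ)) G).card ≤ 2 * G.card :=
    (Finset.card_insert_le _ _).trans (by omega)
  calc (testFunctions G P).card ≤ G.card + 2 * G.card * P.card +
        2 * G.card * (P.card * G.card) := by
        refine (Finset.card_union_le _ _).trans (add_le_add ((Finset.card_union_le _ _).trans
          (add_le_add Finset.card_image_le (Finset.card_image_le.trans ?_)))
          (Finset.card_image_le.trans ?_))
        · rw [Finset.card_product]; gcongr
        · rw [Finset.card_product, Finset.card_product]; gcongr
    _ ≤ 5 * G.card ^ 2 * P.card := by
        obtain ⟨a, ha⟩ := Nat.exists_eq_add_of_le hG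
        obtain ⟨b, hb⟩ := Nat.exists_eq_add_of_le hP
        rw [ha, hb]
        ring_nf
        nlinarith [Nat.zero_le (a * b), Nat.zero_le (a ^ 2 * b), Nat.zero_le (a ^ 2)]

variable {G P}

theorem testFunctions_spec [MeasurableSpace X]
    (hG : ∀ g ∈ G, Measurable g ∧ ∀ x, g x ∈ Set.Icc (0 : ℝ) 1)
    (hP : ∀ π ∈ P, Measurable π) (hK : 1 ≤ K) {f : Sample K X → ℝ} (hf : f ∈ testFunctions G P) :
    Measurable f ∧ ∀ z : Sample K X, z.2.2.1 ∈ Set.Icc (0 : ℝ) 1 → f z ∈ Set.Icc (0 : ℝ) (4 * K) := by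
  classical
  have hG0 : ∀ g ∈ insert (fun _ => 0) G, Measurable g ∧ ∀ x, g x ∈ Set.Icc (0 : ℝ) 1 := by
    intro g hg
    rcases Finset.mem_insert.1 hg with rfl | h
    · exact ⟨measurable_const, fun _ => ⟨le_rfl, zero_le_one⟩⟩
    · exact hG g h
  have hK' : (1 : ℝ) ≤ K := by exact_mod_cast hK
  simp only [testFunctions, Finset.mem_union, Finset.mem_image, Finset.mem_product] at hf
  rcases hf with (⟨g, hg, rfl⟩ | ⟨⟨g', π⟩, ⟨hg', hπ⟩, rfl⟩) | ⟨⟨g', π, g⟩, ⟨hg', hπ, hg⟩, rfl⟩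
  · refine ⟨(hG g hg).1.comp measurable_fst, fun z _ => ?_⟩
    have := (hG g hg).2 z.1
    exact ⟨this.1, by linarith [this.2]⟩
  · exact ⟨measurable_policyTerm (hP π hπ) (hG0 g' hg').1, fun z hz =>
      policyTerm_mem (hG0 g' hg').2 hz⟩
  · exact ⟨measurable_lossTerm (hP π hπ) (hG0 g' hg').1 (hG g hg).1, fun z hz =>
      lossTerm_mem (hG0 g' hg').2 (hG g hg).2 hz⟩

end TestFunctions

namespace DetCDP

variable {H K : ℕ} {S X : Type*} [MeasurableSpace X] [Fintype S] [NeZero K] (E : DetCDP H K S X)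

theorem ae_decode : ∀ᵐ ω ∂E.tapeLaw, ∀ t s, E.decode ((ω t).1 s).1 = s := by
  refine ae_all_iff.2 fun t => ae_all_iff.2 fun s => ?_
  have h1 : MeasurePreserving (fun ω : ℕ → Episode K S X => ω t) E.tapeLaw E.episodeLaw :=
    measurePreserving_eval_infinitePi (fun _ : ℕ => E.episodeLaw) t
  have h2 := ((E.measurePreserving_stateLaw_fst s).comp (E.measurePreserving_state s)).comp h1
  exact h2.quasiMeasurePreserving.ae (E.decode_emit s)

variable {E} {G : Finset (X → ℝ)} {P : Finset (X → Fin K)}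

theorem measure_empMean_le (hR : E.RegularRewards)
    (hG : ∀ g ∈ G, Measurable g ∧ ∀ x, g x ∈ Set.Icc (0 : ℝ) 1) (hP : ∀ π ∈ P, Measurable π)
    {n : ℕ} (hn : 0 < n) {τ : ℝ} (hτ : 0 ≤ τ) {s : S} (hs : E.Reachable s) (t : ℕ)
    {f : Sample K X → ℝ} (hf : f ∈ testFunctions G P) :
    E.tapeLaw {ω | τ < |empMean (E.dataAt ω n t s) f - ∫ e, f (E.sampleAt s e) ∂E.episodeLaw|} ≤
      ENNReal.ofReal (2 * Real.exp (-(2 * n * τ ^ 2 / (4 * K) ^ 2))) := by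
  have hK : (0 : ℝ) < K := Nat.cast_pos.2 (NeZero.pos K)
  obtain ⟨h1, h2⟩ := testFunctions_spec hG hP (NeZero.pos K) hf
  have h3 := hoeffding_block (μ := E.episodeLaw) (f := fun e => f (E.sampleAt s e))
    (h1.comp (E.measurable_sampleAt s)) (b := 4 * K) (by positivity) ?_ hn t hτ
  · refine le_trans (le_of_eq ?_) h3
    congr 1
    ext ω
    simp only [empMean, dataAt, Set.mem_ofPred_eq]
    rw [Finset.sum_range]
  · filter_upwards [hR.ae_sampleAt hs] with e he
    exact h2 _ (he e.2)

theorem Concentrated.of_testFunctions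
    (hG : ∀ g ∈ G, Measurable g) {n B : ℕ} {τ : ℝ}
    {ω : ℕ → Episode K S X} (hd : ∀ t s, E.decode ((ω t).1 s).1 = s)
    (h : ∀ c < B, ∀ s, E.Reachable s → ∀ f ∈ testFunctions G P,
      |empMean (E.dataAt ω n (n * c) s) f - ∫ e, f (E.sampleAt s e) ∂E.episodeLaw| ≤ τ) :
    E.Concentrated ω G P n B τ := by
  classical
  refine ⟨⟨hd, fun c hc s hs g hg => ?_⟩, fun c hc s hs g' hg' π hπ => ?_,
    fun c hc s hs g' hg' π hπ g hg => ?_⟩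
  · have h1 := h c hc s hs (fun z => g z.1) (by
      simp only [testFunctions, Finset.mem_union, Finset.mem_image]
      exact Or.inl (Or.inl ⟨g, hg, rfl⟩))
    have hmp := (E.measurePreserving_stateLaw_fst s).comp (E.measurePreserving_state s)
    rwa [← hmp.map_eq, integral_map hmp.aemeasurable (hG g hg).aestronglyMeasurable]
  · refine h c hc s hs _ ?_
    simp only [testFunctions, Finset.mem_union, Finset.mem_image]
    refine Or.inl (Or.inr ⟨(g', π), ?_, rfl⟩)
    simp only [Finset.mem_product, Finset.mem_insert]
    exact ⟨hg', hπ⟩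
  · refine h c hc s hs _ ?_
    simp only [testFunctions, Finset.mem_union, Finset.mem_image]
    refine Or.inr ⟨(g', π, g), ?_, rfl⟩
    simp only [Finset.mem_product, Finset.mem_insert]
    exact ⟨hg', hπ, hg⟩

/-- No adaptivity has to be handled: the data set of each state in each block is a fixed function of
the tape, so a union bound over blocks, reachable states and test functions covers whatever the
algorithm collects. -/
theorem measure_not_concentrated_le (hR : E.RegularRewards)
    (hG : ∀ g ∈ G, Measurable g ∧ ∀ x, g x ∈ Set.Icc (0 : ℝ) 1) (hP : ∀ π ∈ P, Measurable π)
    (hG1 : 1 ≤ G.card) (hP1 : 1 ≤ P.card) {n : ℕ} (hn : 0 < n) {τ : ℝ} (hτ : 0 ≤ τ) (B : ℕ) :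
    E.tapeLaw {ω | ¬ E.Concentrated ω G P n B τ} ≤
      ENNReal.ofReal (B * (E.width * H) * (5 * G.card ^ 2 * P.card) *
        (2 * Real.exp (-(2 * n * τ ^ 2 / (4 * K) ^ 2)))) := by
  classical
  set r := ENNReal.ofReal (2 * Real.exp (-(2 * n * τ ^ 2 / (4 * K) ^ 2))) with hr
  let T : Finset (ℕ × S × (Sample K X → ℝ)) :=
    Finset.range B ×ˢ (Finset.univ.filter fun s => E.Reachable s) ×ˢ testFunctions G P
  let bad : ℕ × S × (Sample K X → ℝ) → Set (ℕ → Episode K S X) := fun q =>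
    {ω | τ < |empMean (E.dataAt ω n (n * q.1) q.2.1) q.2.2 -
      ∫ e, q.2.2 (E.sampleAt q.2.1 e) ∂E.episodeLaw|}
  have hsub : {ω | ¬ E.Concentrated ω G P n B τ} ⊆
      {ω | ¬ ∀ t s, E.decode ((ω t).1 s).1 = s} ∪ ⋃ q ∈ T, bad q := by
    intro ω hω
    by_contra hnot
    rw [Set.mem_union, not_or] at hnot
    refine hω (Concentrated.of_testFunctions (fun g hg => (hG g hg).1) (not_not.1 hnot.1)
      fun c hc s hs f hf => ?_)
    by_contra hlt
    refine hnot.2 (Set.mem_biUnion (x := (c, s, f)) ?_ (not_le.1 hlt))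
    simp [T, hc, hs, hf]
  have hcard : (T.card : ℝ) ≤ B * (E.width * H) * (5 * G.card ^ 2 * P.card) := by
    have h1 : T.card ≤ B * (E.width * H) * (5 * G.card ^ 2 * P.card) := by
      simp only [T, Finset.card_product, Finset.card_range]
      rw [mul_assoc]
      gcongr
      · exact (Finset.card_le_univ _).trans E.card_le_width_mul
      · exact card_testFunctions_le G P hG1 hP1
    exact_mod_cast h1
  have h0 : E.tapeLaw {ω | ¬ ∀ t s, E.decode ((ω t).1 s).1 = s} = 0 := E.ae_decode
  calc E.tapeLaw {ω | ¬ E.Concentrated ω G P n B τ}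
      ≤ 0 + ∑ q ∈ T, E.tapeLaw (bad q) := by
        refine (measure_mono hsub).trans ((measure_union_le _ _).trans ?_)
        rw [h0]
        gcongr
        exact measure_biUnion_finset_le _ _
    _ ≤ ∑ q ∈ T, r := by
        rw [zero_add]
        refine Finset.sum_le_sum fun q hq => ?_
        simp only [T, Finset.mem_product, Finset.mem_filter] at hq
        exact measure_empMean_le hR hG hP hn hτ hq.2.1.2 _ hq.2.2
    _ = T.card * r := by rw [Finset.sum_const, nsmul_eq_mul]
    _ ≤ _ := by
        rw [hr, ← ENNReal.ofReal_natCast, ← ENNReal.ofReal_mul (by positivity)]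
        refine ENNReal.ofReal_le_ofReal ?_
        gcongr

end DetCDP
end TwoSampleRL

end

noncomputable section
namespace TwoSampleRL

/-! ### The choice of the parameters

The parameters are functions of the logarithmic factors `l = 1 + log (MKH/ε)`, `d = 1 + log (1/δ)`
and `c = 1 + log (|G||Π|/δ)`. -/

/-- The test threshold. -/
def threshold (M H ε l d : ℝ) : ℝ := ε ^ 3 / (11264 * M * H ^ 4 * l * d)

section Parameters

variable {M H K ε δ l d c : ℝ} (hM : 1 ≤ M) (hH : 1 ≤ H) (hε : 0 < ε) (hε1 : ε < 1) (hl : 1 ≤ l)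
  (hd : 1 ≤ d)
include hM hH hε hε1 hl hd

omit hM hH in
theorem one_le_ratio : 1 ≤ l * d / ε := by
  rw [le_div_iff₀ hε]
  nlinarith [one_le_mul_of_one_le_of_one_le hl hd]

omit hε1 in
theorem threshold_pos : 0 < threshold M H ε l d := by
  unfold threshold
  positivity

/-- The regression needs the number of learning data sets times `τ` to be at most `β ^ 2 / 4` with
`β = ε / (16 * H)`. That number is at most `11 * M * H ^ 2 * l * d / ε`, and `11264 = 11 * 4 * 16 ^
2`. -/
theorem mul_threshold_le {n : ℝ} (hn : n ≤ 9 * (l * d / ε)) :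
    (M + (1 + M * H * (H * n))) * threshold M H ε l d ≤ (ε / (16 * H)) ^ 2 / 4 := by
  have h0 := threshold_pos hM hH hε hl hd
  have h1 := one_le_ratio hε hε1 hl hd
  have h2 : M + (1 + M * H * (H * n)) ≤ 11 * (M * H ^ 2 * (l * d / ε)) := by
    have h3 : M * H * (H * n) ≤ M * H ^ 2 * (9 * (l * d / ε)) := by
      have : M * H * (H * n) = M * H ^ 2 * n := by ring
      rw [this]; gcongr
    have h4 : 1 ≤ H ^ 2 * (l * d / ε) :=
      one_le_mul_of_one_le_of_one_le (one_le_pow₀ hH) h1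
    have h5 : M * 1 ≤ M * (H ^ 2 * (l * d / ε)) := by gcongr
    linarith
  calc _ ≤ 11 * (M * H ^ 2 * (l * d / ε)) * threshold M H ε l d := by gcongr
    _ = (ε / (16 * H)) ^ 2 / 4 := by
        unfold threshold
        field_simp
        norm_num

theorem threshold_le : threshold M H ε l d ≤ ε / (16 * H) / 44 := by
  unfold threshold
  have h1 : 1 ≤ M * l * d * H ^ 3 := one_le_mul_of_one_le_of_one_le
    (one_le_mul_of_one_le_of_one_le (one_le_mul_of_one_le_of_one_le hM hl) hd) (one_le_pow₀ hH)
  have h2 : ε ^ 2 ≤ 1 := pow_le_one₀ hε.le hε1.le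
  rw [div_div, div_le_div_iff₀ (by positivity) (by positivity)]
  have h3 : ε * H * (ε ^ 2 * 704) ≤ ε * H * (11264 * (M * l * d * H ^ 3)) :=
    mul_le_mul_of_nonneg_left (by linarith) (by positivity)
  linarith

/-- With `β = ε / (16 * H)` the term `2 * β * H` equals ε/8 and `β ^ 2 * H` is at most ε/16; the
multiples of the threshold fit into the remaining ε/16. -/
theorem accuracy_le : 2 * threshold M H ε l d +
    H * (8 * threshold M H ε l d + 2 * (ε / (16 * H)) + (ε / (16 * H)) ^ 2) ≤ ε / 4 := by
  have h1 := threshold_le hM hH hε hε1 hl hd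
  set b := ε / (16 * H) with hb
  have hbH : H * b = ε / 16 := by rw [hb]; field_simp
  have hb0 : 0 < b := by positivity
  have hb1 : b ≤ 1 := by
    rw [hb, div_le_one (by positivity)]; linarith
  have hb2 : b ≤ H * b := by nlinarith
  have h3 : H * (8 * threshold M H ε l d + 2 * b + b ^ 2) ≤ H * (8 * (b / 44) + 2 * b + b) := by
    gcongr
    nlinarith
  linarith

omit hε1 in
theorem train_le (hK : 1 ≤ K) (hc : 1 ≤ c) {N : ℝ} (hN : N ≤ 129 * (K ^ 2 * H * l * c) / threshold M H ε l d ^ 2) :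
    N ≤ 129 * 11264 ^ 2 * (K ^ 2 * H ^ 9 * M ^ 2 * l ^ 3 * d ^ 2 * c / ε ^ 6) := by
  refine hN.trans (le_of_eq ?_)
  unfold threshold
  field_simp

omit hε1 in
theorem total_le (hK : 1 ≤ K) (hc : 1 ≤ c) {N n : ℝ}
    (hN : N ≤ 129 * (K ^ 2 * H * l * c) / threshold M H ε l d ^ 2)
    (hn1 : 1 ≤ n) (hn : n ≤ 9 * (l * d / ε)) :
    N * (1 + K + M * H * (1 + H * n * (1 + K)) + K * (M * H) + 1) ≤
      129 * 11264 ^ 2 * 63 * (M ^ 5 * H ^ 12 * K ^ 4 / ε ^ 7) * c * d ^ 3 * l ^ 4 := by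
  have h1 := train_le hM hH hε hl hd hK hc hN
  have hMHn : 1 ≤ M * H * (H * n) := one_le_mul_of_one_le_of_one_le
    (one_le_mul_of_one_le_of_one_le hM hH) (one_le_mul_of_one_le_of_one_le hH hn1)
  have h2 : 1 + K + M * H * (1 + H * n * (1 + K)) + K * (M * H) + 1 ≤
      7 * (M * H * (H * n) * K) := by
    have a1 : K * 1 ≤ K * (M * H * (H * n)) := by gcongr
    have a2 : M * H * 1 * 1 ≤ M * H * (H * n) * K := by
      gcongr
      exact one_le_mul_of_one_le_of_one_le hH hn1
    have a3 : K * (M * H) * 1 ≤ K * (M * H) * (H * n) := by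
      gcongr
      exact one_le_mul_of_one_le_of_one_le hH hn1
    have a4 : M * H * (H * n) * 1 ≤ M * H * (H * n) * K := by gcongr
    linarith
  have h3 : 7 * (M * H * (H * n) * K) ≤ 63 * (M * H ^ 2 * K * (l * d / ε)) := by
    have : 7 * (M * H * (H * n) * K) = 7 * (M * H ^ 2 * K) * n := by ring
    rw [this]
    calc _ ≤ 7 * (M * H ^ 2 * K) * (9 * (l * d / ε)) := by gcongr
      _ = _ := by ring
  calc _ ≤ 129 * 11264 ^ 2 * (K ^ 2 * H ^ 9 * M ^ 2 * l ^ 3 * d ^ 2 * c / ε ^ 6) *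
        (63 * (M * H ^ 2 * K * (l * d / ε))) := by
        gcongr
        exact h2.trans h3
    -- The count obtained is smaller in M, H and K than the stated one, which follows by enlarging
    -- the exponents.
    _ = 129 * 11264 ^ 2 * 63 * (M ^ 3 * H ^ 11 * K ^ 3 / ε ^ 7) * c * d ^ 3 * l ^ 4 := by
        field_simp
    _ ≤ _ := by
        gcongr <;> norm_num

end Parameters

section Probabilities

variable {M H K ε δ l d c : ℝ}

theorem exp_one_add_log {x : ℝ} (hx : 0 < x) : Real.exp (1 + Real.log x) = Real.exp 1 * x := by
  rw [Real.exp_add, Real.exp_log hx]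

theorem four_le_exp_two : (4 : ℝ) ≤ Real.exp 2 := by
  have h1 := Real.exp_one_gt_d9
  have h2 : Real.exp 2 = Real.exp 1 * Real.exp 1 := by rw [← Real.exp_add]; norm_num
  rw [h2]; nlinarith

theorem twentySeven_le_exp_four : (27 : ℝ) ≤ Real.exp 4 := by
  have h1 := Real.exp_one_gt_d9
  have h2 : Real.exp 4 = Real.exp 1 ^ 4 := by rw [← Real.exp_nat_mul]; norm_num
  rw [h2]
  calc (27 : ℝ) ≤ 2.7 ^ 4 := by norm_num
    _ ≤ _ := by gcongr; linarith

theorem twenty_le_exp_three : (20 : ℝ) ≤ Real.exp 3 := by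
  have h1 := Real.exp_one_gt_d9
  have h2 : Real.exp 3 = Real.exp 1 ^ 3 := by rw [← Real.exp_nat_mul]; norm_num
  rw [h2]
  calc (20 : ℝ) ≤ 2.718 ^ 3 := by norm_num
    _ ≤ _ := by gcongr; linarith

/-- The probability that the exploration misses an exit. -/
theorem miss_le {M H K ε δ : ℝ} (hM : 1 ≤ M) (hH : 1 ≤ H) (hK : 1 ≤ K) (hε : 0 < ε) (hε1 : ε < 1)
    (hδ : 0 < δ) (hδ1 : δ < 1) {n : ℕ}
    (hn : 8 * ((1 + Real.log (M * K * H / ε)) * (1 + Real.log (1 / δ)) / ε) ≤ n) :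
    M * H * (1 - ε / 4) ^ n ≤ δ / 4 := by
  set l := 1 + Real.log (M * K * H / ε) with hl
  set d := 1 + Real.log (1 / δ) with hd
  have hx : M * H ≤ M * K * H / ε := by
    rw [le_div_iff₀ hε]
    calc M * H * ε ≤ M * H * 1 := by gcongr
      _ ≤ M * H * K := by gcongr
      _ = _ := by ring
  have hMH : 1 ≤ M * H := one_le_mul_of_one_le_of_one_le hM hH
  have hl1 : 1 ≤ l := by have := Real.log_nonneg (hMH.trans hx); linarith
  have hd1 : 1 ≤ d := by
    have := Real.log_nonneg (x := 1 / δ) (by rw [le_div_iff₀ hδ]; linarith); linarith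
  have h1 : (1 - ε / 4) ^ n ≤ Real.exp (-(l + d)) := by
    calc (1 - ε / 4) ^ n ≤ Real.exp (-(ε / 4)) ^ n := by
          refine pow_le_pow_left₀ (by linarith) (Real.one_sub_le_exp_neg _) n
      _ = Real.exp (-(n * (ε / 4))) := by rw [← Real.exp_nat_mul]; ring_nf
      _ ≤ _ := by
          refine Real.exp_le_exp.2 (neg_le_neg ?_)
          -- The exponent is at least `2 * (l * d)`, and this is at least `l + d` because `l, d ≥
          -- 1`.
          have h2 : 8 * (l * d / ε) * (ε / 4) ≤ n * (ε / 4) := by gcongr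
          have h3 : 8 * (l * d / ε) * (ε / 4) = 2 * (l * d) := by field_simp; norm_num
          nlinarith
  have h2 : 4 * (M * H) * (1 / δ) ≤ Real.exp (l + d) := by
    have e1 : l + d = 2 + (Real.log (M * K * H / ε) + Real.log (1 / δ)) := by rw [hl, hd]; ring
    rw [e1, Real.exp_add, Real.exp_add, Real.exp_log (by positivity), Real.exp_log (by positivity),
      mul_assoc]
    have := four_le_exp_two
    gcongr
  rw [Real.exp_neg] at h1
  calc M * H * (1 - ε / 4) ^ n ≤ M * H * (Real.exp (l + d))⁻¹ := by gcongr
    _ ≤ M * H * (4 * (M * H) * (1 / δ))⁻¹ := by gcongr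
    _ = δ / 4 := by field_simp

/-- A bound for the total number of tests. -/
theorem count_le {M H K ε d c l : ℝ} (hM : 1 ≤ M) (hH : 1 ≤ H) (hK : 1 ≤ K) (hε : 0 < ε)
    (hε1 : ε < 1) (hl : l = 1 + Real.log (M * K * H / ε)) (hd : 1 ≤ d) (hdc : d ≤ c) {n : ℝ}
    (hn1 : 1 ≤ n) (hn : n ≤ 9 * (l * d / ε)) {j : ℕ} (hj : H = j) {p q : ℝ} (hp : 1 ≤ p)
    (hq : p * q ≤ Real.exp (c - 1)) (hq1 : 1 ≤ q) :
    20 * ((K + 1) ^ j + M * H * (1 + H * n * (K + 1) ^ j)) * (M * H) * (p ^ 2 * q) ≤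
      Real.exp (16 * (H * l * c)) := by
  have hx0 : 0 < M * K * H / ε := by positivity
  have hexp : Real.exp l = Real.exp 1 * (M * K * H / ε) := by rw [hl, exp_one_add_log hx0]
  have he := Real.exp_one_gt_d9
  have hMH1 : 1 ≤ M * H := one_le_mul_of_one_le_of_one_le hM hH
  have hx : M * K * H ≤ M * K * H / ε := by
    rw [le_div_iff₀ hε]
    have : 0 < M * K * H := by positivity
    nlinarith
  have hy : M * K * H ≤ Real.exp l := by
    rw [hexp]
    nlinarith
  have hMH : M * H ≤ Real.exp l := by
    refine le_trans ?_ hy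
    calc M * H = M * 1 * H := by ring
      _ ≤ _ := by gcongr
  have hHl : H ≤ Real.exp l := by
    refine le_trans ?_ hMH
    nlinarith
  have hKl : K + 1 ≤ Real.exp l := by
    rw [hexp]
    have h1 : K ≤ M * K * H := by
      calc K = 1 * K * 1 := by ring
        _ ≤ _ := by gcongr
    have h2 : 2 * K ≤ Real.exp 1 * (M * K * H / ε) := by gcongr <;> linarith
    linarith
  have hεl : 1 / ε ≤ Real.exp l := by
    rw [hexp]
    have h1 : 1 / ε ≤ M * K * H / ε := by
      gcongr
      exact one_le_mul_of_one_le_of_one_le (one_le_mul_of_one_le_of_one_le hM hK) hH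
    have h2 : 0 < M * K * H / ε := hx0
    nlinarith
  have hl1 : 1 ≤ l := by
    have h1 : 1 ≤ M * K * H :=
      one_le_mul_of_one_le_of_one_le (one_le_mul_of_one_le_of_one_le hM hK) hH
    have := Real.log_nonneg (h1.trans hx)
    linarith
  have hc1 : 1 ≤ c := hd.trans hdc
  have hll : l ≤ Real.exp l := by linarith [Real.add_one_le_exp l]
  have hdd : d ≤ Real.exp c := by linarith [Real.add_one_le_exp c]
  have hKj : (K + 1) ^ j ≤ Real.exp (H * l) := by
    rw [hj, Real.exp_nat_mul]
    gcongr
  have hn' : n ≤ 9 * (Real.exp l * Real.exp c * Real.exp l) := by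
    refine hn.trans ?_
    rw [div_eq_mul_one_div]
    gcongr
  have hKj1 : 1 ≤ (K + 1) ^ j := one_le_pow₀ (by linarith)
  have hB : (K + 1) ^ j + M * H * (1 + H * n * (K + 1) ^ j) ≤
      3 * ((K + 1) ^ j * (M * H) * H * n) := by
    have h1 : (K + 1) ^ j * 1 ≤ (K + 1) ^ j * (M * H * (H * n)) := by
      gcongr
      exact one_le_mul_of_one_le_of_one_le hMH1 (one_le_mul_of_one_le_of_one_le hH hn1)
    have h2 : M * H * 1 ≤ M * H * ((K + 1) ^ j * (H * n)) := by
      gcongr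
      exact one_le_mul_of_one_le_of_one_le hKj1 (one_le_mul_of_one_le_of_one_le hH hn1)
    linarith
  have hpq : p ^ 2 * q ≤ Real.exp (2 * c) := by
    calc p ^ 2 * q ≤ (p * q) ^ 2 := by
          rw [mul_pow]
          gcongr
          nlinarith
      _ ≤ Real.exp (c - 1) ^ 2 := by gcongr
      _ = Real.exp (2 * (c - 1)) := by rw [← Real.exp_nat_mul]; norm_num
      _ ≤ _ := Real.exp_le_exp.2 (by linarith)
  calc 20 * ((K + 1) ^ j + M * H * (1 + H * n * (K + 1) ^ j)) * (M * H) * (p ^ 2 * q)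
      ≤ 20 * (3 * (Real.exp (H * l) * Real.exp l * Real.exp l *
          (9 * (Real.exp l * Real.exp c * Real.exp l)))) * Real.exp l * Real.exp (2 * c) := by
        have hb : (K + 1) ^ j + M * H * (1 + H * n * (K + 1) ^ j) ≤
            3 * (Real.exp (H * l) * Real.exp l * Real.exp l *
              (9 * (Real.exp l * Real.exp c * Real.exp l))) := by
          refine hB.trans ?_
          gcongr
        gcongr
    _ = 20 * 27 * (Real.exp (H * l) * Real.exp l * Real.exp l *
          (Real.exp l * Real.exp c * Real.exp l) * Real.exp l * Real.exp (2 * c)) := by ring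
    _ ≤ Real.exp 3 * Real.exp 4 * (Real.exp (H * l) * Real.exp l * Real.exp l *
          (Real.exp l * Real.exp c * Real.exp l) * Real.exp l * Real.exp (2 * c)) := by
        gcongr
        · exact twenty_le_exp_three
        · exact twentySeven_le_exp_four
    -- Each of 1, `H * l`, `l`, `c` is at most `H * l * c`, and 7 + 1 + 5 + 3 = 16. The worst-case
    -- number of blocks contributes `H * l`: this is its whole price.
    _ = Real.exp (7 + H * l + 5 * l + 3 * c) := by
        simp only [← Real.exp_add]
        congr 1
        ring
    _ ≤ _ := by
        refine Real.exp_le_exp.2 ?_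
        have hlc : 1 ≤ l * c := one_le_mul_of_one_le_of_one_le hl1 hc1
        have hHl1 : 1 ≤ H * l := one_le_mul_of_one_le_of_one_le hH hl1
        have hHlc : 1 ≤ H * l * c := one_le_mul_of_one_le_of_one_le hHl1 hc1
        have a1 : H * l * 1 ≤ H * l * c := by gcongr
        have a2 : 1 * l * 1 ≤ H * l * c := by gcongr
        have a3 : 1 * c ≤ H * l * c := by gcongr
        linarith

end Probabilities
end TwoSampleRL

end

/-! ### The parameters meet all requirements. -/

noncomputable section
namespace TwoSampleRL

/-- The parameters of the algorithm. -/
def parameters (M H K NG NP : ℕ) (ε δ : ℝ) : Params :=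
  let l := 1 + Real.log (M * K * H / ε)
  let d := 1 + Real.log (1 / δ)
  let c := 1 + Real.log (NG * NP / δ)
  let N := ⌈128 * (K ^ 2 * H * l * c) / threshold M H ε l d ^ 2⌉₊
  { τ := threshold M H ε l d, nTrain := N, nEval := N, nExp := ⌈8 * (l * d / ε)⌉₊ }

section Bounds

variable {M H K NG NP : ℕ} {ε δ : ℝ} (hM : 1 ≤ M) (hH : 1 ≤ H) (hK : 1 ≤ K) (hNG : 1 ≤ NG)
  (hNP : 1 ≤ NP) (hε : 0 < ε) (hε1 : ε < 1) (hδ : 0 < δ) (hδ1 : δ < 1)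
include hM hH hK hNG hNP hε hε1 hδ hδ1

/-- The properties of the parameters that the analysis uses. -/
theorem parameters_spec :
    let θ := parameters M H K NG NP ε δ
    let B := (K + 1) ^ H + M * H * (1 + H * θ.nExp * (K + 1) ^ H)
    0 ≤ θ.τ ∧ 0 < θ.nTrain ∧ θ.nExp ≤ θ.nTrain ∧
    ((M + (1 + M * H * (H * θ.nExp)) : ℕ) : ℝ) * θ.τ ≤ (ε / (16 * H)) ^ 2 / 4 ∧
    2 * θ.τ + H * (8 * θ.τ + 2 * (ε / (16 * H)) + (ε / (16 * H)) ^ 2) ≤ ε / 4 ∧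
    B * (M * H) * (5 * NG ^ 2 * NP) *
      (2 * Real.exp (-(2 * θ.nTrain * θ.τ ^ 2 / (4 * K) ^ 2))) ≤ δ / 2 ∧
    M * H * (2 * Real.exp (-(2 * θ.nTrain * θ.τ ^ 2)) + (1 - ε / 4) ^ θ.nExp) ≤ δ / 2 ∧
    ((θ.nTrain * (1 + K + M * H * (1 + H * θ.nExp * (1 + K)) + K * (M * H) + 1) : ℕ) : ℝ) ≤
      129 * 11264 ^ 2 * 63 * ((M : ℝ) ^ 5 * (H : ℝ) ^ 12 * (K : ℝ) ^ 4 / ε ^ 7)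
        * (1 + Real.log (NG * NP / δ)) * (1 + Real.log (1 / δ)) ^ 3
        * (1 + Real.log (M * K * H / ε)) ^ 4 := by
  have hM' : (1 : ℝ) ≤ M := by exact_mod_cast hM
  have hH' : (1 : ℝ) ≤ H := by exact_mod_cast hH
  have hK' : (1 : ℝ) ≤ K := by exact_mod_cast hK
  have hNG' : (1 : ℝ) ≤ NG := by exact_mod_cast hNG
  have hNP' : (1 : ℝ) ≤ NP := by exact_mod_cast hNP
  intro θ
  obtain ⟨l, hl⟩ : ∃ l, l = 1 + Real.log (M * K * H / ε) := ⟨_, rfl⟩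
  obtain ⟨d, hd⟩ : ∃ d, d = 1 + Real.log (1 / δ) := ⟨_, rfl⟩
  obtain ⟨c, hc⟩ : ∃ c, c = 1 + Real.log (NG * NP / δ) := ⟨_, rfl⟩
  have hτ : θ.τ = threshold M H ε l d := by rw [hl, hd]; rfl
  have hN : θ.nTrain = ⌈128 * (K ^ 2 * H * l * c) / threshold M H ε l d ^ 2⌉₊ := by
    rw [hl, hd, hc]; rfl
  have hn : θ.nExp = ⌈8 * (l * d / ε)⌉₊ := by rw [hl, hd]; rfl
  generalize θ.nExp = n at hn ⊢
  generalize θ.nTrain = N at hN ⊢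
  rw [hτ]
  have hGP : 1 ≤ (NG : ℝ) * NP := one_le_mul_of_one_le_of_one_le hNG' hNP'
  have hδd : 1 ≤ 1 / δ := by rw [le_div_iff₀ hδ]; linarith
  have hl1 : 1 ≤ l := by
    have h1 : (1 : ℝ) ≤ M * K * H :=
      one_le_mul_of_one_le_of_one_le (one_le_mul_of_one_le_of_one_le hM' hK') hH'
    have := Real.log_nonneg (x := M * K * H / ε) (by rw [le_div_iff₀ hε]; linarith)
    linarith
  have hd1 : 1 ≤ d := by
    have := Real.log_nonneg hδd
    linarith
  have hdc : d ≤ c := by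
    have := Real.log_le_log (by positivity) (show 1 / δ ≤ NG * NP / δ by gcongr)
    linarith
  have hc1 : 1 ≤ c := hd1.trans hdc
  have hr1 := one_le_ratio hε hε1 hl1 hd1
  set r := l * d / ε with hr
  set τ := threshold M H ε l d with hτdef
  have hτ0 : 0 < τ := threshold_pos hM' hH' hε hl1 hd1
  have hn8 : 8 * r ≤ n := by rw [hn]; exact Nat.le_ceil _
  have hn9 : (n : ℝ) ≤ 9 * r := by
    have := Nat.ceil_lt_add_one (a := 8 * r) (by positivity)
    rw [← hn] at this
    linarith
  have hn1 : (1 : ℝ) ≤ n := by linarith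
  set z := (K : ℝ) ^ 2 * H * l * c with hz
  have hz1 : 1 ≤ z := one_le_mul_of_one_le_of_one_le (one_le_mul_of_one_le_of_one_le
    (one_le_mul_of_one_le_of_one_le (one_le_pow₀ hK') hH') hl1) hc1
  have hτ1 : τ ≤ 1 / 44 := by
    refine (threshold_le hM' hH' hε hε1 hl1 hd1).trans ?_
    gcongr
    rw [div_le_one (by positivity)]
    linarith
  have hτsq : τ ^ 2 ≤ 1 := pow_le_one₀ hτ0.le (by linarith)
  have hN128 : 128 * z / τ ^ 2 ≤ N := by rw [hN]; exact Nat.le_ceil _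
  have hN129 : (N : ℝ) ≤ 129 * z / τ ^ 2 := by
    have h1 := Nat.ceil_lt_add_one (a := 128 * z / τ ^ 2) (by positivity)
    rw [← hN] at h1
    have h2 : 1 ≤ z / τ ^ 2 := by rw [le_div_iff₀ (by positivity)]; linarith
    have h3 : 129 * z / τ ^ 2 = 128 * z / τ ^ 2 + z / τ ^ 2 := by ring
    linarith
  -- As 128 = 8 * 16, the Hoeffding exponent `2 * N * τ ^ 2 / (4 * K) ^ 2` is at least `16 * H * l *
  -- c`, the exponent in `count_le`.
  have hNτ : 128 * z ≤ N * τ ^ 2 := by rwa [div_le_iff₀ (by positivity)] at hN128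
  have hN0 : (0 : ℝ) < N := lt_of_lt_of_le (by positivity) hN128
  have hcount := count_le (n := (n : ℝ)) (j := H) (p := NG) (q := NP / δ) hM' hH' hK' hε hε1 hl hd1
    hdc hn1 hn9 rfl hNG' (by
      rw [hc, add_sub_cancel_left, Real.exp_log (by positivity), mul_div_assoc]) (by
      rw [le_div_iff₀ hδ]; linarith)
  set B : ℝ := ((K : ℝ) + 1) ^ H + M * H * (1 + H * n * (K + 1) ^ H) with hB
  have hB1 : 1 ≤ B := by
    have : 1 ≤ ((K : ℝ) + 1) ^ H := one_le_pow₀ (by linarith)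
    have : (0 : ℝ) ≤ M * H * (1 + H * n * (K + 1) ^ H) := by positivity
    linarith
  set w := (H : ℝ) * l * c with hw
  -- The 20 is 5 from the number of test functions, 2 from the two-sided inequality and 2 from the
  -- target `δ / 2`.
  have hcount' : 20 * B * (M * H) * (NG ^ 2 * NP) * Real.exp (-(16 * w)) ≤ δ := by
    rw [Real.exp_neg, ← div_eq_mul_inv, div_le_iff₀ (Real.exp_pos _)]
    calc 20 * B * (M * H) * (NG ^ 2 * NP) = δ * (20 * B * (M * H) * (NG ^ 2 * (NP / δ))) := by
          field_simp
      _ ≤ _ := by gcongr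
  have hzw : z = K ^ 2 * w := by rw [hz, hw]; ring
  refine ⟨hτ0.le, by exact_mod_cast hN0, ?_, ?_, accuracy_le hM' hH' hε hε1 hl1 hd1, ?_, ?_, ?_⟩
  · have h1 : 9 * r ≤ 128 * z / τ ^ 2 := by
      rw [le_div_iff₀ (by positivity)]
      have h2 : r * τ ≤ 1 := by
        have h3 : (M : ℝ) + (1 + M * H * (H * n)) ≥ r := by
          have h4 : (1 : ℝ) * 1 * (1 * n) ≤ M * H * (H * n) := by gcongr
          linarith
        have h5 := mul_threshold_le hM' hH' hε hε1 hl1 hd1 hn9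
        have h6 : ε / (16 * H) ≤ 1 := by rw [div_le_one (by positivity)]; linarith
        have h7 : (ε / (16 * H)) ^ 2 ≤ 1 := pow_le_one₀ (by positivity) h6
        have h8 : r * τ ≤ (M + (1 + M * H * (H * n))) * τ := by gcongr
        linarith
      have h9 : r * τ * τ ≤ 1 * 1 := by
        gcongr
        linarith
      nlinarith
    exact_mod_cast hn9.trans (h1.trans hN128)
  · push_cast
    exact mul_threshold_le hM' hH' hε hε1 hl1 hd1 hn9
  · have h1 : Real.exp (-(2 * N * τ ^ 2 / (4 * K) ^ 2)) ≤ Real.exp (-(16 * w)) := by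
      refine Real.exp_le_exp.2 (neg_le_neg ?_)
      rw [le_div_iff₀ (by positivity)]
      rw [hzw] at hNτ
      linarith
    push_cast
    rw [← hB]
    calc B * (M * H) * (5 * NG ^ 2 * NP) * (2 * Real.exp (-(2 * N * τ ^ 2 / (4 * K) ^ 2)))
        ≤ B * (M * H) * (5 * NG ^ 2 * NP) * (2 * Real.exp (-(16 * w))) := by gcongr
      _ = 20 * B * (M * H) * (NG ^ 2 * NP) * Real.exp (-(16 * w)) / 2 := by ring
      _ ≤ _ := by gcongr
  · have h1 : Real.exp (-(2 * N * τ ^ 2)) ≤ Real.exp (-(16 * w)) := by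
      refine Real.exp_le_exp.2 (neg_le_neg ?_)
      have h2 : 1 * w ≤ K ^ 2 * w := by
        gcongr
        exact one_le_pow₀ hK'
      have h3 : 0 ≤ w := by positivity
      linarith
    have h2 := miss_le hM' hH' hK' hε hε1 hδ hδ1 (n := n) (by rw [← hl, ← hd]; exact hn8)
    have h3 : M * H * (2 * Real.exp (-(2 * N * τ ^ 2))) ≤ δ / 4 := by
      calc M * H * (2 * Real.exp (-(2 * N * τ ^ 2)))
          ≤ M * H * (2 * Real.exp (-(16 * w))) := by gcongr
        _ = 8 * 1 * (M * H) * (1 * 1) * Real.exp (-(16 * w)) / 4 := by ring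
        _ ≤ 20 * B * (M * H) * (NG ^ 2 * NP) * Real.exp (-(16 * w)) / 4 := by
            gcongr
            · norm_num
            · exact one_le_pow₀ hNG'
        _ ≤ _ := by gcongr
    linarith
  · rw [← hl, ← hd, ← hc]
    push_cast
    exact total_le hM' hH' hε hl1 hd1 hK' hc1 hN129 hn1 hn9

end Bounds
end TwoSampleRL

end

/-! ### The failure probability. -/

noncomputable section
namespace TwoSampleRL
namespace DetCDP

variable {H K : ℕ} {S X : Type*} [MeasurableSpace X] [Fintype S] (E : DetCDP H K S X)
  {G : Finset (X → ℝ)} {P : Finset (X → Fin K)}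

theorem one_le_width (hH : 1 ≤ H) : 1 ≤ E.width := by
  classical
  refine le_trans ?_ (Finset.le_sup (f := fun h => (Finset.univ.filter fun s => E.level s = h).card)
    (Finset.mem_range.2 hH))
  exact Finset.card_pos.2 ⟨E.init, by simp [E.level_init]⟩

variable {E}

omit [Fintype S] in
-- Completeness at the last level, for the target 0, already needs a member of each class. This
-- excludes empty classes, for which the logarithm of their sizes would carry no information.
theorem PolicyValueComplete.one_le_card (hC : E.PolicyValueComplete G P) (hH : 1 ≤ H) :
    1 ≤ G.card ∧ 1 ≤ P.card := by
  obtain ⟨π, hπ, g, hg, -⟩ := hC (H - 1) (by omega) (fun _ => 0)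
    (by rw [if_neg (by omega)]; rfl)
  exact ⟨Finset.card_pos.2 ⟨g, hg⟩, Finset.card_pos.2 ⟨π, hπ⟩⟩

variable [NeZero K]

/-- With the parameters chosen above, all events of the analysis hold with high probability. -/
theorem measure_failure_le (hH : 1 ≤ H) {ε δ : ℝ} (hε : 0 < ε) (hε1 : ε < 1) (hδ : 0 < δ)
    (hδ1 : δ < 1) (hR : E.RegularRewards)
    (hG : ∀ g ∈ G, Measurable g ∧ ∀ x, g x ∈ Set.Icc (0 : ℝ) 1) (hP : ∀ π ∈ P, Measurable π)
    (hC : E.PolicyValueComplete G P) {θ : Params}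
    (hθ : θ = parameters E.width H K G.card P.card ε δ) (O : Oracles K θ.nTrain G P) :
    E.tapeLaw {ω | ¬ ∃ π : Policy K X,
      (runAlgorithm (E.access ω) E.width H ε θ O).1 = some π ∧
      E.optimalValue - E.value π ≤ ε ∧
      ((runAlgorithm (E.access ω) E.width H ε θ O).2 : ℝ) ≤
        129 * 11264 ^ 2 * 63 * ((E.width : ℝ) ^ 5 * (H : ℝ) ^ 12 * (K : ℝ) ^ 4 / ε ^ 7)
          * (1 + Real.log (G.card * P.card / δ)) * (1 + Real.log (1 / δ)) ^ 3
          * (1 + Real.log (E.width * K * H / ε)) ^ 4} ≤ ENNReal.ofReal δ := by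
  obtain ⟨hNG, hNP⟩ := hC.one_le_card hH
  obtain ⟨hτ, hN, hn, hL, hκ, hconc, hrep, htotal⟩ := parameters_spec (E.one_le_width hH) hH
    (NeZero.one_le : 1 ≤ K) hNG hNP hε hε1 hδ hδ1
  have heval : θ.nEval = θ.nTrain := by rw [hθ]; rfl
  rw [← hθ] at hτ hN hn hL hκ hconc hrep htotal
  have : NeZero θ.nTrain := ⟨hN.ne'⟩
  set B := (K + 1) ^ H + E.width * H * (1 + H * θ.nExp * (K + 1) ^ H) with hB
  have hH' : (0 : ℝ) < H := Nat.cast_pos.2 hH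
  have hsub : {ω | ¬ ∃ π : Policy K X,
      (runAlgorithm (E.access ω) E.width H ε θ O).1 = some π ∧
      E.optimalValue - E.value π ≤ ε ∧
      ((runAlgorithm (E.access ω) E.width H ε θ O).2 : ℝ) ≤
        129 * 11264 ^ 2 * 63 * ((E.width : ℝ) ^ 5 * (H : ℝ) ^ 12 * (K : ℝ) ^ 4 / ε ^ 7)
          * (1 + Real.log (G.card * P.card / δ)) * (1 + Real.log (1 / δ)) ^ 3
          * (1 + Real.log (E.width * K * H / ε)) ^ 4} ⊆
      {ω | ¬ E.Concentrated ω G P θ.nTrain B θ.τ} ∪ ⋃ k ∈ Finset.range (E.width * H),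
        {ω | ¬ E.Representative ω ε θ O (memoryAt (E.access ω) H θ O k)} := by
    intro ω hω
    by_contra hnot
    rw [Set.mem_union, not_or] at hnot
    have hrep' : ∀ k < E.width * H,
        E.Representative ω ε θ O (memoryAt (E.access ω) H θ O k) := fun k hk => by
      by_contra h
      exact hnot.2 (Set.mem_biUnion (x := k) (by simpa using hk) h)
    obtain ⟨π, h1, h2, h3⟩ := runAlgorithm_correct hR hG hP hC (not_not.1 hnot.1) hτ hH heval hn O
      rfl le_rfl hε (β := ε / (16 * H)) (by positivity) hL le_rfl hκ hrep'
    exact hω ⟨π, h1, h2, le_trans (Nat.cast_le.2 h3) htotal⟩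
  refine (measure_mono hsub).trans ((measure_union_le _ _).trans ?_)
  have h1 := (measure_not_concentrated_le hR hG hP hNG hNP hN hτ B).trans
    (ENNReal.ofReal_le_ofReal hconc)
  have h2 : E.tapeLaw (⋃ k ∈ Finset.range (E.width * H),
      {ω | ¬ E.Representative ω ε θ O (memoryAt (E.access ω) H θ O k)}) ≤
      ENNReal.ofReal (δ / 2) := by
    refine (measure_biUnion_finset_le _ _).trans ((Finset.sum_le_sum fun k _ =>
      measure_not_representative_le hR (fun g hg => (hG g hg).1) hP O hτ (by linarith)
        (heval ▸ hN) (heval ▸ hn) k).trans ?_)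
    rw [Finset.sum_const, Finset.card_range, nsmul_eq_mul, ← ENNReal.ofReal_natCast,
      ← ENNReal.ofReal_mul (Nat.cast_nonneg _), heval]
    refine ENNReal.ofReal_le_ofReal ?_
    push_cast
    exact hrep
  calc _ ≤ ENNReal.ofReal (δ / 2) + ENNReal.ofReal (δ / 2) := add_le_add h1 h2
    _ = ENNReal.ofReal δ := by
        rw [← ENNReal.ofReal_add (by positivity) (by positivity), add_halves]

end DetCDP
end TwoSampleRL

end

theorem mainTheorem8 :
    ∃ (C : ℝ) (q : ℕ), ∀ (M H K : ℕ) [NeZero K], 1 ≤ H → ∀ (NG NP : ℕ) (ε δ : ℝ),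
      0 < ε → ε < 1 → 0 < δ → δ < 1 →
      ∃ θ : TwoSampleRL.Params,
        ∀ (S : Type*) [Fintype S] (X : Type*) [MeasurableSpace X]
          (E : TwoSampleRL.DetCDP H K S X) (G : Finset (X → ℝ)) (P : Finset (X → Fin K)),
          E.width = M → E.RegularRewards →
          G.card = NG → P.card = NP →
          (∀ g ∈ G, Measurable g ∧ ∀ x, g x ∈ Set.Icc (0 : ℝ) 1) →
          (∀ π ∈ P, Measurable π) →
          E.PolicyValueComplete G P →
          ∀ O : TwoSampleRL.Oracles K θ.nTrain G P,
            E.tapeLaw {ω | ¬ ∃ π : TwoSampleRL.Policy K X,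
              (TwoSampleRL.runAlgorithm (E.access ω) M H ε θ O).1 = some π ∧
              E.optimalValue - E.value π ≤ ε ∧
              ((TwoSampleRL.runAlgorithm (E.access ω) M H ε θ O).2 : ℝ) ≤
                C * ((M : ℝ) ^ 5 * (H : ℝ) ^ 12 * (K : ℝ) ^ 4 / ε ^ 7)
                  * (1 + Real.log (NG * NP / δ)) * (1 + Real.log (1 / δ)) ^ 3
                  * (1 + Real.log (M * K * H / ε)) ^ q} ≤ ENNReal.ofReal δ := by
  -- The exponent 4: `nTrain` contributes three factors `l` (two from the inverse square of the
  -- threshold, one from the logarithm of the number of tests), and `nExp` contributes one.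
  refine ⟨129 * 11264 ^ 2 * 63, 4, fun M H K _ hH NG NP ε δ hε hε1 hδ hδ1 =>
    ⟨TwoSampleRL.parameters M H K NG NP ε δ, ?_⟩⟩
  intro S _ X _ E G P hM hR hNG hNP hG hP hC O
  subst hM hNG hNP
  exact TwoSampleRL.DetCDP.measure_failure_le hH hε hε1 hδ hδ1 hR hG hP hC rfl O
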